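/- Let \(k\in(0,\tfrac12)\), let \[ Q_k(x,y)=2\,\partial_x^2\ln\Bigl(\cosh(kx)+\sqrt{\tfrac{1-4k^2}{1-k^2}}\;\cos\bigl(k\sqrt{1-k^2}\,y\bigr)\Bigr),\qquad (x,y)\in\mathbb R^2, \] and let \(t_k=\dfrac{2\pi}{k\sqrt{1-k^2}}\). Then \(Q_k\) is nondegenerate in the following sense. Suppose that \(\varphi:\mathbb R^2\to\mathbb R\) is of class \(C^4\), is \(t_k\)-periodic in \(y\), decays in the \(x\) variable, meaning that \(\varphi\) is bounded on \(\mathbb R^2\) and, for each fixed \(y\), \(\varphi(x,y)\to0\) as \(|x|\to\infty\), and satisfies the linearization at \(Q_k\) of the KP-I travelling wave equation \(\partial_x^2(\partial_x^2u-u+3u^2)-\partial_y^2u=0\), that is, \[ \partial_x^2\bigl(\partial_x^2\varphi-\varphi+6Q_k\varphi\bigr)-\partial_y^2\varphi=0\qquad\text{on }\mathbb R^2 . \] Then there are real constants \(c_1,c_2\) such that \(\varphi=c_1\,\partial_xQ_k+c_2\,\partial_yQ_k\) on \(\mathbb R^2\). -/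

import Mathlib

noncomputable section

namespace KPI

/-- Partial derivative `∂f/∂x` of a function of two real variables `(x, y)`. -/
def dx (f : ℝ → ℝ → ℝ) : ℝ → ℝ → ℝ := fun x y => deriv (fun s => f s y) x

/-- Partial derivative `∂f/∂y` of a function of two real variables `(x, y)`. -/
def dy (f : ℝ → ℝ → ℝ) : ℝ → ℝ → ℝ := fun x y => deriv (fun s => f x s) y

/-- The tau function `cosh (k x) + √((1 - 4k²)/(1 - k²)) cos (k √(1 - k²) y)`. -/
def tau (k : ℝ) : ℝ → ℝ → ℝ := fun x y =>
  Real.cosh (k * x) +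
    Real.sqrt ((1 - 4 * k ^ 2) / (1 - k ^ 2)) * Real.cos (k * Real.sqrt (1 - k ^ 2) * y)

/-- The profile `Q_k = 2 ∂ₓ² ln τ_k`. -/
def Q (k : ℝ) : ℝ → ℝ → ℝ := fun x y => 2 * dx (dx (fun x y => Real.log (tau k x y))) x y

/-- The `y`-period `t_k = 2π / (k √(1 - k²))`. -/
def period (k : ℝ) : ℝ := 2 * Real.pi / (k * Real.sqrt (1 - k ^ 2))

/-- The linearization at the profile `q` of the travelling wave KP-I equation (speed one):
`∂ₓ² (∂ₓ² φ - φ + 6 q φ) - ∂_y² φ`. -/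
def linearized (q φ : ℝ → ℝ → ℝ) : ℝ → ℝ → ℝ := fun x y =>
  dx (dx (fun x y => dx (dx φ) x y - φ x y + 6 * q x y * φ x y)) x y - dy (dy φ) x y

/-- Decay in the `x` variable: the function is bounded and, for each fixed `y`,
it tends to zero as `|x| → ∞`. -/
def DecaysInX (φ : ℝ → ℝ → ℝ) : Prop :=
  (∃ C : ℝ, ∀ x y, |φ x y| ≤ C) ∧
    ∀ y, Filter.Tendsto (fun x => φ x y) (Filter.cocompact ℝ) (nhds 0)

end KPI

end

/-! Write τ for `tau k`, w for `freq k`, a for `ampl k`, and S = ∂ₓ² - 1 + 6Q. Since Q = 2∂ₓ² ln τ,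
the derivatives ∂ₓQ and ∂_yQ are, up to constants, ∂ₓ² of sinh(kx)/τ and a sin(wy)/τ. So the task is
to find a potential ψ with φ = ∂ₓ²ψ and Sφ = ∂_y²ψ, and to show that θ = τψ is a combination of
sinh(kx) and sin(wy).

The algebraic input is a Bäcklund-type identity (`TauRing.intertwine`): for every e, the adjoint
linearization S∂ₓ² - ∂_y² applied to `dress e`/τ equals τ⁻² `factorNum` of (∂ₓ⁴ - ∂ₓ² - ∂_y²)e. Test
φ against this with e = f(x)exp(inwy). The functional f ↦ ⟨φ, τ⁻² `factorNum`(f exp(inwy))⟩ vanishes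
on the range of the constant coefficient operator P_n(D) = D⁴ - D² + n²w², and it tends to zero
along translates because φ decays and the coefficients are bounded. Hence it is zero
(`KernelFn.pairing_factorNum_mode`): φ satisfies an additional equation.

Testing that equation on τ times a mode clears the denominators, and in terms of θ it decouples:
each Fourier coefficient θ_n annihilates the range of D²((D² - k²)² - 3n²w²)
(`IsPotential.theta_resSymbol`). The equation for ψ itself is the bilinear equation (D_x⁴ - D_x² -
D_y²) τ·θ = 0, in Hirota's notation, which couples θ_n to θ_{n±1} (`IsPotential.theta_shifted`).

The rest is a study of exponential polynomials. For n ≠ 0 the growth of θ_n is o(exp(k|x|)), which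
removes the real exponents of the first equation. The coupling then gives θ_n = 0 for |n| ≥ 2, an
affine θ_{±1}, and, after using the freedom to add an affine function to ψ_0, a constant θ_1 =
-θ_{-1} and a multiple of sinh(kx) for θ_0. Division by τ is unique because a < 1
(`eq_zero_of_theta_eq_zero`), so ψ, and then φ, is determined by two constants. -/

namespace KPI

/-- Derivations of a commutative ring. -/
abbrev IntDer (R : Type*) [CommRing R] : Type _ := Derivation ℤ R R

/-! ### Differential algebra: the Hirota form, the dressing and the factored operator. -/

section DifferentialAlgebra

variable {R : Type*} [CommRing R]

/-- A commutative ring with two commuting derivations, constants `k`, `w`, `a` and elements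
`C`, `S`, `co`, `si` that behave like `cosh (k x)`, `sinh (k x)`, `a cos (w y)`, `a sin (w y)`. -/
structure TauRing (X Y : IntDer R) (k w a C S co si : R) : Prop where
  comm : ∀ f, Y (X f) = X (Y f)
  Xk : X k = 0
  Yk : Y k = 0
  Xw : X w = 0
  Yw : Y w = 0
  XC : X C = k * S
  XS : X S = k * C
  YC : Y C = 0
  YS : Y S = 0
  Xco : X co = 0
  Xsi : X si = 0
  Yco : Y co = -(w * si)
  Ysi : Y si = w * co
  hyp : S ^ 2 = C ^ 2 - 1
  trig : si ^ 2 = a ^ 2 - co ^ 2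
  freq : w ^ 2 = k ^ 2 - k ^ 4
  amp : a ^ 2 * (1 - k ^ 2) = 1 - 4 * k ^ 2

theorem derivation_ofNat (X : IntDer R) (n : ℕ) [n.AtLeastTwo] :
    X (ofNat(n) : R) = 0 := by
  have := X.map_natCast n
  exact this

/-- The Hirota form `(D_x⁴ - D_x² - D_y²) η · τ`. -/
def hirota (X Y : IntDer R) (t η : R) : R :=
  (t * X (X (X (X η))) - 4 * X t * X (X (X η)) + 6 * X (X t) * X (X η)
    - 4 * X (X (X t)) * X η + X (X (X (X t))) * η)
  - (t * X (X η) - 2 * X t * X η + X (X t) * η)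
  - (t * Y (Y η) - 2 * Y t * Y η + Y (Y t) * η)

/-- The dressing numerator: maps solutions of the linear equation at `0` to `τ` times solutions
of the adjoint linearization. -/
def dress (X Y : IntDer R) (k w C S co si e : R) : R :=
  (C + co) * (4 * X (X (X (X e))) - (3 + 2 * k ^ 2) * X (X e) + (4 * k ^ 4 - 3 * k ^ 2) * e)
    + 18 * k ^ 2 * C * X (X e) + 6 * k * S * ((1 - 2 * k ^ 2) * X e - 2 * X (X (X e)))
    + 6 * w * si * Y e

/-- `τ²` times the operator through which the dressed adjoint linearization factors. -/
def factorNum (X Y : IntDer R) (k w C S co si F : R) : R :=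
  4 * (C + co) ^ 2 * X (X (X (X F))) - 12 * (C + co) * k * S * X (X (X F))
    + (16 * k ^ 2 * C * (C + co) - 2 * k ^ 2 * co * (C + co) - 3 * (C + co) ^ 2) * X (X F)
    + k * S * (C + co) * (6 - 12 * k ^ 2) * X F
    + ((C + co) * (3 * k ^ 2 - 2 * k ^ 4) * co - 4 * k ^ 4 * C * (C + co)
      + (24 * k ^ 4 - 6 * k ^ 2) * S ^ 2 - 16 * k ^ 4 * C ^ 2 + 2 * k ^ 4 * C * co
      + 3 * k ^ 2 * C * (C + co)) * F
    + 6 * w * si * ((C + co) * Y F + w * si * F)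

variable {X Y : IntDer R} {k w a C S co si : R}

/-- The derivatives of `e` are treated as free variables. After expansion the two sides differ by an
element of the ideal generated by the relations `hyp`, `trig`, `freq` and `amp`, and the explicit
cofactors are the proof. No equation is imposed on `e`; this lets the identity be tested on
arbitrary functions. -/
theorem TauRing.hirota_dress (h : TauRing X Y k w a C S co si) (e : R) :
    hirota X Y (C + co) (dress X Y k w C S co si e)
      = factorNum X Y k w C S co si (X (X (X (X e))) - X (X e) - Y (Y e)) := by
  obtain ⟨comm, Xk, Yk, Xw, Yw, XC, XS, YC, YS, Xco, Xsi, Yco, Ysi, hyp, trig, freq, amp⟩ := h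
  simp only [hirota, dress, factorNum, map_add, map_sub, map_neg, Derivation.leibniz,
    Derivation.leibniz_pow,
    smul_eq_mul, comm, Xk, Yk, Xw, Yw, XC, XS, YC, YS, Xco, Xsi, Yco, Ysi, derivation_ofNat,
    Derivation.map_one_eq_zero, mul_zero, add_zero, zero_add, smul_zero, sub_zero]
  linear_combination ((-6)*k^2*(Y (Y e)) + (2)*k^2*(X (X (X (X e)))) + (-6)*k^4*(e) + (24)*k^4*(Y (Y e)) + (-4)*k^4*(X (X e)) + (-8)*k^4*(X (X (X (X e)))) + (32)*k^6*(e) + (16)*k^6*(X (X e)) + (-32)*k^8*(e)) * hyp + ((-6)*w^2*(Y (Y e)) + (2)*w^2*(X (X (X (X e)))) + (-6)*k^2*w^2*(e) + (-4)*k^2*w^2*(X (X e)) + (8)*k^4*w^2*(e)) * trig + ((-6)*a^2*(Y (Y e)) + (2)*a^2*(X (X (X (X e)))) + (-6)*k^2*a^2*(e) + (-4)*k^2*a^2*(X (X e)) + (8)*k^4*a^2*(e) + (-6)*co^2*(Y (Y e)) + (-6)*co^2*(X (X e)) + (6)*co^2*(X (X (X (X e)))) + (6)*S*co*k*(X e)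 + (-12)*S*co*k*(X (X (X e))) + (-12)*S*co*k^3*(X e) + (6)*C*si*w*(Y e) + (-12)*C*co*(Y (Y e)) + (-6)*C*co*(X (X e)) + (8)*C*co*(X (X (X (X e)))) + (-6)*C*co*k^2*(e) + (14)*C*co*k^2*(X (X e)) + (8)*C*co*k^4*(e)) * freq + ((-6)*k^2*(Y (Y e)) + (2)*k^2*(X (X (X (X e)))) + (-6)*k^4*(e) + (-4)*k^4*(X (X e)) + (8)*k^6*(e)) * amp

/-- The bilinear form of the travelling wave equation for Q. It holds precisely because of the
frequency and amplitude relations. -/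
theorem TauRing.hirota_self (h : TauRing X Y k w a C S co si) :
    hirota X Y (C + co) (C + co) = 0 := by
  obtain ⟨comm, Xk, Yk, Xw, Yw, XC, XS, YC, YS, Xco, Xsi, Yco, Ysi, hyp, trig, freq, amp⟩ := h
  simp only [hirota, map_add, map_neg, Derivation.leibniz,
    smul_eq_mul, Xk, Yw, XC, XS, YC, Xco, Yco, Ysi, mul_zero, add_zero, zero_add]
  linear_combination (2 * k ^ 2 - 8 * k ^ 4) * hyp + 2 * w ^ 2 * trig
    + (2 * a ^ 2 + 2 * C * co) * freq + 2 * k ^ 2 * amp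

/-- The Schrödinger type operator `X² - 1 + 6 q`. -/
def schr (X : IntDer R) (q g : R) : R := X (X g) - g + 6 * q * g

/-- Since τ τ_xx - τ_x² = k²(1 + C co), the last term is 6Qτ² X²g. Thus the Hirota form of τ with τg
is τ² times the adjoint linearization of g; the term without derivatives of g drops by
`TauRing.hirota_self`. -/
theorem TauRing.hirota_mul (h : TauRing X Y k w a C S co si) (g : R) :
    hirota X Y (C + co) ((C + co) * g)
      = (C + co) ^ 2 * (X (X (X (X g))) - X (X g) - Y (Y g))
        + 12 * k ^ 2 * (1 + C * co) * X (X g) := by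
  have hs := h.hirota_self
  obtain ⟨comm, Xk, Yk, Xw, Yw, XC, XS, YC, YS, Xco, Xsi, Yco, Ysi, hyp, trig, freq, amp⟩ := h
  simp only [hirota, map_add, map_neg, Derivation.leibniz,
    smul_eq_mul, Xk, Yw, XC, XS, YC, Xco, Yco, Ysi, mul_zero, add_zero, zero_add] at hs ⊢
  linear_combination g * hs - 12 * k ^ 2 * X (X g) * hyp

variable {ti : R}

theorem TauRing.intertwine (h : TauRing X Y k w a C S co si) (hti : (C + co) * ti = 1) (e : R) :
    schr X (2 * k ^ 2 * (1 + C * co) * ti ^ 2) (X (X (ti * dress X Y k w C S co si e)))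
        - Y (Y (ti * dress X Y k w C S co si e))
      = ti ^ 2 * factorNum X Y k w C S co si (X (X (X (X e))) - X (X e) - Y (Y e)) := by
  have h1 := h.hirota_mul (ti * dress X Y k w C S co si e)
  rw [← mul_assoc, hti, one_mul, h.hirota_dress] at h1
  rw [h1, schr]
  generalize X (X (ti * dress X Y k w C S co si e)) = g2
  linear_combination (g2 - X (X g2) + Y (Y (ti * dress X Y k w C S co si e))) *
    ((C + co) * ti + 1) * hti

/-- On τe every term of `factorNum` is divisible by τ² except -36k²S²τ X²e. Since -36k²S²/τ = 18Qτ -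
36k²C, this term is absorbed by 3(X² - 1 + 6Q) applied to τX²e. What remains is linear in the
generators, hence couples only neighbouring Fourier modes. -/
theorem TauRing.factor_mul (h : TauRing X Y k w a C S co si) (hti : (C + co) * ti = 1) (e : R) :
    ti ^ 2 * factorNum X Y k w C S co si ((C + co) * e)
      = (C + co) * X (X (X (X e))) - 2 * k * S * X (X (X e))
        + (k ^ 2 * C - 2 * k ^ 2 * co) * X (X e) + (3 * k ^ 2 - 2 * k ^ 4) * co * e
        + 6 * w * si * Y e
        + 3 * schr X (2 * k ^ 2 * (1 + C * co) * ti ^ 2) ((C + co) * X (X e)) := by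
  obtain ⟨comm, Xk, Yk, Xw, Yw, XC, XS, YC, YS, Xco, Xsi, Yco, Ysi, hyp, trig, freq, amp⟩ := h
  have key : factorNum X Y k w C S co si ((C + co) * e)
      = (C + co) ^ 2 * (4 * (C + co) * X (X (X (X e))) + 4 * k * S * X (X (X e))
          + (40 * k ^ 2 * C - 2 * k ^ 2 * co - 3 * (C + co)) * X (X e)
          + (3 * k ^ 2 - 2 * k ^ 4) * co * e + 6 * w * si * Y e)
        - 36 * k ^ 2 * S ^ 2 * (C + co) * X (X e) := by
    simp only [factorNum, map_add, Derivation.leibniz,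
      smul_eq_mul, Xk, XC, XS, YC, Xco, Yco, mul_zero, add_zero, zero_add]
    ring
  rw [key]
  simp only [schr, map_add, Derivation.leibniz,
    smul_eq_mul, Xk, XC, XS, Xco, mul_zero, add_zero]
  generalize X (X (X (X e))) = e4
  generalize X (X (X e)) = e3
  generalize X (X e) = e2
  linear_combination (4 * (C + co) * e4 + 4 * k * S * e3
      + (40 * k ^ 2 * C - 2 * k ^ 2 * co - 3 * (C + co)) * e2
      + (3 * k ^ 2 - 2 * k ^ 4) * co * e + 6 * w * si * Y e) * ((C + co) * ti + 1) * hti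
    - 36 * k ^ 2 * S ^ 2 * e2 * ti * hti
    - 36 * k ^ 2 * e2 * (((1 + C * co) * ti + C) * hti + ti * hyp)

end DifferentialAlgebra

end KPI

/-! ### Test functions on the line, and functionals annihilating the range of a polynomial in D. -/

open scoped ContDiff

noncomputable section

namespace KPI

/-- The submodule of smooth compactly supported functions `ℝ → ℂ`. -/
def testFnSubmodule : Submodule ℂ (ℝ → ℂ) where
  carrier := {f | ContDiff ℝ ∞ f ∧ HasCompactSupport f}
  add_mem' := fun hf hg => ⟨hf.1.add hg.1, hf.2.add hg.2⟩
  zero_mem' := ⟨contDiff_const, HasCompactSupport.zero⟩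
  smul_mem' := fun c _ hf => ⟨hf.1.const_smul c, hf.2.smul_left (f := fun _ => c)⟩

/-- Smooth compactly supported functions `ℝ → ℂ`. -/
abbrev TestFn : Type := testFnSubmodule

namespace TestFn

theorem contDiff (f : TestFn) : ContDiff ℝ ∞ f.1 := f.2.1

theorem compact (f : TestFn) : HasCompactSupport f.1 := f.2.2

theorem continuous (f : TestFn) : Continuous f.1 := f.contDiff.continuous

theorem differentiable (f : TestFn) : Differentiable ℝ f.1 :=
  f.contDiff.differentiable (by simp)

theorem integrable_mul (f : TestFn) {m : ℝ → ℂ} (hm : Continuous m) :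
    MeasureTheory.Integrable (fun x => m x * f.1 x) :=
  (hm.mul f.continuous).integrable_of_hasCompactSupport f.compact.mul_left

theorem exists_bound (f : TestFn) : ∃ R : ℝ, 0 < R ∧ ∀ x, R < |x| → f.1 x = 0 := by
  obtain ⟨R, hR⟩ := f.compact.isCompact.isBounded.subset_closedBall 0
  refine ⟨max R 1, by positivity, fun x hx => ?_⟩
  by_contra h
  have h1 := hR (subset_tsupport _ h)
  rw [mem_closedBall_zero_iff, Real.norm_eq_abs] at h1
  exact absurd (h1.trans (le_max_left _ _)) (not_le.2 hx)

/-- Differentiation of test functions. -/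
def D : TestFn →ₗ[ℂ] TestFn where
  toFun f := ⟨deriv f.1, (contDiff_infty_iff_deriv.1 f.contDiff).2, f.compact.deriv⟩
  map_add' f g := Subtype.ext (by
    ext x; exact deriv_add (f.differentiable x) (g.differentiable x))
  map_smul' c f := Subtype.ext (by
    ext x; exact deriv_const_smul c (f.differentiable x))

theorem D_apply (f : TestFn) (x : ℝ) : (D f).1 x = deriv f.1 x := rfl

theorem hasDerivAt (f : TestFn) (x : ℝ) : HasDerivAt f.1 ((D f).1 x) x :=
  (f.differentiable x).hasDerivAt

/-- Translation of test functions. -/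
def T (X : ℝ) : TestFn →ₗ[ℂ] TestFn where
  toFun f := ⟨fun x => f.1 (x - X), f.contDiff.comp (contDiff_id.sub contDiff_const),
    f.compact.comp_homeomorph (Homeomorph.subRight X)⟩
  map_add' _ _ := rfl
  map_smul' _ _ := rfl

/-- Multiplication of test functions by a smooth function. -/
def mulBy (m : ℝ → ℂ) (hm : ContDiff ℝ ∞ m) : TestFn →ₗ[ℂ] TestFn where
  toFun f := ⟨fun x => m x * f.1 x, hm.mul f.contDiff, f.compact.mul_left⟩
  map_add' f g := Subtype.ext (by ext x; exact mul_add _ _ _)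
  map_smul' c f := Subtype.ext (by ext x; exact mul_left_comm _ _ _)

theorem contDiff_exp (r : ℂ) : ContDiff ℝ ∞ (fun x : ℝ => Complex.exp (r * x)) := by
  have : ContDiff ℝ ∞ (fun x : ℝ => (x : ℂ)) := Complex.ofRealCLM.contDiff
  exact (contDiff_const.mul this).cexp

/-- Multiplication of test functions by `exp (r x)`. -/
def mulExp (r : ℂ) : TestFn →ₗ[ℂ] TestFn := mulBy _ (contDiff_exp r)

theorem hasDerivAt_exp (r : ℂ) (x : ℝ) :
    HasDerivAt (fun x : ℝ => Complex.exp (r * x)) (Complex.exp (r * x) * r) x := by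
  have h : HasDerivAt (fun x : ℝ => r * (x : ℂ)) r x := by
    simpa using (Complex.ofRealCLM.hasDerivAt (x := x)).const_mul r
  exact h.cexp

theorem D_T (X : ℝ) (f : TestFn) : D (T X f) = T X (D f) :=
  Subtype.ext (by ext x; exact deriv_comp_sub_const f.1 X x)

theorem aeval_D_T (p : Polynomial ℂ) (X : ℝ) (f : TestFn) :
    Polynomial.aeval D p (T X f) = T X (Polynomial.aeval D p f) := by
  have h : Commute D (T X) := LinearMap.ext (D_T X)
  have h2 : Commute (Polynomial.aeval D p) (T X) := by
    induction p using Polynomial.induction_on' with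
    | add p q hp hq => rw [map_add]; exact hp.add_left hq
    | monomial n c =>
      rw [Polynomial.aeval_monomial]
      exact (show Commute _ _ from Algebra.commutes c (T X)).mul_left (h.pow_left n)
  exact LinearMap.congr_fun h2 f

theorem D_mulExp (r : ℂ) (f : TestFn) : D (mulExp r f) = mulExp r (D f + r • f) := by
  refine Subtype.ext (funext fun x => ?_)
  have h := ((hasDerivAt_exp r x).mul (f.hasDerivAt x)).deriv
  refine h.trans ?_
  change _ = Complex.exp (r * x) * ((D f).1 x + r * f.1 x)
  ring

theorem mulExp_T (r : ℂ) (X : ℝ) (f : TestFn) :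
    mulExp r (T X f) = Complex.exp (r * X) • T X (mulExp r f) := by
  refine Subtype.ext (funext fun x => ?_)
  change Complex.exp (r * x) * f.1 (x - X)
    = Complex.exp (r * X) * (Complex.exp (r * ((x - X : ℝ) : ℂ)) * f.1 (x - X))
  rw [← mul_assoc, ← Complex.exp_add]
  push_cast
  ring_nf

theorem mulExp_mulExp (r s : ℂ) (f : TestFn) : mulExp r (mulExp s f) = mulExp (r + s) f := by
  refine Subtype.ext (funext fun x => ?_)
  change Complex.exp (r * x) * (Complex.exp (s * x) * f.1 x) = Complex.exp ((r + s) * x) * f.1 x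
  rw [← mul_assoc, ← Complex.exp_add, ← add_mul]

theorem mulExp_zero (f : TestFn) : mulExp 0 f = f :=
  Subtype.ext (funext fun x => by
    change Complex.exp (0 * x) * f.1 x = f.1 x
    simp)

theorem aeval_mulExp (p : Polynomial ℂ) (r : ℂ) (f : TestFn) :
    Polynomial.aeval D p (mulExp r f)
      = mulExp r (Polynomial.aeval D (p.comp (Polynomial.X + Polynomial.C r)) f) := by
  induction p using Polynomial.induction_on generalizing f with
  | C c =>
    simp [Polynomial.aeval_C]
  | add p q hp hq => simp [hp, hq]
  | monomial n c ih =>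
    have h1 : ∀ g, Polynomial.aeval D (Polynomial.C c * Polynomial.X ^ (n + 1)) g
        = Polynomial.aeval D (Polynomial.C c * Polynomial.X ^ n) (D g) := by
      intro g
      rw [pow_succ, ← mul_assoc, map_mul, Polynomial.aeval_X]
      rfl
    rw [h1, D_mulExp, ih]
    congr 1
    rw [pow_succ, ← mul_assoc, Polynomial.mul_comp, map_mul, Module.End.mul_apply]
    simp [Algebra.algebraMap_eq_smul_one]

/-- A test function annihilated by `∫ exp (-r x) ·` lies in the range of `D - r`. -/
theorem exists_D_sub_eq (r : ℂ) (g : TestFn) (hg : ∫ x : ℝ, Complex.exp (-r * x) * g.1 x = 0) :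
    ∃ z : TestFn, D z - r • z = g := by
  obtain ⟨R, hR0, hR⟩ := g.exists_bound
  set G : ℝ → ℂ := (mulExp (-r) g).1 with hG
  have hGc : Continuous G := (mulExp (-r) g).continuous
  have hG0 : ∀ x, R < |x| → G x = 0 := fun x hx => by
    change Complex.exp (-r * x) * g.1 x = 0
    rw [hR x hx, mul_zero]
  -- The solution is exp(rx)F with F a primitive of exp(-rx)g. The hypothesis that the total
  -- integral vanishes makes F zero to the right of R, hence compactly supported.
  set F : ℝ → ℂ := fun x => ∫ s in (-R)..x, G s with hF
  have hFd : ∀ x, HasDerivAt F (G x) x := fun x =>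
    intervalIntegral.integral_hasDerivAt_right (hGc.intervalIntegrable _ _)
      (hGc.stronglyMeasurableAtFilter _ _) hGc.continuousAt
  have hFs : ContDiff ℝ ∞ F := by
    rw [contDiff_infty_iff_deriv]
    refine ⟨fun x => (hFd x).differentiableAt, ?_⟩
    rw [show deriv F = G from funext fun x => (hFd x).deriv]
    exact (mulExp (-r) g).contDiff
  have hF0 : ∀ x, R < |x| → F x = 0 := by
    intro x hx
    rcases lt_abs.1 hx with h | h
    · have h1 : (∫ s in (-R)..R, G s) = 0 := by
        rw [intervalIntegral.integral_of_le (by linarith), ← hg]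
        refine MeasureTheory.setIntegral_eq_integral_of_ae_compl_eq_zero ?_
        have : ∀ᵐ y : ℝ, y ≠ -R := MeasureTheory.Measure.ae_ne _ _
        filter_upwards [this] with y hy hyn
        refine hG0 y ?_
        rw [Set.mem_Ioc, not_and_or, not_lt, not_le] at hyn
        rcases hyn with h' | h'
        · exact lt_abs.2 (Or.inr (by have := lt_of_le_of_ne h' hy; linarith))
        · exact lt_abs.2 (Or.inl h')
      rw [hF]
      change (∫ s in (-R)..x, G s) = 0
      rw [← intervalIntegral.integral_add_adjacent_intervals (hGc.intervalIntegrable (-R) R)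
        (hGc.intervalIntegrable R x), h1, zero_add]
      refine (intervalIntegral.integral_congr_ae (g := fun _ => (0 : ℂ)) ?_).trans (by simp)
      refine Filter.Eventually.of_forall fun y hy => hG0 y ?_
      rw [Set.uIoc_of_le h.le] at hy
      exact lt_abs.2 (Or.inl hy.1)
    · change (∫ s in (-R)..x, G s) = 0
      refine (intervalIntegral.integral_congr_ae (g := fun _ => (0 : ℂ)) ?_).trans (by simp)
      have : ∀ᵐ y : ℝ, y ≠ -R := MeasureTheory.Measure.ae_ne _ _
      filter_upwards [this] with y hyn hy
      refine hG0 y ?_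
      rw [Set.uIoc_of_ge (by linarith)] at hy
      exact lt_abs.2 (Or.inr (by have := lt_of_le_of_ne hy.2 hyn; linarith))
  let Z : TestFn := ⟨F, hFs, HasCompactSupport.intro (isCompact_closedBall (0 : ℝ) R)
    fun x hx => hF0 x (by simpa using hx)⟩
  have hZ : D Z = mulExp (-r) g := Subtype.ext (funext fun x => (hFd x).deriv)
  refine ⟨mulExp r Z, ?_⟩
  rw [D_mulExp, map_add, map_smul, add_sub_cancel_right, hZ, mulExp_mulExp, add_neg_cancel,
    mulExp_zero]

/-- Integration of a test function against `exp (-r x)`. -/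
def expInt (r : ℂ) : TestFn →ₗ[ℂ] ℂ where
  toFun f := ∫ x : ℝ, Complex.exp (-r * x) * f.1 x
  map_add' f g := by
    rw [← MeasureTheory.integral_add (f.integrable_mul (contDiff_exp _).continuous)
      (g.integrable_mul (contDiff_exp _).continuous)]
    exact MeasureTheory.integral_congr_ae (Filter.Eventually.of_forall fun x => mul_add _ _ _)
  map_smul' c f := by
    rw [RingHom.id_apply, smul_eq_mul, ← MeasureTheory.integral_const_mul]
    exact MeasureTheory.integral_congr_ae
      (Filter.Eventually.of_forall fun x => mul_left_comm _ _ _)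

theorem expInt_T (r : ℂ) (X : ℝ) (f : TestFn) :
    expInt r (T X f) = Complex.exp (-r * X) * expInt r f := by
  have h := MeasureTheory.integral_sub_right_eq_self
    (μ := MeasureTheory.volume) (fun x : ℝ => Complex.exp (-r * ((x + X : ℝ) : ℂ)) * f.1 x) X
  change ∫ x : ℝ, Complex.exp (-r * x) * f.1 (x - X) = _ * ∫ x : ℝ, _
  rw [← MeasureTheory.integral_const_mul]
  simp only [sub_add_cancel] at h
  rw [h]
  refine MeasureTheory.integral_congr_ae (Filter.Eventually.of_forall fun x => ?_)
  change Complex.exp (-r * ((x + X : ℝ) : ℂ)) * f.1 x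
    = Complex.exp (-r * X) * (Complex.exp (-r * x) * f.1 x)
  rw [← mul_assoc, ← Complex.exp_add]
  push_cast
  ring_nf

/-- There is a test function on which `expInt r` takes the value `1`. -/
theorem exists_expInt_eq_one (r : ℂ) : ∃ f, expInt r f = 1 := by
  let b : ContDiffBump (0 : ℝ) := default
  let f0 : TestFn := ⟨fun x => (b x : ℂ), Complex.ofRealCLM.contDiff.comp b.contDiff,
    b.hasCompactSupport.comp_left (g := fun x : ℝ => (x : ℂ)) Complex.ofReal_zero⟩
  have h0 : expInt r (mulExp r f0) = ((∫ x, b x : ℝ) : ℂ) := by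
    rw [← integral_complex_ofReal]
    refine MeasureTheory.integral_congr_ae (Filter.Eventually.of_forall fun x => ?_)
    change Complex.exp (-r * x) * (Complex.exp (r * x) * (b x : ℂ)) = _
    rw [← mul_assoc, ← Complex.exp_add]
    simp
  have h1 : (∫ x, b x : ℝ) ≠ 0 := b.integral_pos.ne'
  refine ⟨((∫ x, b x : ℝ) : ℂ)⁻¹ • mulExp r f0, ?_⟩
  rw [map_smul, h0, smul_eq_mul, inv_mul_cancel₀ (Complex.ofReal_ne_zero.2 h1)]

/-- A functional vanishing on the range of `D - r` is a multiple of `expInt r`. -/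
theorem eq_smul_expInt (l : TestFn →ₗ[ℂ] ℂ) (r : ℂ) (h : ∀ f, l (D f - r • f) = 0) :
    ∃ c : ℂ, l = c • expInt r := by
  obtain ⟨f0, hf0⟩ := exists_expInt_eq_one r
  refine ⟨l f0, LinearMap.ext fun f => ?_⟩
  obtain ⟨z, hz⟩ := exists_D_sub_eq r (f - expInt r f • f0) (by
    change expInt r (f - expInt r f • f0) = 0
    rw [map_sub, map_smul, hf0, smul_eq_mul, mul_one, sub_self])
  have h1 := h z
  rw [hz, map_sub, map_smul, sub_eq_zero] at h1
  rw [h1, LinearMap.smul_apply, smul_eq_mul, smul_eq_mul, mul_comm]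

/-- If `l ∘ p(D) = 0` and for every root `r` of `p` the numbers `exp (r X) l (T X f)` tend to zero
along some filter, then `l = 0`. -/
theorem eq_zero_of_aeval (p : Polynomial ℂ) (hp : p ≠ 0) (l : TestFn →ₗ[ℂ] ℂ)
    (hl : ∀ r, p.IsRoot r → ∃ F : Filter ℝ, F.NeBot ∧
      ∀ f, Filter.Tendsto (fun X : ℝ => Complex.exp (r * X) * l (T X f)) F (nhds 0))
    (h : ∀ f, l (Polynomial.aeval D p f) = 0) : l = 0 := by
  induction hn : p.natDegree generalizing p l with
  | zero =>
    rw [Polynomial.natDegree_eq_zero] at hn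
    obtain ⟨c, rfl⟩ := hn
    have hc : c ≠ 0 := fun h0 => hp (by rw [h0, map_zero])
    refine LinearMap.ext fun f => ?_
    have h1 := h (c⁻¹ • f)
    rwa [Polynomial.aeval_C, Module.algebraMap_end_apply, smul_smul, mul_inv_cancel₀ hc,
      one_smul] at h1
  | succ n ih =>
    obtain ⟨r, hr⟩ := IsAlgClosed.exists_root p (by
      rw [Polynomial.degree_eq_natDegree hp, hn]; exact_mod_cast Nat.succ_ne_zero n)
    obtain ⟨q, rfl⟩ := Polynomial.dvd_iff_isRoot.2 hr
    have hq : q ≠ 0 := right_ne_zero_of_mul hp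
    refine ih q hq l (fun s hs => hl s (hs.dvd (dvd_mul_left _ _))) ?_ ?_
    · intro f
      obtain ⟨F, hF, hlim⟩ := hl r hr
      obtain ⟨c, hc⟩ := eq_smul_expInt (l ∘ₗ Polynomial.aeval D q) r (fun g => by
        have h1 := h g
        rw [mul_comm, map_mul, Module.End.mul_apply] at h1
        simpa [Module.algebraMap_end_apply] using h1)
      have h2 := hlim (Polynomial.aeval D q f)
      -- As `l` composed with q(D) kills the range of D - r, it is a multiple of `expInt r`.
      -- Translation multiplies this by exp(-rX), so the product does not depend on X and equals its
      -- limit, zero. One root of p is thereby removed.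
      have h3 : (fun X : ℝ => Complex.exp (r * X) * l (T X (Polynomial.aeval D q f)))
          = fun _ => c * expInt r f := by
        funext X
        rw [← aeval_D_T]
        change _ * (l ∘ₗ Polynomial.aeval D q) _ = _
        rw [hc, LinearMap.smul_apply, expInt_T, smul_eq_mul, mul_left_comm, ← mul_assoc (Complex.exp _),
          ← Complex.exp_add]
        simp
      rw [h3] at h2
      have h4 := tendsto_nhds_unique h2 tendsto_const_nhds
      change (l ∘ₗ Polynomial.aeval D q) f = 0
      rw [hc, LinearMap.smul_apply, smul_eq_mul, h4]
    · rw [Polynomial.natDegree_mul (Polynomial.X_sub_C_ne_zero r) hq,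
        Polynomial.natDegree_X_sub_C] at hn
      omega

end TestFn

end KPI

end

/-! ### Smooth functions on the plane as a concrete `TauRing`, and Fourier modes in y. -/

noncomputable section

namespace KPI

/-- The algebra of smooth functions `ℝ × ℝ → ℂ`. -/
def smoothSubalgebra : Subalgebra ℂ (ℝ × ℝ → ℂ) where
  carrier := {f | ContDiff ℝ ∞ f}
  add_mem' := fun {f g} (hf : ContDiff ℝ ∞ f) (hg : ContDiff ℝ ∞ g) =>
    (hf.add hg : ContDiff ℝ ∞ fun p => f p + g p)
  mul_mem' := fun {f g} (hf : ContDiff ℝ ∞ f) (hg : ContDiff ℝ ∞ g) =>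
    (hf.mul hg : ContDiff ℝ ∞ fun p => f p * g p)
  algebraMap_mem' := fun c => (contDiff_const : ContDiff ℝ ∞ fun _ : ℝ × ℝ => c)

/-- Smooth functions `ℝ × ℝ → ℂ`. -/
abbrev SmoothFn : Type := smoothSubalgebra

namespace SmoothFn

theorem contDiff (f : SmoothFn) : ContDiff ℝ ∞ f.1 := f.2

theorem continuous (f : SmoothFn) : Continuous f.1 := f.contDiff.continuous

theorem differentiable (f : SmoothFn) : Differentiable ℝ f.1 :=
  f.contDiff.differentiable (by simp)

/-- Directional derivative as a derivation of the ring of smooth functions. -/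
def dirD (v : ℝ × ℝ) : IntDer SmoothFn :=
  Derivation.mk'
    (AddMonoidHom.toIntLinearMap
      { toFun := fun f => ⟨fun p => fderiv ℝ f.1 p v,
          (f.contDiff.fderiv_right (m := ∞) (by simp)).clm_apply contDiff_const⟩
        map_zero' := Subtype.ext (by
          ext p
          change fderiv ℝ (fun _ => (0 : ℂ)) p v = 0
          simp)
        map_add' := fun f g => Subtype.ext (by
          ext p
          change fderiv ℝ (f.1 + g.1) p v = fderiv ℝ f.1 p v + fderiv ℝ g.1 p v
          rw [fderiv_add (f.differentiable p) (g.differentiable p)]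
          rfl) })
    (fun f g => Subtype.ext (by
      ext p
      change fderiv ℝ (f.1 * g.1) p v = f.1 p * fderiv ℝ g.1 p v + g.1 p * fderiv ℝ f.1 p v
      rw [fderiv_mul (f.differentiable p) (g.differentiable p)]
      rfl))

theorem dirD_apply (v : ℝ × ℝ) (f : SmoothFn) (p : ℝ × ℝ) :
    (dirD v f).1 p = fderiv ℝ f.1 p v := rfl

theorem dirD_comm (v w : ℝ × ℝ) (f : SmoothFn) : dirD v (dirD w f) = dirD w (dirD v f) := by
  refine Subtype.ext (funext fun p => ?_)
  have hd : DifferentiableAt ℝ (fderiv ℝ f.1) p :=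
    ((f.contDiff.fderiv_right (m := ∞) (by simp)).differentiable (by simp)) p
  have h : ∀ u u' : ℝ × ℝ, (dirD u (dirD u' f)).1 p = fderiv ℝ (fderiv ℝ f.1) p u u' := by
    intro u u'
    change fderiv ℝ (fun q => fderiv ℝ f.1 q u') p u = _
    rw [fderiv_clm_apply hd (differentiableAt_const _)]
    simp
  rw [h, h]
  exact (f.contDiff.contDiffAt.isSymmSndFDerivAt
    (by simpa using WithTop.coe_le_coe.2 (le_top (a := (2 : ℕ∞))))).eq v w

/-- `∂/∂x` on smooth functions. -/
abbrev dX : IntDer SmoothFn := dirD (1, 0)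

/-- `∂/∂y` on smooth functions. -/
abbrev dY : IntDer SmoothFn := dirD (0, 1)

theorem hasDerivAt_dX (f : SmoothFn) (x y : ℝ) :
    HasDerivAt (fun s => f.1 (s, y)) ((dX f).1 (x, y)) x := by
  have h1 : HasDerivAt (fun s : ℝ => (s, y)) ((1 : ℝ), (0 : ℝ)) x :=
    (hasDerivAt_id x).prodMk (hasDerivAt_const x y)
  exact (f.differentiable (x, y)).hasFDerivAt.comp_hasDerivAt x h1

theorem hasDerivAt_dY (f : SmoothFn) (x y : ℝ) :
    HasDerivAt (fun s => f.1 (x, s)) ((dY f).1 (x, y)) y := by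
  have h1 : HasDerivAt (fun s : ℝ => (x, s)) ((0 : ℝ), (1 : ℝ)) y :=
    (hasDerivAt_const y x).prodMk (hasDerivAt_id y)
  exact (f.differentiable (x, y)).hasFDerivAt.comp_hasDerivAt y h1

theorem dX_eq {f g : SmoothFn}
    (h : ∀ x y, HasDerivAt (fun s => f.1 (s, y)) (g.1 (x, y)) x) : dX f = g :=
  Subtype.ext (funext fun p => (f.hasDerivAt_dX p.1 p.2).unique (h p.1 p.2))

theorem dY_eq {f g : SmoothFn}
    (h : ∀ x y, HasDerivAt (fun s => f.1 (x, s)) (g.1 (x, y)) y) : dY f = g :=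
  Subtype.ext (funext fun p => (f.hasDerivAt_dY p.1 p.2).unique (h p.1 p.2))

/-- Constants as smooth functions. -/
def const (c : ℂ) : SmoothFn := algebraMap ℂ SmoothFn c

theorem dX_const (c : ℂ) : dX (const c) = 0 := dX_eq fun x _ => hasDerivAt_const x c

theorem dY_const (c : ℂ) : dY (const c) = 0 := dY_eq fun _ y => hasDerivAt_const y c

/-- Real valued smooth functions, as elements of the algebra. -/
def ofReal (h : ℝ × ℝ → ℝ) (hh : ContDiff ℝ ∞ h) : SmoothFn :=
  ⟨fun p => (h p : ℂ), Complex.ofRealCLM.contDiff.comp hh⟩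

end SmoothFn

/-- The frequency `k √(1 - k²)`. -/
def freq (k : ℝ) : ℝ := k * Real.sqrt (1 - k ^ 2)

/-- The amplitude `√((1 - 4k²)/(1 - k²))`. -/
def ampl (k : ℝ) : ℝ := Real.sqrt ((1 - 4 * k ^ 2) / (1 - k ^ 2))

theorem tau_eq (k x y : ℝ) :
    tau k x y = Real.cosh (k * x) + ampl k * Real.cos (freq k * y) := rfl

section Parameters

variable {k : ℝ} (hk : k ∈ Set.Ioo (0 : ℝ) (1 / 2))

include hk

theorem one_sub_sq_pos : 0 < 1 - k ^ 2 := by nlinarith [hk.1, hk.2]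

theorem freq_pos : 0 < freq k := mul_pos hk.1 (Real.sqrt_pos.2 (one_sub_sq_pos hk))

theorem freq_sq : freq k ^ 2 = k ^ 2 - k ^ 4 := by
  rw [freq, mul_pow, Real.sq_sqrt (one_sub_sq_pos hk).le]; ring

theorem ampl_pos : 0 < ampl k :=
  Real.sqrt_pos.2 (div_pos (by nlinarith [hk.1, hk.2]) (one_sub_sq_pos hk))

theorem ampl_sq : ampl k ^ 2 * (1 - k ^ 2) = 1 - 4 * k ^ 2 := by
  have h := one_sub_sq_pos hk
  rw [ampl, Real.sq_sqrt (div_nonneg (by nlinarith [hk.1, hk.2]) h.le), div_mul_cancel₀ _ h.ne']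

theorem ampl_lt_one : ampl k < 1 := by
  have h := one_sub_sq_pos hk
  rw [ampl, Real.sqrt_lt' one_pos, div_lt_iff₀ h]
  nlinarith [hk.1]

theorem period_pos : 0 < period k := div_pos (by positivity) (freq_pos hk)

theorem freq_mul_period : freq k * period k = 2 * Real.pi :=
  mul_div_cancel₀ _ (freq_pos hk).ne'

/-- As a < 1, τ is comparable to cosh(kx) uniformly in y. This gives its positivity and the
boundedness of all quotients by τ that occur as multipliers. -/
theorem tau_ge (x y : ℝ) : (1 - ampl k) * Real.cosh (k * x) ≤ tau k x y := by
  rw [tau_eq]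
  have h1 := Real.neg_one_le_cos (freq k * y)
  have h2 := Real.one_le_cosh (k * x)
  nlinarith [ampl_pos hk]

theorem tau_pos (x y : ℝ) : 0 < tau k x y :=
  (mul_pos (sub_pos.2 (ampl_lt_one hk)) (Real.cosh_pos _)).trans_le (tau_ge hk x y)

end Parameters

namespace SmoothFn

/-- `cosh (k x)` -/
def C (k : ℝ) : SmoothFn := ofReal (fun p => Real.cosh (k * p.1)) (by fun_prop)

/-- `sinh (k x)` -/
def S (k : ℝ) : SmoothFn := ofReal (fun p => Real.sinh (k * p.1)) (by fun_prop)

/-- `a cos (w y)` -/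
def co (k : ℝ) : SmoothFn := ofReal (fun p => ampl k * Real.cos (freq k * p.2)) (by fun_prop)

/-- `a sin (w y)` -/
def si (k : ℝ) : SmoothFn := ofReal (fun p => ampl k * Real.sin (freq k * p.2)) (by fun_prop)

/-- `1 / τ` -/
def ti {k : ℝ} (hk : k ∈ Set.Ioo (0 : ℝ) (1 / 2)) : SmoothFn :=
  ofReal (fun p => (tau k p.1 p.2)⁻¹) (by
    refine ContDiff.inv ?_ fun p => (tau_pos hk p.1 p.2).ne'
    simp only [tau_eq]
    fun_prop)

theorem C_add_co_apply (k : ℝ) (p : ℝ × ℝ) : (C k + co k).1 p = tau k p.1 p.2 := by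
  change ((Real.cosh (k * p.1) : ℝ) : ℂ) + ((ampl k * Real.cos (freq k * p.2) : ℝ) : ℂ) = _
  rw [tau_eq]
  push_cast
  rfl

variable {k : ℝ} (hk : k ∈ Set.Ioo (0 : ℝ) (1 / 2))

include hk

theorem tau_mul_ti : (C k + co k) * ti hk = 1 := by
  refine Subtype.ext (funext fun p => ?_)
  change (C k + co k).1 p * (((tau k p.1 p.2)⁻¹ : ℝ) : ℂ) = 1
  rw [C_add_co_apply, ← Complex.ofReal_mul, mul_inv_cancel₀ (tau_pos hk _ _).ne',
    Complex.ofReal_one]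

theorem tauRing : TauRing dX dY (const k) (const (freq k)) (const (ampl k))
    (C k) (S k) (co k) (si k) where
  comm f := dirD_comm _ _ f
  Xk := dX_const _
  Yk := dY_const _
  Xw := dX_const _
  Yw := dY_const _
  XC := dX_eq fun x y => by
    have h := (((hasDerivAt_id x).const_mul k).cosh).ofReal_comp
    refine h.congr_deriv ?_
    change _ = (k : ℂ) * ((Real.sinh (k * x) : ℝ) : ℂ)
    push_cast; simp; ring
  XS := dX_eq fun x y => by
    have h := (((hasDerivAt_id x).const_mul k).sinh).ofReal_comp
    refine h.congr_deriv ?_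
    change _ = (k : ℂ) * ((Real.cosh (k * x) : ℝ) : ℂ)
    push_cast; simp; ring
  YC := dY_eq fun x y => hasDerivAt_const y ((Real.cosh (k * x) : ℝ) : ℂ)
  YS := dY_eq fun x y => hasDerivAt_const y ((Real.sinh (k * x) : ℝ) : ℂ)
  Xco := dX_eq fun x y =>
    hasDerivAt_const x (((ampl k * Real.cos (KPI.freq k * y) : ℝ) : ℂ))
  Xsi := dX_eq fun x y =>
    hasDerivAt_const x (((ampl k * Real.sin (KPI.freq k * y) : ℝ) : ℂ))
  Yco := dY_eq fun x y => by
    have h := ((((hasDerivAt_id y).const_mul (freq k)).cos).const_mul (ampl k)).ofReal_comp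
    refine h.congr_deriv ?_
    change _ = -((freq k : ℂ) * ((ampl k * Real.sin (freq k * y) : ℝ) : ℂ))
    push_cast; simp; ring
  Ysi := dY_eq fun x y => by
    have h := ((((hasDerivAt_id y).const_mul (freq k)).sin).const_mul (ampl k)).ofReal_comp
    refine h.congr_deriv ?_
    change _ = (freq k : ℂ) * ((ampl k * Real.cos (freq k * y) : ℝ) : ℂ)
    push_cast; simp; ring
  hyp := Subtype.ext (funext fun p => by
    change ((Real.sinh (k * p.1) : ℝ) : ℂ) ^ 2 = ((Real.cosh (k * p.1) : ℝ) : ℂ) ^ 2 - 1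
    have := Real.sinh_sq (k * p.1)
    exact_mod_cast this)
  trig := Subtype.ext (funext fun p => by
    change ((ampl k * Real.sin (freq k * p.2) : ℝ) : ℂ) ^ 2
      = (ampl k : ℂ) ^ 2 - ((ampl k * Real.cos (freq k * p.2) : ℝ) : ℂ) ^ 2
    have : (ampl k * Real.sin (freq k * p.2)) ^ 2
      = ampl k ^ 2 - (ampl k * Real.cos (freq k * p.2)) ^ 2 := by
      rw [mul_pow, Real.sin_sq]; ring
    exact_mod_cast this)
  freq := Subtype.ext (funext fun p => by
    change (KPI.freq k : ℂ) ^ 2 = (k : ℂ) ^ 2 - (k : ℂ) ^ 4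
    exact_mod_cast freq_sq hk)
  amp := Subtype.ext (funext fun p => by
    change (ampl k : ℂ) ^ 2 * (1 - (k : ℂ) ^ 2) = 1 - 4 * (k : ℂ) ^ 2
    exact_mod_cast ampl_sq hk)

omit hk

/-- `f(x) exp (i n w y)` -/
def mode (k : ℝ) (n : ℤ) : TestFn →ₗ[ℂ] SmoothFn where
  toFun f := ⟨fun p => f.1 p.1 * Complex.exp ((n * freq k * Complex.I) * p.2),
    (f.contDiff.comp contDiff_fst).mul ((TestFn.contDiff_exp _).comp contDiff_snd)⟩
  map_add' f g := Subtype.ext (by ext p; exact add_mul _ _ _)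
  map_smul' c f := Subtype.ext (by ext p; exact mul_assoc _ _ _)

theorem dX_mode (n : ℤ) (f : TestFn) : dX (mode k n f) = mode k n (TestFn.D f) :=
  dX_eq fun x y =>
    (f.hasDerivAt x).mul_const (Complex.exp ((n * freq k * Complex.I) * y))

theorem dY_mode (n : ℤ) (f : TestFn) :
    dY (mode k n f) = const (n * freq k * Complex.I) * mode k n f :=
  dY_eq fun x y => by
    refine ((TestFn.hasDerivAt_exp (n * freq k * Complex.I) y).const_mul (f.1 x)).congr_deriv ?_
    change _ = (n * freq k * Complex.I : ℂ) *
      (f.1 x * Complex.exp ((n * freq k * Complex.I) * y))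
    ring

end SmoothFn

end KPI

end

/-! ### Partial derivatives, the explicit profile, and integration over one period strip. -/

open MeasureTheory Filter Topology

noncomputable section

namespace KPI

section PartialDerivatives

variable {f : ℝ → ℝ → ℝ}

theorem hasDerivAt_dx (hf : ContDiff ℝ 1 (fun p : ℝ × ℝ => f p.1 p.2)) (x y : ℝ) :
    HasDerivAt (fun s => f s y) (dx f x y) x := by
  have h : ContDiff ℝ 1 (fun s : ℝ => f s y) := hf.comp (contDiff_id.prodMk contDiff_const)
  exact (h.differentiable one_ne_zero x).hasDerivAt

theorem hasDerivAt_dy (hf : ContDiff ℝ 1 (fun p : ℝ × ℝ => f p.1 p.2)) (x y : ℝ) :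
    HasDerivAt (fun s => f x s) (dy f x y) y := by
  have h : ContDiff ℝ 1 (fun s : ℝ => f x s) := hf.comp (contDiff_const.prodMk contDiff_id)
  exact (h.differentiable one_ne_zero y).hasDerivAt

theorem contDiff_dx {n : ℕ} (hf : ContDiff ℝ (n + 1) (fun p : ℝ × ℝ => f p.1 p.2)) :
    ContDiff ℝ n (fun p : ℝ × ℝ => dx f p.1 p.2) := by
  have h1 : (fun p : ℝ × ℝ => dx f p.1 p.2)
      = fun p => fderiv ℝ (fun p : ℝ × ℝ => f p.1 p.2) p (1, 0) := by
    funext p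
    have hd := (hf.differentiable (by simp) p).hasFDerivAt
    have hl : HasDerivAt (fun s : ℝ => (s, p.2)) ((1 : ℝ), (0 : ℝ)) p.1 :=
      (hasDerivAt_id p.1).prodMk (hasDerivAt_const p.1 p.2)
    exact (hd.comp_hasDerivAt p.1 hl).deriv
  rw [h1]
  exact (hf.fderiv_right le_rfl).clm_apply contDiff_const

theorem contDiff_dy {n : ℕ} (hf : ContDiff ℝ (n + 1) (fun p : ℝ × ℝ => f p.1 p.2)) :
    ContDiff ℝ n (fun p : ℝ × ℝ => dy f p.1 p.2) := by
  have h1 : (fun p : ℝ × ℝ => dy f p.1 p.2)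
      = fun p => fderiv ℝ (fun p : ℝ × ℝ => f p.1 p.2) p (0, 1) := by
    funext p
    have hd := (hf.differentiable (by simp) p).hasFDerivAt
    have hl : HasDerivAt (fun s : ℝ => (p.1, s)) ((0 : ℝ), (1 : ℝ)) p.2 :=
      (hasDerivAt_const p.2 p.1).prodMk (hasDerivAt_id p.2)
    exact (hd.comp_hasDerivAt p.2 hl).deriv
  rw [h1]
  exact (hf.fderiv_right le_rfl).clm_apply contDiff_const

end PartialDerivatives

/-- The explicit form of the profile. -/
def profile (k x y : ℝ) : ℝ :=
  2 * k ^ 2 * (1 + Real.cosh (k * x) * (ampl k * Real.cos (freq k * y))) * (tau k x y)⁻¹ ^ 2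

theorem hasDerivAt_tau_fst (k x y : ℝ) :
    HasDerivAt (fun s => tau k s y) (k * Real.sinh (k * x)) x := by
  have h := (((hasDerivAt_id x).const_mul k).cosh).add_const (ampl k * Real.cos (freq k * y))
  refine h.congr_deriv ?_
  simp [mul_comm]

theorem hasDerivAt_sinh_div_tau {k : ℝ} (hk : k ∈ Set.Ioo (0 : ℝ) (1 / 2)) (x y : ℝ) :
    HasDerivAt (fun s => k * Real.sinh (k * s) / tau k s y) (profile k x y / 2) x := by
  have h1 := (((hasDerivAt_id x).const_mul k).sinh).const_mul k
  have ht := (tau_pos hk x y).ne'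
  refine (h1.div (hasDerivAt_tau_fst k x y) ht).congr_deriv ?_
  have hs := Real.cosh_sq (k * x)
  rw [profile]
  field_simp
  rw [tau_eq]
  simp only [id]
  linear_combination (k ^ 2) * hs

theorem Q_eq {k : ℝ} (hk : k ∈ Set.Ioo (0 : ℝ) (1 / 2)) (x y : ℝ) : Q k x y = profile k x y := by
  have h1 : dx (fun x y => Real.log (tau k x y))
      = fun x y => k * Real.sinh (k * x) / tau k x y := by
    funext x y
    exact ((hasDerivAt_tau_fst k x y).log (tau_pos hk x y).ne').deriv
  rw [Q, h1, dx, (hasDerivAt_sinh_div_tau hk x y).deriv]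
  ring

theorem contDiff_tau (k : ℝ) : ContDiff ℝ ∞ (fun p : ℝ × ℝ => tau k p.1 p.2) := by
  simp only [tau_eq]
  fun_prop

theorem contDiff_profile {k : ℝ} (hk : k ∈ Set.Ioo (0 : ℝ) (1 / 2)) :
    ContDiff ℝ ∞ (fun p : ℝ × ℝ => profile k p.1 p.2) := by
  have h := (contDiff_tau k).inv fun p => (tau_pos hk p.1 p.2).ne'
  have h2 : ContDiff ℝ ∞ (fun p : ℝ × ℝ =>
      2 * k ^ 2 * (1 + Real.cosh (k * p.1) * (ampl k * Real.cos (freq k * p.2)))) := by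
    fun_prop
  exact h2.mul (h.pow 2)

/-- Lebesgue measure on the strip `ℝ × (0, t]`. -/
def strip (t : ℝ) : Measure (ℝ × ℝ) := (volume : Measure ℝ).prod (volume.restrict (Set.Ioc 0 t))

theorem integrable_strip {t R : ℝ} {h : ℝ × ℝ → ℂ} (hc : Continuous h)
    (h0 : ∀ p : ℝ × ℝ, R < |p.1| → h p = 0) : Integrable h (strip t) := by
  have h1 : strip t = (volume : Measure (ℝ × ℝ)).restrict (Set.univ ×ˢ Set.Ioc 0 t) := by
    rw [strip, Measure.volume_eq_prod, ← Measure.prod_restrict, Measure.restrict_univ]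
  rw [h1]
  have h2 : IntegrableOn h (Set.Icc (-R) R ×ˢ Set.Icc 0 t) :=
    hc.continuousOn.integrableOn_compact (isCompact_Icc.prod isCompact_Icc)
  have h3 : IntegrableOn h (Set.Icc (-R) R ×ˢ Set.Ioc 0 t) :=
    h2.mono_set (Set.prod_mono le_rfl Set.Ioc_subset_Icc_self)
  refine IntegrableOn.of_forall_sdiff_eq_zero h3 (MeasurableSet.univ.prod measurableSet_Ioc) ?_
  rintro ⟨x, y⟩ ⟨⟨-, hy⟩, hn⟩
  refine h0 _ ?_
  by_contra hle
  exact hn ⟨abs_le.1 (not_lt.1 hle), hy⟩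

/-- The ideal of smooth functions vanishing for large `|x|`. -/
def xCompact : Ideal SmoothFn where
  carrier := {g | ∃ R : ℝ, ∀ p : ℝ × ℝ, R < |p.1| → g.1 p = 0}
  add_mem' := by
    rintro f g ⟨R, hR⟩ ⟨R', hR'⟩
    refine ⟨max R R', fun p hp => ?_⟩
    change f.1 p + g.1 p = 0
    rw [hR p ((le_max_left _ _).trans_lt hp), hR' p ((le_max_right _ _).trans_lt hp), add_zero]
  zero_mem' := ⟨0, fun _ _ => rfl⟩
  smul_mem' := by
    rintro c g ⟨R, hR⟩
    refine ⟨R, fun p hp => ?_⟩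
    change c.1 p * g.1 p = 0
    rw [hR p hp, mul_zero]

theorem dirD_mem_xCompact (v : ℝ × ℝ) {g : SmoothFn} (hg : g ∈ xCompact) :
    SmoothFn.dirD v g ∈ xCompact := by
  obtain ⟨R, hR⟩ := hg
  refine ⟨R, fun p hp => ?_⟩
  have h : g.1 =ᶠ[𝓝 p] fun _ => 0 := by
    have ho : IsOpen {p : ℝ × ℝ | R < |p.1|} := isOpen_lt continuous_const (by fun_prop)
    filter_upwards [ho.mem_nhds hp] with q hq using hR q hq
  rw [SmoothFn.dirD_apply, h.fderiv_eq]
  simp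

theorem mode_mem_xCompact (k : ℝ) (n : ℤ) (f : TestFn) : SmoothFn.mode k n f ∈ xCompact := by
  obtain ⟨R, -, hR⟩ := f.exists_bound
  refine ⟨R, fun p hp => ?_⟩
  change f.1 p.1 * _ = 0
  rw [hR _ hp, zero_mul]

/-- The algebra of smooth functions that are `t`-periodic in `y`. -/
def yPeriodic (t : ℝ) : Subalgebra ℂ SmoothFn where
  carrier := {g | ∀ x y, g.1 (x, y + t) = g.1 (x, y)}
  add_mem' := fun {f g} hf hg x y => by
    change f.1 _ + g.1 _ = f.1 _ + g.1 _
    rw [hf, hg]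
  mul_mem' := fun {f g} hf hg x y => by
    change f.1 _ * g.1 _ = f.1 _ * g.1 _
    rw [hf, hg]
  algebraMap_mem' := fun _ _ _ => rfl

theorem dX_mem_yPeriodic {t : ℝ} {g : SmoothFn} (hg : g ∈ yPeriodic t) :
    SmoothFn.dX g ∈ yPeriodic t := fun x y => by
  have h := g.hasDerivAt_dX x (y + t)
  rw [show (fun s => g.1 (s, y + t)) = fun s => g.1 (s, y) from funext fun s => hg s y] at h
  exact h.unique (g.hasDerivAt_dX x y)

theorem dY_mem_yPeriodic {t : ℝ} {g : SmoothFn} (hg : g ∈ yPeriodic t) :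
    SmoothFn.dY g ∈ yPeriodic t := fun x y => by
  have h := (g.hasDerivAt_dY x (y + t)).comp_add_const y t
  rw [show (fun s => g.1 (x, s + t)) = fun s => g.1 (x, s) from funext fun s => hg x s] at h
  exact h.unique (g.hasDerivAt_dY x y)

/-- The test function `g(·, y)`. -/
def xSlice (g : SmoothFn) (hg : g ∈ xCompact) (y : ℝ) : TestFn :=
  ⟨fun x => g.1 (x, y), g.contDiff.comp (contDiff_id.prodMk contDiff_const), by
    obtain ⟨R, hR⟩ := hg
    exact HasCompactSupport.intro (isCompact_closedBall (0 : ℝ) R)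
      fun x hx => hR (x, y) (by simpa using hx)⟩

theorem TestFn.integral_mul_D {u u' : ℝ → ℂ} (hu : ∀ x, HasDerivAt u (u' x) x)
    (hu' : Continuous u') (f : TestFn) :
    ∫ x, u x * (TestFn.D f).1 x = -∫ x, u' x * f.1 x := by
  have hc : Continuous u := continuous_iff_continuousAt.2 fun x => (hu x).continuousAt
  exact integral_mul_deriv_eq_deriv_mul_of_integrable (fun x _ => hu x) (fun x _ => f.hasDerivAt x)
    ((TestFn.D f).integrable_mul hc) (f.integrable_mul hu') (f.integrable_mul hc)

theorem TestFn.integral_mul_D_D {u u' u'' : ℝ → ℂ} (hu : ∀ x, HasDerivAt u (u' x) x)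
    (hu' : ∀ x, HasDerivAt u' (u'' x) x) (hu'' : Continuous u'') (f : TestFn) :
    ∫ x, u x * (TestFn.D (TestFn.D f)).1 x = ∫ x, u'' x * f.1 x := by
  have hc : Continuous u' := continuous_iff_continuousAt.2 fun x => (hu' x).continuousAt
  rw [integral_mul_D hu hc, integral_mul_D hu' hu'', neg_neg]

end KPI

end

/-! ### The weak form of the linearized equation. -/

noncomputable section

namespace KPI

/-- `φ` is a decaying periodic solution of the linearization at the profile. -/
structure KernelFn (k : ℝ) (φ : ℝ → ℝ → ℝ) : Prop where
  smooth : ContDiff ℝ 4 (fun p : ℝ × ℝ => φ p.1 p.2)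
  decays : DecaysInX φ
  periodic : ∀ x, Function.Periodic (φ x) (period k)
  sol : ∀ x y, linearized (Q k) φ x y = 0

namespace SmoothFn

/-- The profile as a smooth function, in terms of the generators. -/
def prof {k : ℝ} (hk : k ∈ Set.Ioo (0 : ℝ) (1 / 2)) : SmoothFn :=
  2 * const k ^ 2 * (1 + C k * co k) * ti hk ^ 2

theorem prof_apply {k : ℝ} (hk : k ∈ Set.Ioo (0 : ℝ) (1 / 2)) (x y : ℝ) :
    (prof hk).1 (x, y) = (profile k x y : ℂ) := by
  change (2 : ℂ) * (k : ℂ) ^ 2 * (1 + ((Real.cosh (k * x) : ℝ) : ℂ) *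
    ((ampl k * Real.cos (freq k * y) : ℝ) : ℂ)) * (((tau k x y)⁻¹ : ℝ) : ℂ) ^ 2 = _
  rw [profile]
  push_cast
  rfl

end SmoothFn

open SmoothFn

namespace KernelFn

variable {k : ℝ} {φ : ℝ → ℝ → ℝ}

theorem continuous_ofReal (h : KernelFn k φ) : Continuous (fun p : ℝ × ℝ => (φ p.1 p.2 : ℂ)) :=
  Complex.continuous_ofReal.comp h.smooth.continuous

theorem integrable_mul (h : KernelFn k φ) (t : ℝ) {g : SmoothFn} (hg : g ∈ xCompact) :
    Integrable (fun p : ℝ × ℝ => (φ p.1 p.2 : ℂ) * g.1 p) (strip t) := by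
  obtain ⟨R, hR⟩ := hg
  exact integrable_strip (R := R) (h.continuous_ofReal.mul g.continuous)
    fun p hp => by rw [hR p hp, mul_zero]

/-- For fixed y all x-derivatives are moved from φ to `g`, whose slice is a test function. No decay
of the derivatives of φ is needed. -/
theorem integral_slice (hk : k ∈ Set.Ioo (0 : ℝ) (1 / 2)) (h : KernelFn k φ) (g : SmoothFn)
    (hg : g ∈ xCompact) (y : ℝ) :
    ∫ x, (φ x y : ℂ) * (schr dX (prof hk) (dX (dX g))).1 (x, y)
      = ∫ x, (dy (dy φ) x y : ℂ) * g.1 (x, y) := by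
  have h1 : dX g ∈ xCompact := dirD_mem_xCompact _ hg
  have h2 : dX (dX g) ∈ xCompact := dirD_mem_xCompact _ h1
  have hsl : ∀ (g : SmoothFn) (hg : g ∈ xCompact),
      TestFn.D (xSlice g hg y) = xSlice (dX g) (dirD_mem_xCompact _ hg) y := fun g hg =>
    Subtype.ext (funext fun x => (g.hasDerivAt_dX x y).deriv)
  set f := xSlice g hg y with hf
  set f2 := TestFn.D (TestFn.D f) with hf2
  have hf2' : f2 = xSlice (dX (dX g)) h2 y := by rw [hf2, hf, hsl, hsl]
  have s3 : ContDiff ℝ 3 (fun p : ℝ × ℝ => dx φ p.1 p.2) := contDiff_dx (n := 3) h.smooth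
  have s2 : ContDiff ℝ 2 (fun p : ℝ × ℝ => dx (dx φ) p.1 p.2) := contDiff_dx (n := 2) s3
  set σ : ℝ → ℝ → ℝ := fun x y => dx (dx φ) x y - φ x y + 6 * Q k x y * φ x y with hσ
  have sQ : ContDiff ℝ 2 (fun p : ℝ × ℝ => Q k p.1 p.2) := by
    simp only [Q_eq hk]
    exact (contDiff_profile hk).of_le (WithTop.coe_le_coe.2 (le_top (a := (2 : ℕ∞))))
  have sφ : ContDiff ℝ 2 (fun p : ℝ × ℝ => φ p.1 p.2) := h.smooth.of_le (by norm_num)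
  have sσ : ContDiff ℝ 2 (fun p : ℝ × ℝ => σ p.1 p.2) :=
    (s2.sub sφ).add ((contDiff_const.mul sQ).mul sφ)
  have sσ1 : ContDiff ℝ 1 (fun p : ℝ × ℝ => dx σ p.1 p.2) := contDiff_dx (n := 1) sσ
  have sσ2 : ContDiff ℝ 0 (fun p : ℝ × ℝ => dx (dx σ) p.1 p.2) := contDiff_dx (n := 0) sσ1
  have e1 : ∀ x, HasDerivAt (fun x => (φ x y : ℂ)) (dx φ x y : ℂ) x := fun x =>
    (hasDerivAt_dx (h.smooth.of_le (by norm_num)) x y).ofReal_comp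
  have e2 : ∀ x, HasDerivAt (fun x => (dx φ x y : ℂ)) (dx (dx φ) x y : ℂ) x := fun x =>
    (hasDerivAt_dx (s3.of_le (by norm_num)) x y).ofReal_comp
  have e3 : ∀ x, HasDerivAt (fun x => (σ x y : ℂ)) (dx σ x y : ℂ) x := fun x =>
    (hasDerivAt_dx (sσ.of_le (by norm_num)) x y).ofReal_comp
  have e4 : ∀ x, HasDerivAt (fun x => (dx σ x y : ℂ)) (dx (dx σ) x y : ℂ) x := fun x =>
    (hasDerivAt_dx sσ1 x y).ofReal_comp
  have hslc : ∀ {u : ℝ → ℝ → ℝ}, Continuous (fun p : ℝ × ℝ => u p.1 p.2) →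
      Continuous (fun x => (u x y : ℂ)) := fun hu =>
    Complex.continuous_ofReal.comp (hu.comp (continuous_id.prodMk continuous_const))
  have i1 := TestFn.integral_mul_D_D e1 e2 (hslc s2.continuous) f2
  have i2 := TestFn.integral_mul_D_D e3 e4 (hslc sσ2.continuous) f
  have hsol : ∀ x, dx (dx σ) x y = dy (dy φ) x y := fun x => sub_eq_zero.1 (h.sol x y)
  have hcφ := hslc sφ.continuous
  have hcQφ : Continuous (fun x => ((6 * Q k x y * φ x y - φ x y : ℝ) : ℂ)) :=
    hslc (u := fun x y => 6 * Q k x y * φ x y - φ x y)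
      (((continuous_const.mul sQ.continuous).mul sφ.continuous).sub sφ.continuous)
  calc ∫ x, (φ x y : ℂ) * (schr dX (prof hk) (dX (dX g))).1 (x, y)
      = ∫ x, ((φ x y : ℂ) * (TestFn.D (TestFn.D f2)).1 x
          + ((6 * Q k x y * φ x y - φ x y : ℝ) : ℂ) * f2.1 x) := by
        refine integral_congr_ae (Eventually.of_forall fun x => ?_)
        have hD : TestFn.D (TestFn.D f2) = xSlice (dX (dX (dX (dX g)))) (dirD_mem_xCompact _
            (dirD_mem_xCompact _ h2)) y := by rw [hf2', hsl, hsl]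
        beta_reduce
        rw [hD, hf2']
        change (φ x y : ℂ) * ((dX (dX (dX (dX g)))).1 (x, y) - (dX (dX g)).1 (x, y)
          + 6 * (prof hk).1 (x, y) * (dX (dX g)).1 (x, y))
          = (φ x y : ℂ) * (dX (dX (dX (dX g)))).1 (x, y) + _ * (dX (dX g)).1 (x, y)
        rw [prof_apply, Q_eq hk]
        push_cast
        ring
    _ = ∫ x, ((dx (dx φ) x y : ℂ) * f2.1 x
          + ((6 * Q k x y * φ x y - φ x y : ℝ) : ℂ) * f2.1 x) := by
        rw [integral_add ((TestFn.D (TestFn.D f2)).integrable_mul hcφ) (f2.integrable_mul hcQφ),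
          integral_add (f2.integrable_mul (hslc s2.continuous)) (f2.integrable_mul hcQφ), i1]
    _ = ∫ x, (σ x y : ℂ) * f2.1 x := by
        refine integral_congr_ae (Eventually.of_forall fun x => ?_)
        simp only [hσ]
        push_cast
        ring
    _ = ∫ x, (dy (dy φ) x y : ℂ) * g.1 (x, y) := by
        rw [i2]
        simp only [hsol]
        rfl

/-- Two integrations by parts over a period; the boundary terms cancel because φ, `g` and their
y-derivatives are periodic. -/
theorem integral_fibre (hk : k ∈ Set.Ioo (0 : ℝ) (1 / 2)) (h : KernelFn k φ) (g : SmoothFn)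
    (hp : g ∈ yPeriodic (period k)) (x : ℝ) :
    ∫ y in Set.Ioc 0 (period k), (dy (dy φ) x y : ℂ) * g.1 (x, y)
      = ∫ y in Set.Ioc 0 (period k), (φ x y : ℂ) * (dY (dY g)).1 (x, y) := by
  have s3 : ContDiff ℝ 3 (fun p : ℝ × ℝ => dy φ p.1 p.2) := contDiff_dy (n := 3) h.smooth
  have s2 : ContDiff ℝ 2 (fun p : ℝ × ℝ => dy (dy φ) p.1 p.2) := contDiff_dy (n := 2) s3
  have e1 : ∀ y, HasDerivAt (fun y => (φ x y : ℂ)) (dy φ x y : ℂ) y := fun y =>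
    (hasDerivAt_dy (h.smooth.of_le (by norm_num)) x y).ofReal_comp
  have e2 : ∀ y, HasDerivAt (fun y => (dy φ x y : ℂ)) (dy (dy φ) x y : ℂ) y := fun y =>
    (hasDerivAt_dy (s3.of_le (by norm_num)) x y).ofReal_comp
  have hslc : ∀ {u : ℝ → ℝ → ℝ}, Continuous (fun p : ℝ × ℝ => u p.1 p.2) →
      Continuous (fun y => (u x y : ℂ)) := fun hu =>
    Complex.continuous_ofReal.comp (hu.comp (continuous_const.prodMk continuous_id))
  have hgc : ∀ g : SmoothFn, Continuous fun y => g.1 (x, y) := fun g =>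
    g.continuous.comp (continuous_const.prodMk continuous_id)
  have p1 : dY g ∈ yPeriodic (period k) := dY_mem_yPeriodic hp
  have q0 : φ x (period k) = φ x 0 := by simpa using h.periodic x 0
  have q1 : dy φ x (period k) = dy φ x 0 := by
    have h0 := (hasDerivAt_dy (h.smooth.of_le (by norm_num)) x (0 + period k)).comp_add_const
      0 (period k)
    rw [show (fun s => φ x (s + period k)) = φ x from funext fun s => h.periodic x s] at h0
    have := h0.unique (hasDerivAt_dy (h.smooth.of_le (by norm_num)) x 0)
    simpa using this
  have g0 : g.1 (x, period k) = g.1 (x, 0) := by simpa using hp x 0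
  have g1 : (dY g).1 (x, period k) = (dY g).1 (x, 0) := by simpa using p1 x 0
  have i1 := intervalIntegral.integral_mul_deriv_eq_deriv_mul (a := 0) (b := period k)
    (fun y _ => e2 y) (fun y _ => g.hasDerivAt_dY x y)
    ((hslc s2.continuous).intervalIntegrable _ _) ((hgc (dY g)).intervalIntegrable _ _)
  have i2 := intervalIntegral.integral_mul_deriv_eq_deriv_mul (a := 0) (b := period k)
    (fun y _ => e1 y) (fun y _ => (dY g).hasDerivAt_dY x y)
    ((hslc s3.continuous).intervalIntegrable _ _) ((hgc (dY (dY g))).intervalIntegrable _ _)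
  rw [q1, g0, sub_self, zero_sub] at i1
  rw [q0, g1, sub_self, zero_sub] at i2
  rw [← intervalIntegral.integral_of_le (period_pos hk).le,
    ← intervalIntegral.integral_of_le (period_pos hk).le, i2, i1, neg_neg]

theorem weak (hk : k ∈ Set.Ioo (0 : ℝ) (1 / 2)) (h : KernelFn k φ) (g : SmoothFn)
    (hg : g ∈ xCompact) (hp : g ∈ yPeriodic (period k)) :
    ∫ p : ℝ × ℝ, (φ p.1 p.2 : ℂ) * (schr dX (prof hk) (dX (dX g)) - dY (dY g)).1 p
      ∂(strip (period k)) = 0 := by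
  have h2 : dX (dX g) ∈ xCompact := dirD_mem_xCompact _ (dirD_mem_xCompact _ hg)
  have hs : schr dX (prof hk) (dX (dX g)) ∈ xCompact :=
    add_mem (sub_mem (dirD_mem_xCompact _ (dirD_mem_xCompact _ h2)) h2) (Ideal.mul_mem_left _ _ h2)
  have hy : dY (dY g) ∈ xCompact := dirD_mem_xCompact _ (dirD_mem_xCompact _ hg)
  have e : ∀ p : ℝ × ℝ, (φ p.1 p.2 : ℂ) * (schr dX (prof hk) (dX (dX g)) - dY (dY g)).1 p
      = (φ p.1 p.2 : ℂ) * (schr dX (prof hk) (dX (dX g))).1 p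
        - (φ p.1 p.2 : ℂ) * (dY (dY g)).1 p := fun p => mul_sub _ _ _
  have s3 : ContDiff ℝ 3 (fun p : ℝ × ℝ => dy φ p.1 p.2) := contDiff_dy (n := 3) h.smooth
  have s2 : ContDiff ℝ 2 (fun p : ℝ × ℝ => dy (dy φ) p.1 p.2) := contDiff_dy (n := 2) s3
  have hyy : Integrable (fun p : ℝ × ℝ => (dy (dy φ) p.1 p.2 : ℂ) * g.1 p)
      (strip (period k)) := by
    obtain ⟨R, hR⟩ := hg
    exact integrable_strip (R := R)
      ((Complex.continuous_ofReal.comp s2.continuous).mul g.continuous)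
      fun p hp => by rw [hR p hp, mul_zero]
  simp only [e]
  rw [integral_sub (h.integrable_mul _ hs) (h.integrable_mul _ hy), sub_eq_zero]
  have iy := h.integrable_mul (period k) hy
  have is := h.integrable_mul (period k) hs
  rw [strip] at hyy iy is ⊢
  -- The S-term is integrated in x first and the y-term in y first; both iterated integrals turn
  -- into the integral of φ_yy g.
  rw [integral_prod_symm _ is, integral_prod _ iy]
  simp only [h.integral_slice hk g hg]
  simp only [← h.integral_fibre hk g hp]
  rw [← integral_prod _ hyy, integral_prod_symm _ hyy]

end KernelFn

end KPI

end

/-! ### Functionals vanishing along translates, and bounded or periodic multipliers. -/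

noncomputable section

namespace KPI

namespace TestFn

/-- Functionals whose values on translates of a test function tend to zero. -/
def vanishing : Submodule ℂ (TestFn →ₗ[ℂ] ℂ) where
  carrier := {l | ∀ f, Tendsto (fun X => l (T X f)) (cocompact ℝ) (𝓝 0)}
  add_mem' := fun ha hb f => by simpa using (ha f).add (hb f)
  zero_mem' := fun _ => tendsto_const_nhds
  smul_mem' := fun c l hl f => by simpa using (hl f).const_mul c

theorem comp_D_mem_vanishing {l : TestFn →ₗ[ℂ] ℂ} (hl : l ∈ vanishing) : l ∘ₗ D ∈ vanishing :=
  fun f => by simpa [D_T] using hl (D f)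

theorem tendsto_exp_mul {r : ℂ} {u : ℝ → ℂ} {F : Filter ℝ} (hu : Tendsto u F (𝓝 0))
    (hr : ∀ᶠ X in F, r.re * X ≤ 0) :
    Tendsto (fun X : ℝ => Complex.exp (r * X) * u X) F (𝓝 0) := by
  refine squeeze_zero_norm' (a := fun X => ‖u X‖) ?_ (by simpa using hu.norm)
  filter_upwards [hr] with X hX
  rw [norm_mul, Complex.norm_exp]
  refine mul_le_of_le_one_left (norm_nonneg _) (Real.exp_le_one_iff.2 ?_)
  simpa using hX

/-- No condition on the roots is needed: translate towards +∞ if Re r ≤ 0 and towards -∞ otherwise,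
so that the exponential weight is at most one. -/
theorem eq_zero_of_vanishing {l : TestFn →ₗ[ℂ] ℂ} (hl : l ∈ vanishing) {p : Polynomial ℂ}
    (hp : p ≠ 0) (h : ∀ f, l (Polynomial.aeval D p f) = 0) : l = 0 := by
  refine eq_zero_of_aeval p hp l (fun r _ => ?_) h
  rcases le_total r.re 0 with hr | hr
  · refine ⟨atTop, inferInstance, fun f => tendsto_exp_mul ((hl f).mono_left atTop_le_cocompact) ?_⟩
    filter_upwards [eventually_ge_atTop 0] with X hX using mul_nonpos_of_nonpos_of_nonneg hr hX
  · refine ⟨atBot, inferInstance, fun f => tendsto_exp_mul ((hl f).mono_left atBot_le_cocompact) ?_⟩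
    filter_upwards [eventually_le_atBot 0] with X hX using mul_nonpos_of_nonneg_of_nonpos hr hX

end TestFn

namespace SmoothFn

/-- The algebra of bounded smooth functions. -/
def bounded : Subalgebra ℂ SmoothFn where
  carrier := {g | ∃ M : ℝ, ∀ p, ‖g.1 p‖ ≤ M}
  add_mem' := by
    rintro f g ⟨M, hM⟩ ⟨M', hM'⟩
    exact ⟨M + M', fun p => (norm_add_le _ _).trans (add_le_add (hM p) (hM' p))⟩
  mul_mem' := by
    rintro f g ⟨M, hM⟩ ⟨M', hM'⟩
    exact ⟨M * M', fun p => (norm_mul_le _ _).trans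
      (mul_le_mul (hM p) (hM' p) (norm_nonneg _) ((norm_nonneg _).trans (hM p)))⟩
  algebraMap_mem' := fun c => ⟨‖c‖, fun _ => le_rfl⟩

theorem const_mem_bounded (c : ℂ) : const c ∈ bounded := bounded.algebraMap_mem c

variable {k : ℝ} (hk : k ∈ Set.Ioo (0 : ℝ) (1 / 2))

include hk

theorem ofReal_mul_ti_mem_bounded {u : ℝ × ℝ → ℝ} {hu : ContDiff ℝ ∞ u}
    (hb : ∀ p, |u p| ≤ Real.cosh (k * p.1)) : ofReal u hu * ti hk ∈ bounded := by
  refine ⟨(1 - ampl k)⁻¹, fun p => ?_⟩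
  change ‖((u p : ℝ) : ℂ) * (((tau k p.1 p.2)⁻¹ : ℝ) : ℂ)‖ ≤ _
  have ha := sub_pos.2 (ampl_lt_one hk)
  have ht := tau_pos hk p.1 p.2
  rw [norm_mul, Complex.norm_real, Complex.norm_real, Real.norm_eq_abs, Real.norm_eq_abs,
    abs_of_pos (inv_pos.2 ht), ← div_eq_mul_inv, div_le_iff₀ ht, ← div_eq_inv_mul,
    le_div_iff₀' ha]
  exact (mul_le_mul_of_nonneg_left (hb p) ha.le).trans (tau_ge hk _ _)

theorem C_mul_ti_mem_bounded : C k * ti hk ∈ bounded :=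
  ofReal_mul_ti_mem_bounded hk fun _ => (abs_of_pos (Real.cosh_pos _)).le

theorem S_mul_ti_mem_bounded : S k * ti hk ∈ bounded :=
  ofReal_mul_ti_mem_bounded hk fun p => abs_le.2
    ⟨by have := Real.cosh_add_sinh (k * p.1); have := Real.exp_pos (k * p.1); linarith,
      (Real.sinh_lt_cosh _).le⟩

theorem abs_ampl_mul_le {u x : ℝ} (hu : |u| ≤ 1) : |ampl k * u| ≤ Real.cosh x := by
  rw [abs_mul, abs_of_pos (ampl_pos hk)]
  have h1 := ampl_lt_one hk
  have h2 := Real.one_le_cosh x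
  have h3 := ampl_pos hk
  nlinarith [abs_nonneg u]

theorem co_mul_ti_mem_bounded : co k * ti hk ∈ bounded :=
  ofReal_mul_ti_mem_bounded hk fun _ => abs_ampl_mul_le hk (Real.abs_cos_le_one _)

theorem si_mul_ti_mem_bounded : si k * ti hk ∈ bounded :=
  ofReal_mul_ti_mem_bounded hk fun _ => abs_ampl_mul_le hk (Real.abs_sin_le_one _)

theorem ti_mem_bounded : ti hk ∈ bounded := by
  have h : ofReal (fun _ => 1) contDiff_const = 1 := rfl
  have h2 := ofReal_mul_ti_mem_bounded hk (u := fun _ => 1) (hu := contDiff_const)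
    fun p => by simp
  rwa [h, one_mul] at h2

theorem prof_mem_bounded : prof hk ∈ bounded := by
  have h : prof hk = 2 * const k ^ 2 * (ti hk ^ 2 + (C k * ti hk) * (co k * ti hk)) := by
    rw [prof]; ring
  rw [h]
  exact mul_mem (mul_mem (ofNat_mem _ 2) (pow_mem (const_mem_bounded _) 2))
    (add_mem (pow_mem (ti_mem_bounded hk) 2)
      (mul_mem (C_mul_ti_mem_bounded hk) (co_mul_ti_mem_bounded hk)))

theorem mode_mem_yPeriodic (n : ℤ) (f : TestFn) : mode k n f ∈ yPeriodic (period k) := by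
  intro x y
  change f.1 x * Complex.exp _ = f.1 x * Complex.exp _
  congr 1
  rw [← Complex.exp_periodic.int_mul n (n * freq k * Complex.I * y)]
  congr 1
  have h : (freq k : ℂ) * (period k : ℂ) = 2 * Real.pi := by
    exact_mod_cast freq_mul_period hk
  push_cast
  linear_combination (n * Complex.I) * h

omit hk in
theorem const_mem_yPeriodic (t : ℝ) (c : ℂ) : const c ∈ yPeriodic t :=
  (yPeriodic t).algebraMap_mem c

theorem co_mem_yPeriodic : co k ∈ yPeriodic (period k) := by
  intro x y
  change ((ampl k * Real.cos (freq k * (y + period k)) : ℝ) : ℂ)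
    = ((ampl k * Real.cos (freq k * y) : ℝ) : ℂ)
  rw [mul_add, freq_mul_period hk, Real.cos_add_two_pi]

theorem si_mem_yPeriodic : si k ∈ yPeriodic (period k) := by
  intro x y
  change ((ampl k * Real.sin (freq k * (y + period k)) : ℝ) : ℂ)
    = ((ampl k * Real.sin (freq k * y) : ℝ) : ℂ)
  rw [mul_add, freq_mul_period hk, Real.sin_add_two_pi]

theorem ti_mem_yPeriodic : ti hk ∈ yPeriodic (period k) := by
  intro x y
  change (((tau k x (y + period k))⁻¹ : ℝ) : ℂ) = (((tau k x y)⁻¹ : ℝ) : ℂ)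
  rw [tau_eq, tau_eq, mul_add, freq_mul_period hk, Real.cos_add_two_pi]

theorem dress_mem_yPeriodic {e : SmoothFn} (he : e ∈ yPeriodic (period k)) :
    dress dX dY (const k) (const (freq k)) (C k) (S k) (co k) (si k) e ∈ yPeriodic (period k) := by
  have hC : C k ∈ yPeriodic (period k) := fun _ _ => rfl
  have hS : S k ∈ yPeriodic (period k) := fun _ _ => rfl
  have h1 := dX_mem_yPeriodic he
  have h2 := dX_mem_yPeriodic h1
  have h3 := dX_mem_yPeriodic h2
  have h4 := dX_mem_yPeriodic h3
  have hy := dY_mem_yPeriodic he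
  have hn : ∀ (n : ℕ) [n.AtLeastTwo], (ofNat(n) : SmoothFn) ∈ yPeriodic (period k) :=
    fun n _ => ofNat_mem _ n
  have := co_mem_yPeriodic hk
  have := si_mem_yPeriodic hk
  have := const_mem_yPeriodic (period k)
  unfold dress
  repeat' first
    | assumption | apply add_mem | apply sub_mem | apply mul_mem | apply pow_mem
    | apply one_mem | apply hn | apply const_mem_yPeriodic

omit hk in
theorem dress_mem_xCompact {e : SmoothFn} (he : e ∈ xCompact) :
    dress dX dY (const k) (const (freq k)) (C k) (S k) (co k) (si k) e ∈ xCompact := by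
  have h1 : dX e ∈ xCompact := dirD_mem_xCompact _ he
  have h2 : dX (dX e) ∈ xCompact := dirD_mem_xCompact _ h1
  have h3 : dX (dX (dX e)) ∈ xCompact := dirD_mem_xCompact _ h2
  have h4 : dX (dX (dX (dX e))) ∈ xCompact := dirD_mem_xCompact _ h3
  have hy : dY e ∈ xCompact := dirD_mem_xCompact _ he
  unfold dress
  repeat' first
    | assumption | apply add_mem | apply sub_mem | apply Ideal.mul_mem_left

end SmoothFn

end KPI

end

/-! ### Pairing with φ, and the additional equation given by the factored operator. -/

noncomputable section

namespace KPI

open SmoothFn TestFn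

theorem norm_exp_mode (k : ℝ) (n : ℤ) (y : ℝ) :
    ‖Complex.exp ((n * freq k * Complex.I) * y)‖ = 1 := by
  rw [Complex.norm_exp]
  simp

theorem TestFn.exists_norm_le (f : TestFn) : ∃ M : ℝ, ∀ x, ‖f.1 x‖ ≤ M := by
  obtain ⟨M, hM⟩ := f.compact.exists_bound_of_continuous f.continuous
  exact ⟨M, hM⟩

namespace KernelFn

variable {k : ℝ} {φ : ℝ → ℝ → ℝ}

/-- The integral is meaningful only on `xCompact`. An arbitrary linear extension to all smooth
functions frees later algebra from integrability side conditions. -/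
theorem exists_pairing (h : KernelFn k φ) : ∃ I : SmoothFn →ₗ[ℂ] ℂ, ∀ g ∈ xCompact,
    I g = ∫ p : ℝ × ℝ, (φ p.1 p.2 : ℂ) * g.1 p ∂(strip (period k)) := by
  let J : (xCompact.restrictScalars ℂ : Submodule ℂ SmoothFn) →ₗ[ℂ] ℂ :=
    { toFun := fun g => ∫ p : ℝ × ℝ, (φ p.1 p.2 : ℂ) * g.1.1 p ∂(strip (period k))
      map_add' := fun f g => by
        rw [← integral_add (h.integrable_mul _ f.2) (h.integrable_mul _ g.2)]
        exact integral_congr_ae (Eventually.of_forall fun p => mul_add _ _ _)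
      map_smul' := fun c f => by
        rw [RingHom.id_apply, smul_eq_mul, ← integral_const_mul]
        exact integral_congr_ae (Eventually.of_forall fun p => mul_left_comm _ _ _) }
  obtain ⟨I, hI⟩ := LinearMap.exists_extend J
  exact ⟨I, fun g hg => LinearMap.congr_fun hI ⟨g, hg⟩⟩

/-- A linear extension of `g ↦ ∫ φ g` over one period strip to all smooth functions. -/
def pairing (h : KernelFn k φ) : SmoothFn →ₗ[ℂ] ℂ := h.exists_pairing.choose

theorem pairing_apply (h : KernelFn k φ) {g : SmoothFn} (hg : g ∈ xCompact) :
    h.pairing g = ∫ p : ℝ × ℝ, (φ p.1 p.2 : ℂ) * g.1 p ∂(strip (period k)) :=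
  h.exists_pairing.choose_spec g hg

theorem pairing_lin (hk : k ∈ Set.Ioo (0 : ℝ) (1 / 2)) (h : KernelFn k φ) {g : SmoothFn}
    (hg : g ∈ xCompact) (hp : g ∈ yPeriodic (period k)) :
    h.pairing (schr dX (prof hk) (dX (dX g)) - dY (dY g)) = 0 := by
  have h2 : dX (dX g) ∈ xCompact := dirD_mem_xCompact _ (dirD_mem_xCompact _ hg)
  rw [h.pairing_apply, h.weak hk g hg hp]
  exact sub_mem (add_mem (sub_mem (dirD_mem_xCompact _ (dirD_mem_xCompact _ h2)) h2)
    (Ideal.mul_mem_left _ _ h2)) (dirD_mem_xCompact _ (dirD_mem_xCompact _ hg))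

/-- Undoing the translation keeps the test function fixed and moves φ, which tends to zero
pointwise. Dominated convergence applies with a bound for φ and `m` times |f|. This is how the decay
hypothesis enters. -/
theorem tendsto_pairing (h : KernelFn k φ) {m : SmoothFn} (hm : m ∈ bounded) (n : ℤ)
    (f : TestFn) :
    Tendsto (fun X => h.pairing (m * mode k n (TestFn.T X f))) (cocompact ℝ) (𝓝 0) := by
  obtain ⟨M, hM⟩ := hm
  obtain ⟨A, hA⟩ := h.decays.1
  have hc : (cocompact ℝ).IsCountablyGenerated := by
    rw [cocompact_eq_atBot_atTop]; infer_instance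
  have e : ∀ X, h.pairing (m * mode k n (TestFn.T X f)) = ∫ p : ℝ × ℝ,
      (φ (p.1 + X) p.2 : ℂ) * (m.1 (p.1 + X, p.2) *
        (f.1 p.1 * Complex.exp ((n * freq k * Complex.I) * p.2))) ∂(strip (period k)) := by
    intro X
    rw [h.pairing_apply (Ideal.mul_mem_left _ _ (mode_mem_xCompact _ _ _))]
    have hmp : MeasurePreserving (Prod.map (· + X) id : ℝ × ℝ → ℝ × ℝ) (strip (period k))
        (strip (period k)) :=
      (measurePreserving_add_right volume X).prod (MeasurePreserving.id _)
    have he : MeasurableEmbedding (Prod.map (· + X) id : ℝ × ℝ → ℝ × ℝ) :=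
      ((Homeomorph.addRight X).prodCongr (Homeomorph.refl ℝ)).measurableEmbedding
    rw [← hmp.integral_comp he]
    refine integral_congr_ae (Eventually.of_forall fun p => ?_)
    change (φ (p.1 + X) p.2 : ℂ) * (m.1 (p.1 + X, p.2) *
      (f.1 (p.1 + X - X) * Complex.exp ((n * freq k * Complex.I) * p.2))) = _
    rw [add_sub_cancel_right]
  simp only [e]
  have hfc : Continuous fun p : ℝ × ℝ => ((A * M : ℝ) : ℂ) * f.1 p.1 :=
    continuous_const.mul (f.continuous.comp continuous_fst)
  obtain ⟨R, -, hR⟩ := f.exists_bound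
  have hbi : Integrable (fun p : ℝ × ℝ => ‖((A * M : ℝ) : ℂ) * f.1 p.1‖) (strip (period k)) :=
    (integrable_strip (R := R) hfc fun p hp => by rw [hR _ hp, mul_zero]).norm
  have hA0 : 0 ≤ A := (abs_nonneg _).trans (hA 0 0)
  have hM0 : 0 ≤ M := (norm_nonneg _).trans (hM 0)
  have hlim := tendsto_integral_filter_of_dominated_convergence (l := cocompact ℝ)
    (μ := strip (period k))
    (F := fun X (p : ℝ × ℝ) => (φ (p.1 + X) p.2 : ℂ) * (m.1 (p.1 + X, p.2) *
        (f.1 p.1 * Complex.exp ((n * freq k * Complex.I) * p.2))))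
    (f := fun _ => 0) (fun p : ℝ × ℝ => ‖((A * M : ℝ) : ℂ) * f.1 p.1‖)
    (Eventually.of_forall fun X => ?_) (Eventually.of_forall fun X => ?_) hbi ?_
  · simpa using hlim
  · have hs : Continuous fun p : ℝ × ℝ => (p.1 + X, p.2) := by fun_prop
    exact ((h.continuous_ofReal.comp hs).mul ((m.continuous.comp hs).mul
      (mode k n f).continuous)).aestronglyMeasurable
  · refine Eventually.of_forall fun p => ?_
    rw [norm_mul, norm_mul, norm_mul, norm_exp_mode, mul_one, norm_mul, Complex.norm_real,
      Complex.norm_real, Real.norm_eq_abs, Real.norm_eq_abs, abs_of_nonneg (mul_nonneg hA0 hM0),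
      ← mul_assoc]
    exact mul_le_mul_of_nonneg_right (mul_le_mul (hA _ _) (hM _) (norm_nonneg _) hA0)
      (norm_nonneg _)
  · refine Eventually.of_forall fun p => ?_
    have h1 : Tendsto (fun X => (φ (p.1 + X) p.2 : ℂ)) (cocompact ℝ) (𝓝 0) := by
      have := (h.decays.2 p.2).comp (Homeomorph.addLeft p.1).isClosedEmbedding.tendsto_cocompact
      exact (Complex.continuous_ofReal.tendsto' 0 0 Complex.ofReal_zero).comp this
    have h2 := h1.zero_mul_isBoundedUnder_le (g := fun X => m.1 (p.1 + X, p.2) *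
        (f.1 p.1 * Complex.exp ((n * freq k * Complex.I) * p.2)))
      ⟨M * ‖f.1 p.1‖, by
        rw [eventually_map]
        refine Eventually.of_forall fun X => ?_
        simp only [Function.comp]
        rw [norm_mul, norm_mul, norm_exp_mode, mul_one]
        exact mul_le_mul_of_nonneg_right (hM _) (norm_nonneg _)⟩
    exact h2

/-- The functional `f ↦ ∫ φ m f(x) exp (i n w y)`. -/
def coeff (h : KernelFn k φ) (m : SmoothFn) (n : ℤ) : TestFn →ₗ[ℂ] ℂ :=
  h.pairing ∘ₗ LinearMap.mulLeft ℂ m ∘ₗ mode k n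

theorem coeff_apply (h : KernelFn k φ) (m : SmoothFn) (n : ℤ) (f : TestFn) :
    h.coeff m n f = h.pairing (m * mode k n f) := rfl

theorem coeff_mem_vanishing (h : KernelFn k φ) {m : SmoothFn} (hm : m ∈ bounded) (n : ℤ) :
    h.coeff m n ∈ TestFn.vanishing := h.tendsto_pairing hm n

end KernelFn

theorem const_mul_eq_smul (c : ℂ) (g : SmoothFn) : const c * g = c • g :=
  (Algebra.smul_def c g).symm

/-- The symbol `X⁴ - X² + n² w²` of the linear equation at zero. -/
def symbol (k : ℝ) (n : ℤ) : Polynomial ℂ :=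
  Polynomial.X ^ 4 - Polynomial.X ^ 2 + Polynomial.C ((n * freq k : ℂ) ^ 2)

theorem symbol_ne_zero (k : ℝ) (n : ℤ) : symbol k n ≠ 0 := by
  unfold symbol
  generalize (n * freq k : ℂ) ^ 2 = c
  intro h
  have := congrArg (fun p : Polynomial ℂ => p.coeff 4) h
  simp [Polynomial.coeff_X_pow] at this

theorem mode_symbol (k : ℝ) (n : ℤ) (f : TestFn) :
    mode k n (Polynomial.aeval TestFn.D (symbol k n) f)
      = dX (dX (dX (dX (mode k n f)))) - dX (dX (mode k n f)) - dY (dY (mode k n f)) := by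
  have hc : dY (const (n * freq k * Complex.I)) = 0 := dY_const _
  have e : Polynomial.aeval TestFn.D (symbol k n) f
      = TestFn.D (TestFn.D (TestFn.D (TestFn.D f))) - TestFn.D (TestFn.D f)
        + ((n * freq k : ℂ) ^ 2) • f := by
    unfold symbol
    generalize (n * freq k : ℂ) ^ 2 = c
    simp [pow_succ, Module.algebraMap_end_apply]
  rw [e, map_add, map_sub, map_smul, dX_mode, dX_mode, dX_mode, dX_mode, dY_mode,
    Derivation.leibniz, hc, smul_zero, add_zero, dY_mode, smul_eq_mul, const_mul_eq_smul,
    const_mul_eq_smul, smul_smul, sub_eq_add_neg _ ((_ : ℂ) • _), ← neg_smul]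
  congr 2
  linear_combination (n * freq k : ℂ) ^ 2 * Complex.I_sq

namespace KernelFn

variable {k : ℝ} {φ : ℝ → ℝ → ℝ}

/-- By `TauRing.intertwine` and the weak equation, this functional of `f` annihilates the range of
P_n(D). Its coefficients are bounded, so it vanishes along translates and must be zero. The gain is
that the identity holds on all modes, not only on those in that range. -/
theorem pairing_factorNum_mode (hk : k ∈ Set.Ioo (0 : ℝ) (1 / 2)) (h : KernelFn k φ) (n : ℤ)
    (f : TestFn) : h.pairing (ti hk ^ 2 *
      factorNum dX dY (const k) (const (freq k)) (C k) (S k) (co k) (si k) (mode k n f)) = 0 := by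
  set s := S k * ti hk
  set c := C k * ti hk
  set o := co k * ti hk
  set z := si k * ti hk
  set κ := const (k : ℂ)
  set η := const (freq k : ℂ)
  have hκ : κ ∈ bounded := const_mem_bounded _
  have hη : η ∈ bounded := const_mem_bounded _
  have hs : s ∈ bounded := S_mul_ti_mem_bounded hk
  have hc : c ∈ bounded := C_mul_ti_mem_bounded hk
  have ho : o ∈ bounded := co_mul_ti_mem_bounded hk
  have hz : z ∈ bounded := si_mul_ti_mem_bounded hk
  have hn : ∀ (n : ℕ) [n.AtLeastTwo], (ofNat(n) : SmoothFn) ∈ bounded := fun n _ => ofNat_mem _ n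
  -- The coefficients of τ⁻² `factorNum` in powers of ∂ₓ, expressed by the bounded quotients S/τ,
  -- C/τ, co/τ and si/τ. On a mode ∂_y is multiplication by inw, so its term joins `m0`.
  set m3 : SmoothFn := -(12 * κ * s) with hm3
  set m2 : SmoothFn := 16 * κ ^ 2 * c - 2 * κ ^ 2 * o - 3 with hm2
  set m1 : SmoothFn := κ * s * (6 - 12 * κ ^ 2) with hm1
  set m0 : SmoothFn := (3 * κ ^ 2 - 2 * κ ^ 4) * o - 4 * κ ^ 4 * c
    + (24 * κ ^ 4 - 6 * κ ^ 2) * s ^ 2 - 16 * κ ^ 4 * c ^ 2 + 2 * κ ^ 4 * (c * o)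
    + 3 * κ ^ 2 * c + 6 * η * z * const (n * freq k * Complex.I) + 6 * η ^ 2 * z ^ 2 with hm0
  have b4 : (4 : SmoothFn) ∈ bounded := hn 4
  have b3 : m3 ∈ bounded := neg_mem (mul_mem (mul_mem (hn 12) hκ) hs)
  have b2 : m2 ∈ bounded := by
    rw [hm2]
    repeat' first
      | assumption | apply add_mem | apply sub_mem | apply mul_mem | apply pow_mem | apply hn
  have b1 : m1 ∈ bounded := by
    rw [hm1]
    repeat' first
      | assumption | apply add_mem | apply sub_mem | apply mul_mem | apply pow_mem | apply hn
  have b0 : m0 ∈ bounded := by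
    rw [hm0]
    repeat' first
      | assumption | apply add_mem | apply sub_mem | apply mul_mem | apply pow_mem | apply hn
      | apply const_mem_bounded
  have hD := @TestFn.comp_D_mem_vanishing
  obtain ⟨l, hl, hlv⟩ : ∃ l : TestFn →ₗ[ℂ] ℂ, (∀ f, l f = h.coeff 4 n (D (D (D (D f))))
      + h.coeff m3 n (D (D (D f))) + h.coeff m2 n (D (D f)) + h.coeff m1 n (D f)
      + h.coeff m0 n f) ∧ l ∈ TestFn.vanishing :=
    ⟨_, fun _ => rfl, add_mem (add_mem (add_mem (add_mem
      (hD (hD (hD (hD (h.coeff_mem_vanishing b4 n))))) (hD (hD (hD (h.coeff_mem_vanishing b3 n)))))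
      (hD (hD (h.coeff_mem_vanishing b2 n)))) (hD (h.coeff_mem_vanishing b1 n)))
      (h.coeff_mem_vanishing b0 n)⟩
  have hτ : (C k + co k) * ti hk = 1 := tau_mul_ti hk
  have hlf : ∀ f, l f = h.pairing (ti hk ^ 2 *
      factorNum dX dY κ η (C k) (S k) (co k) (si k) (mode k n f)) := by
    intro f
    simp only [hl, coeff_apply, ← map_add]
    congr 1
    unfold factorNum
    rw [← dX_mode, ← dX_mode, ← dX_mode, ← dX_mode, dY_mode, hm3, hm2, hm1, hm0]
    generalize dX (dX (dX (dX (mode k n f)))) = F4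
    generalize dX (dX (dX (mode k n f))) = F3
    generalize dX (dX (mode k n f)) = F2
    generalize dX (mode k n f) = F1
    generalize mode k n f = F
    generalize const (n * freq k * Complex.I) = ν
    linear_combination (-(4 * F4 * ((C k + co k) * ti hk + 1) - 12 * κ * S k * ti hk * F3
      + (16 * κ ^ 2 * C k * ti hk - 2 * κ ^ 2 * co k * ti hk
        - 3 * ((C k + co k) * ti hk + 1)) * F2
      + κ * S k * ti hk * (6 - 12 * κ ^ 2) * F1
      + ((3 * κ ^ 2 - 2 * κ ^ 4) * co k * ti hk - 4 * κ ^ 4 * C k * ti hk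
        + 3 * κ ^ 2 * C k * ti hk) * F + 6 * η * si k * ti hk * (ν * F))) * hτ
  rw [← hlf, TestFn.eq_zero_of_vanishing hlv (symbol_ne_zero k n), LinearMap.zero_apply]
  intro f
  rw [hlf, mode_symbol, ← (tauRing hk).intertwine hτ]
  exact h.pairing_lin hk (Ideal.mul_mem_left _ _ (dress_mem_xCompact (mode_mem_xCompact _ _ _)))
    (mul_mem (ti_mem_yPeriodic hk) (dress_mem_yPeriodic hk (mode_mem_yPeriodic hk _ _)))

end KernelFn

end KPI

end

/-! ### Relations between the Fourier coefficients of φ and of Sφ. -/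

noncomputable section

namespace KPI

namespace TestFn

theorem add_apply (f g : TestFn) (x : ℝ) : (f + g).1 x = f.1 x + g.1 x := rfl
theorem sub_apply (f g : TestFn) (x : ℝ) : (f - g).1 x = f.1 x - g.1 x := rfl
theorem smul_apply (c : ℂ) (f : TestFn) (x : ℝ) : (c • f).1 x = c * f.1 x := rfl

theorem mulExp_apply (r : ℂ) (f : TestFn) (x : ℝ) :
    (mulExp r f).1 x = Complex.exp (r * x) * f.1 x := rfl

/-- Multiplication by `cosh (k x)`. -/
def cs (k : ℝ) : TestFn →ₗ[ℂ] TestFn :=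
  mulBy (fun x => ((Real.cosh (k * x) : ℝ) : ℂ))
    (Complex.ofRealCLM.contDiff.comp (by fun_prop : ContDiff ℝ ∞ fun x => Real.cosh (k * x)))

/-- Multiplication by `sinh (k x)`. -/
def sn (k : ℝ) : TestFn →ₗ[ℂ] TestFn :=
  mulBy (fun x => ((Real.sinh (k * x) : ℝ) : ℂ))
    (Complex.ofRealCLM.contDiff.comp (by fun_prop : ContDiff ℝ ∞ fun x => Real.sinh (k * x)))

theorem cs_apply (k : ℝ) (f : TestFn) (x : ℝ) :
    (cs k f).1 x = ((Real.cosh (k * x) : ℝ) : ℂ) * f.1 x := rfl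

theorem sn_apply (k : ℝ) (f : TestFn) (x : ℝ) :
    (sn k f).1 x = ((Real.sinh (k * x) : ℝ) : ℂ) * f.1 x := rfl

theorem D_cs (k : ℝ) (f : TestFn) : D (cs k f) = cs k (D f) + (k : ℂ) • sn k f := by
  refine Subtype.ext (funext fun x => ?_)
  have h := ((((hasDerivAt_id x).const_mul k).cosh).ofReal_comp.mul (f.hasDerivAt x)).deriv
  refine h.trans ?_
  rw [add_apply, smul_apply, cs_apply, sn_apply]
  simp only [id, mul_one]
  push_cast
  ring

theorem D_sn (k : ℝ) (f : TestFn) : D (sn k f) = sn k (D f) + (k : ℂ) • cs k f := by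
  refine Subtype.ext (funext fun x => ?_)
  have h := ((((hasDerivAt_id x).const_mul k).sinh).ofReal_comp.mul (f.hasDerivAt x)).deriv
  refine h.trans ?_
  rw [add_apply, smul_apply, cs_apply, sn_apply]
  simp only [id, mul_one]
  push_cast
  ring

theorem sinh_sq_ofReal (k x : ℝ) : ((Real.sinh (k * x) : ℝ) : ℂ) ^ 2
    = ((Real.cosh (k * x) : ℝ) : ℂ) ^ 2 - 1 := by
  exact_mod_cast Real.sinh_sq (k * x)

theorem aeval_symbol (k : ℝ) (n : ℤ) (f : TestFn) :
    Polynomial.aeval D (symbol k n) f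
      = D (D (D (D f))) - D (D f) + ((n * freq k : ℂ) ^ 2) • f := by
  unfold symbol
  generalize (n * freq k : ℂ) ^ 2 = c
  simp [pow_succ, Module.algebraMap_end_apply]

/-- The symmetrized shifted symbol: `½ (e^{kx} P(D + 2k) + e^{-kx} P(D - 2k))`. -/
def shifted (k : ℝ) (n : ℤ) (f : TestFn) : TestFn :=
  (1 / 2 : ℂ) • (mulExp (-k) (Polynomial.aeval D (symbol k n) (mulExp (2 * k) f))
    + mulExp k (Polynomial.aeval D (symbol k n) (mulExp (-(2 * k)) f)))

theorem shifted_eq (k : ℝ) (n : ℤ) (f : TestFn) :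
    shifted k n f = cs k (D (D (D (D f))) + (24 * k ^ 2 - 1 : ℂ) • D (D f)
        + (16 * k ^ 4 - 4 * k ^ 2 + (n * freq k) ^ 2 : ℂ) • f)
      + sn k ((8 * k : ℂ) • D (D (D f)) + (32 * k ^ 3 - 4 * k : ℂ) • D f) := by
  refine Subtype.ext (funext fun x => ?_)
  have e1 : Complex.exp (k * x) = ((Real.cosh (k * x) : ℝ) : ℂ) + ((Real.sinh (k * x) : ℝ) : ℂ) := by
    push_cast
    exact (Complex.cosh_add_sinh _).symm
  have e2 : Complex.exp (-k * x) = ((Real.cosh (k * x) : ℝ) : ℂ) - ((Real.sinh (k * x) : ℝ) : ℂ) := by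
    push_cast
    rw [Complex.cosh_sub_sinh, neg_mul]
  have e3 : Complex.exp (-k * x) * Complex.exp (2 * k * x) = Complex.exp (k * x) := by
    rw [← Complex.exp_add]; ring_nf
  have e4 : Complex.exp (k * x) * Complex.exp (-(2 * k) * x) = Complex.exp (-k * x) := by
    rw [← Complex.exp_add]; ring_nf
  simp only [shifted, aeval_symbol, D_mulExp, map_add, map_sub, map_smul, smul_add, add_apply,
    sub_apply, smul_apply, mulExp_apply, cs_apply, sn_apply]
  generalize (D (D (D (D f)))).1 x = f4
  generalize (D (D (D f))).1 x = f3
  generalize (D (D f)).1 x = f2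
  generalize (D f).1 x = f1
  generalize f.1 x = f0
  rw [e1] at e3 e4
  rw [e2] at e3 e4
  rw [e1, e2]
  linear_combination (1 / 2) * (f4 + 8 * k * f3 + (24 * k ^ 2 - 1) * f2 + (32 * k ^ 3 - 4 * k) * f1
      + (16 * k ^ 4 - 4 * k ^ 2 + (n * freq k) ^ 2) * f0) * e3
    + (1 / 2) * (f4 - 8 * k * f3 + (24 * k ^ 2 - 1) * f2 - (32 * k ^ 3 - 4 * k) * f1
      + (16 * k ^ 4 - 4 * k ^ 2 + (n * freq k) ^ 2) * f0) * e4

end TestFn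

open SmoothFn TestFn

theorem C_mul_mode (k : ℝ) (n : ℤ) (f : TestFn) : C k * mode k n f = mode k n (cs k f) :=
  Subtype.ext (funext fun _ => (mul_assoc _ _ _).symm)

theorem S_mul_mode (k : ℝ) (n : ℤ) (f : TestFn) : S k * mode k n f = mode k n (sn k f) :=
  Subtype.ext (funext fun _ => (mul_assoc _ _ _).symm)

theorem exp_mode_add_one (k : ℝ) (n : ℤ) (y : ℝ) :
    Complex.exp (((n + 1 : ℤ) * freq k * Complex.I) * y)
      = Complex.exp ((n * freq k * Complex.I) * y) *
        (((Real.cos (freq k * y) : ℝ) : ℂ) + ((Real.sin (freq k * y) : ℝ) : ℂ) * Complex.I) := by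
  push_cast
  rw [← Complex.exp_mul_I, ← Complex.exp_add]
  ring_nf

theorem exp_mode_sub_one (k : ℝ) (n : ℤ) (y : ℝ) :
    Complex.exp (((n - 1 : ℤ) * freq k * Complex.I) * y)
      = Complex.exp ((n * freq k * Complex.I) * y) *
        (((Real.cos (freq k * y) : ℝ) : ℂ) - ((Real.sin (freq k * y) : ℝ) : ℂ) * Complex.I) := by
  have h := exp_mode_add_one k (n - 1) y
  rw [sub_add_cancel] at h
  rw [h]
  have hp : ((Real.sin (freq k * y) : ℝ) : ℂ) ^ 2 + ((Real.cos (freq k * y) : ℝ) : ℂ) ^ 2 = 1 := by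
    exact_mod_cast Real.sin_sq_add_cos_sq (freq k * y)
  linear_combination Complex.exp (((n - 1 : ℤ) * freq k * Complex.I) * y) *
    (((Real.sin (freq k * y) : ℝ) : ℂ) ^ 2 * Complex.I_sq - hp)

theorem co_mul_mode (k : ℝ) (n : ℤ) (f : TestFn) : co k * mode k n f
    = mode k (n + 1) ((ampl k / 2 : ℂ) • f) + mode k (n - 1) ((ampl k / 2 : ℂ) • f) := by
  refine Subtype.ext (funext fun p => ?_)
  change ((ampl k * Real.cos (freq k * p.2) : ℝ) : ℂ) * (f.1 p.1 * Complex.exp _)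
    = (ampl k / 2 : ℂ) * f.1 p.1 * Complex.exp _ + (ampl k / 2 : ℂ) * f.1 p.1 * Complex.exp _
  rw [exp_mode_add_one, exp_mode_sub_one]
  rw [Complex.ofReal_mul]
  ring

theorem si_mul_mode (k : ℝ) (n : ℤ) (f : TestFn) : si k * mode k n f
    = mode k (n + 1) (-(ampl k / 2 * Complex.I : ℂ) • f)
      + mode k (n - 1) ((ampl k / 2 * Complex.I : ℂ) • f) := by
  refine Subtype.ext (funext fun p => ?_)
  change ((ampl k * Real.sin (freq k * p.2) : ℝ) : ℂ) * (f.1 p.1 * Complex.exp _)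
    = -(ampl k / 2 * Complex.I : ℂ) * f.1 p.1 * Complex.exp _
      + (ampl k / 2 * Complex.I : ℂ) * f.1 p.1 * Complex.exp _
  rw [exp_mode_add_one, exp_mode_sub_one]
  rw [Complex.ofReal_mul]
  linear_combination ((ampl k : ℂ) * ((Real.sin (freq k * p.2) : ℝ) : ℂ) * f.1 p.1 *
    Complex.exp ((n * freq k * Complex.I) * p.2)) * Complex.I_sq

theorem const_mul_mode (k : ℝ) (c : ℂ) (n : ℤ) (f : TestFn) :
    const c * mode k n f = mode k n (c • f) := by
  rw [const_mul_eq_smul, map_smul]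

theorem tau_mul_mode (k : ℝ) (n : ℤ) (f : TestFn) : (C k + co k) * mode k n f
    = mode k n (cs k f) + mode k (n + 1) ((ampl k / 2 : ℂ) • f)
      + mode k (n - 1) ((ampl k / 2 : ℂ) • f) := by
  rw [add_mul, C_mul_mode, co_mul_mode, add_assoc]

theorem factorNum_add {R : Type*} [CommRing R] (X Y : IntDer R) (k w C S co si F G : R) :
    factorNum X Y k w C S co si (F + G)
      = factorNum X Y k w C S co si F + factorNum X Y k w C S co si G := by
  simp only [factorNum, map_add]
  ring

namespace KernelFn

variable {k : ℝ} {φ : ℝ → ℝ → ℝ}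

/-- `f ↦ ∫ φ f(x) exp (i n w y)` -/
def four (h : KernelFn k φ) (n : ℤ) : TestFn →ₗ[ℂ] ℂ := h.pairing ∘ₗ mode k n

theorem four_apply (h : KernelFn k φ) (n : ℤ) (f : TestFn) :
    h.four n f = h.pairing (mode k n f) := rfl

theorem four_mem_vanishing (h : KernelFn k φ) (n : ℤ) : h.four n ∈ vanishing := by
  have := h.coeff_mem_vanishing (one_mem bounded) n
  have e : h.coeff 1 n = h.four n := LinearMap.ext fun f => by rw [coeff_apply, one_mul, four_apply]
  rwa [e] at this

/-- The functional `f ↦ ∫ φ S(f(x) exp (i n w y))` with `S = ∂ₓ² - 1 + 6 Q`. -/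
def sig (hk : k ∈ Set.Ioo (0 : ℝ) (1 / 2)) (h : KernelFn k φ) (n : ℤ) : TestFn →ₗ[ℂ] ℂ :=
  (h.four n ∘ₗ D) ∘ₗ D - h.four n + h.coeff (6 * prof hk) n

theorem sig_apply (hk : k ∈ Set.Ioo (0 : ℝ) (1 / 2)) (h : KernelFn k φ) (n : ℤ) (f : TestFn) :
    h.sig hk n f = h.pairing (schr dX (prof hk) (mode k n f)) := by
  rw [schr, map_add, map_sub, dX_mode, dX_mode]
  rfl

theorem sig_mem_vanishing (hk : k ∈ Set.Ioo (0 : ℝ) (1 / 2)) (h : KernelFn k φ) (n : ℤ) :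
    h.sig hk n ∈ vanishing :=
  add_mem (sub_mem (comp_D_mem_vanishing (comp_D_mem_vanishing (h.four_mem_vanishing n)))
    (h.four_mem_vanishing n))
    (h.coeff_mem_vanishing (mul_mem (ofNat_mem _ 6) (prof_mem_bounded hk)) n)

theorem sig_D_D (hk : k ∈ Set.Ioo (0 : ℝ) (1 / 2)) (h : KernelFn k φ) (n : ℤ) (f : TestFn) :
    h.sig hk n (D (D f)) = -(n * freq k : ℂ) ^ 2 * h.four n f := by
  have h1 := h.pairing_lin hk (mode_mem_xCompact k n f) (mode_mem_yPeriodic hk n f)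
  have hc : dY (const (n * freq k * Complex.I)) = 0 := dY_const _
  rw [dX_mode, dX_mode, map_sub, ← sig_apply, sub_eq_zero, dY_mode, Derivation.leibniz, hc,
    smul_zero, add_zero, smul_eq_mul, dY_mode, const_mul_eq_smul, const_mul_eq_smul, map_smul,
    map_smul, ← four_apply, smul_eq_mul, smul_eq_mul] at h1
  rw [h1]
  linear_combination (n * freq k : ℂ) ^ 2 * h.four n f * Complex.I_sq

/-- The mean of Sφ over a period has vanishing second derivative and tends to zero. This is the
compatibility condition for Sφ to be a second y-derivative. -/
theorem sig_zero (hk : k ∈ Set.Ioo (0 : ℝ) (1 / 2)) (h : KernelFn k φ) : h.sig hk 0 = 0 := by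
  refine eq_zero_of_vanishing (h.sig_mem_vanishing hk 0) (p := Polynomial.X ^ 2)
    (pow_ne_zero _ Polynomial.X_ne_zero) fun f => ?_
  have h1 := h.sig_D_D hk 0 f
  simp only [Int.cast_zero, zero_mul, ne_eq, OfNat.ofNat_ne_zero, not_false_eq_true, zero_pow,
    neg_zero] at h1
  simpa [pow_two] using h1

/-- τ times a mode is a sum of three modes, so `pairing_factorNum_mode` applies to it.
`TauRing.factor_mul` supplies the denominator-free expression, which is sorted here by frequency. -/
theorem four_relation (hk : k ∈ Set.Ioo (0 : ℝ) (1 / 2)) (h : KernelFn k φ) (n : ℤ) (f : TestFn) :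
    h.four n (cs k (D (D (D (D f)))) - (2 * k : ℂ) • sn k (D (D (D f)))
        + (k ^ 2 : ℂ) • cs k (D (D f)))
      + (ampl k / 2 : ℂ) * h.four (n + 1) (D (D (D (D f))) - (2 * k ^ 2 : ℂ) • D (D f)
        + (3 * k ^ 2 - 2 * k ^ 4 + 6 * n * freq k ^ 2 : ℂ) • f)
      + (ampl k / 2 : ℂ) * h.four (n - 1) (D (D (D (D f))) - (2 * k ^ 2 : ℂ) • D (D f)
        + (3 * k ^ 2 - 2 * k ^ 4 - 6 * n * freq k ^ 2 : ℂ) • f)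
      + 3 * h.sig hk n (cs k (D (D f)))
      + 3 * (ampl k / 2 : ℂ) * h.sig hk (n + 1) (D (D f))
      + 3 * (ampl k / 2 : ℂ) * h.sig hk (n - 1) (D (D f)) = 0 := by
  have h1 := (tauRing hk).factor_mul (tau_mul_ti hk) (mode k n f)
  have h2 : h.pairing (ti hk ^ 2 * factorNum dX dY (const k) (const (freq k)) (C k) (S k) (co k)
      (si k) ((C k + co k) * mode k n f)) = 0 := by
    rw [tau_mul_mode, factorNum_add, factorNum_add, mul_add, mul_add, map_add, map_add,
      h.pairing_factorNum_mode hk, h.pairing_factorNum_mode hk, h.pairing_factorNum_mode hk,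
      add_zero, add_zero]
  rw [h1] at h2
  rw [dX_mode, dX_mode, dX_mode, dX_mode, dY_mode, tau_mul_mode] at h2
  have e1 : (2 : SmoothFn) * const k * S k * mode k n (D (D (D f)))
      = mode k n ((2 * k : ℂ) • sn k (D (D (D f)))) := by
    rw [mul_assoc _ (S k), S_mul_mode, map_smul, ← const_mul_eq_smul]
    rfl
  have e2 : (const (k : ℂ) ^ 2 * C k - 2 * const k ^ 2 * co k) * mode k n (D (D f))
      = mode k n ((k ^ 2 : ℂ) • cs k (D (D f)))
        - mode k (n + 1) ((ampl k / 2 : ℂ) • (2 * k ^ 2 : ℂ) • D (D f))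
        - mode k (n - 1) ((ampl k / 2 : ℂ) • (2 * k ^ 2 : ℂ) • D (D f)) := by
    have e : (2 * const k ^ 2 : SmoothFn) = const (2 * k ^ 2) := rfl
    have e' : (const k ^ 2 : SmoothFn) = const (k ^ 2) := rfl
    rw [sub_mul, mul_assoc, C_mul_mode, e, mul_assoc, mul_left_comm, const_mul_mode, co_mul_mode,
      sub_sub, e', const_mul_mode]
  have e3 : (3 * const (k : ℂ) ^ 2 - 2 * const (k : ℂ) ^ 4) * co k * mode k n f
      = mode k (n + 1) ((ampl k / 2 : ℂ) • (3 * k ^ 2 - 2 * k ^ 4 : ℂ) • f)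
        + mode k (n - 1) ((ampl k / 2 : ℂ) • (3 * k ^ 2 - 2 * k ^ 4 : ℂ) • f) := by
    have e : (3 * const (k : ℂ) ^ 2 - 2 * const (k : ℂ) ^ 4 : SmoothFn)
      = const (3 * k ^ 2 - 2 * k ^ 4) := rfl
    rw [e, mul_assoc, mul_left_comm, const_mul_mode, co_mul_mode]
  have e4 : 6 * const (freq k : ℂ) * si k * (const (n * freq k * Complex.I) * mode k n f)
      = mode k (n + 1) ((ampl k / 2 : ℂ) • (6 * n * freq k ^ 2 : ℂ) • f)
        + mode k (n - 1) ((ampl k / 2 : ℂ) • (-(6 * n * freq k ^ 2) : ℂ) • f) := by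
    have e : 6 * const (freq k : ℂ) * si k * (const (n * freq k * Complex.I) * mode k n f)
      = (const (6 * freq k * (n * freq k * Complex.I))) * (si k * mode k n f) := by
      have : (const (6 * freq k * (n * freq k * Complex.I)) : SmoothFn)
        = 6 * const (freq k : ℂ) * const (n * freq k * Complex.I) := rfl
      rw [this]; ring
    rw [e, si_mul_mode, mul_add, const_mul_mode, const_mul_mode, smul_smul, smul_smul, smul_smul,
      smul_smul]
    congr 3
    · linear_combination (-3 * ampl k * n * freq k ^ 2 : ℂ) * Complex.I_sq
    · linear_combination (3 * ampl k * n * freq k ^ 2 : ℂ) * Complex.I_sq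
  have e5 : ∀ F G H : SmoothFn, 3 * schr dX (prof hk) (F + G + H)
      = 3 * schr dX (prof hk) F + 3 * schr dX (prof hk) G + 3 * schr dX (prof hk) H := by
    intro F G H
    simp only [schr, map_add]
    ring
  have e6 : ∀ g : SmoothFn, h.pairing (3 * g) = 3 * h.pairing g := by
    intro g
    have : (3 : SmoothFn) * g = (3 : ℂ) • g := const_mul_eq_smul 3 g
    rw [this, map_smul, smul_eq_mul]
  have e7 : schr dX (2 * const (k : ℂ) ^ 2 * (1 + C k * co k) * ti hk ^ 2)
      = schr dX (prof hk) := rfl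
  rw [e1, e2, e3, e4, e7, tau_mul_mode, e5] at h2
  simp only [map_add, e6, ← sig_apply] at h2
  simp only [map_add, map_sub, map_smul, ← four_apply, smul_eq_mul] at h2 ⊢
  linear_combination h2

/-- Testing Sφ against τ² times a mode removes the denominator of Q, as 6Qτ² = 12k²(1 + C co). The
functions `g0`, `g1`, `g2` are the coefficients of τ²f at the frequencies n, n ± 1, n ± 2. -/
theorem square_relation (hk : k ∈ Set.Ioo (0 : ℝ) (1 / 2)) (h : KernelFn k φ) (n : ℤ)
    (f g0 g1 g2 : TestFn) (hg0 : g0 = cs k (cs k f) + (ampl k ^ 2 / 2 : ℂ) • f)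
    (hg1 : g1 = (ampl k : ℂ) • cs k f) (hg2 : g2 = (ampl k ^ 2 / 4 : ℂ) • f) :
    h.sig hk n g0 + h.sig hk (n + 1) g1 + h.sig hk (n - 1) g1 + h.sig hk (n + 2) g2
        + h.sig hk (n - 2) g2
      = h.four n (D (D g0) - g0 + (12 * k ^ 2 : ℂ) • f)
        + h.four (n + 1) (D (D g1) - g1 + (6 * k ^ 2 : ℂ) • g1)
        + h.four (n - 1) (D (D g1) - g1 + (6 * k ^ 2 : ℂ) • g1)
        + h.four (n + 2) (D (D g2) - g2) + h.four (n - 2) (D (D g2) - g2) := by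
  have hG : (C k + co k) * ((C k + co k) * mode k n f) = mode k n g0 + mode k (n + 1) g1
      + mode k (n - 1) g1 + mode k (n + 2) g2 + mode k (n - 2) g2 := by
    rw [tau_mul_mode, mul_add, mul_add, tau_mul_mode, tau_mul_mode, tau_mul_mode, hg0, hg1, hg2,
      add_sub_cancel_right, sub_add_cancel, show n + 1 + 1 = n + 2 by ring,
      show n - 1 - 1 = n - 2 by ring]
    simp only [map_add, map_smul, smul_smul]
    module
  have hco : (1 + C k * co k) * mode k n f
      = mode k n f + mode k (n + 1) ((1 / 2 : ℂ) • g1) + mode k (n - 1) ((1 / 2 : ℂ) • g1) := by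
    have : (1 + C k * co k) * mode k n f = mode k n f + co k * (C k * mode k n f) := by ring
    rw [this, C_mul_mode, co_mul_mode, hg1, smul_smul, add_assoc]
    congr 4 <;> ring
  have hs : schr dX (prof hk) ((C k + co k) * ((C k + co k) * mode k n f))
      = dX (dX ((C k + co k) * ((C k + co k) * mode k n f)))
        - (C k + co k) * ((C k + co k) * mode k n f)
        + const (12 * k ^ 2) * ((1 + C k * co k) * mode k n f) := by
    have hc : const (12 * k ^ 2 : ℂ) = 12 * const (k : ℂ) ^ 2 := rfl
    rw [schr, hc, prof]
    linear_combination (12 * const (k : ℂ) ^ 2 * (1 + C k * co k) * mode k n f *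
      ((C k + co k) * ti hk + 1)) * tau_mul_ti hk
  have e5 : ∀ F G : SmoothFn, schr dX (prof hk) (F + G)
      = schr dX (prof hk) F + schr dX (prof hk) G := by
    intro F G
    simp only [schr, map_add]
    ring
  rw [hG, hco] at hs
  simp only [e5, map_add, mul_add, dX_mode, const_mul_mode] at hs
  have h2 := congrArg h.pairing hs
  simp only [map_add, map_sub, map_smul, ← sig_apply, ← four_apply, smul_eq_mul] at h2 ⊢
  linear_combination h2

end KernelFn

end KPI

end

/-! ### The potential ψ, and the two equations for θ = τψ. -/

noncomputable section

namespace KPI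

open SmoothFn TestFn

theorem freq_sq_ofReal {k : ℝ} (hk : k ∈ Set.Ioo (0 : ℝ) (1 / 2)) :
    (freq k : ℂ) ^ 2 = (k : ℂ) ^ 2 - (k : ℂ) ^ 4 := by
  exact_mod_cast freq_sq hk

theorem ampl_sq_ofReal {k : ℝ} (hk : k ∈ Set.Ioo (0 : ℝ) (1 / 2)) :
    (ampl k : ℂ) ^ 2 * (1 - (k : ℂ) ^ 2) = 1 - 4 * (k : ℂ) ^ 2 := by
  exact_mod_cast ampl_sq hk

/-- Fourier coefficients of `τ ψ` in terms of those of `ψ`. -/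
def theta (k : ℝ) (ψ : ℤ → TestFn →ₗ[ℂ] ℂ) (n : ℤ) : TestFn →ₗ[ℂ] ℂ :=
  ψ n ∘ₗ cs k + (ampl k / 2 : ℂ) • (ψ (n + 1) + ψ (n - 1))

theorem theta_apply (k : ℝ) (ψ : ℤ → TestFn →ₗ[ℂ] ℂ) (n : ℤ) (f : TestFn) :
    theta k ψ n f = ψ n (cs k f) + (ampl k / 2 : ℂ) * (ψ (n + 1) f + ψ (n - 1) f) := rfl

/-- The symbol `X² ((X² - k²)² - 3 n² w²)`. -/
def resSymbol (k : ℝ) (n : ℤ) : Polynomial ℂ :=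
  Polynomial.X ^ 2 * ((Polynomial.X ^ 2 - Polynomial.C (k ^ 2 : ℂ)) ^ 2
    - Polynomial.C (3 * (n * freq k) ^ 2 : ℂ))

theorem aeval_resSymbol (k : ℝ) (n : ℤ) (f : TestFn) :
    Polynomial.aeval D (resSymbol k n) f = D (D (D (D (D (D f)))))
      - (2 * k ^ 2 : ℂ) • D (D (D (D f))) + (k ^ 4 - 3 * (n * freq k) ^ 2 : ℂ) • D (D f) := by
  unfold resSymbol
  have h4 : (k ^ 4 : ℂ) = (k ^ 2 : ℂ) * k ^ 2 := by ring
  have h2 : (2 * k ^ 2 : ℂ) = (k ^ 2 : ℂ) + k ^ 2 := by ring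
  rw [h4, h2]
  generalize (3 * (n * freq k) ^ 2 : ℂ) = c
  generalize (k ^ 2 : ℂ) = d
  simp only [pow_succ, pow_zero, one_mul, map_mul, map_sub, Polynomial.aeval_X,
    Polynomial.aeval_C, Module.End.mul_apply, LinearMap.sub_apply, Module.algebraMap_end_apply,
    map_smul]
  module

/-- `ψ` is the family of Fourier coefficients of a potential: `φ = ∂ₓ² ψ` and `S φ = ∂_y² ψ`. -/
structure IsPotential {k : ℝ} {φ : ℝ → ℝ → ℝ} (hk : k ∈ Set.Ioo (0 : ℝ) (1 / 2))
    (h : KernelFn k φ) (ψ : ℤ → TestFn →ₗ[ℂ] ℂ) : Prop where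
  four_eq : ∀ n f, h.four n f = ψ n (D (D f))
  sig_eq : ∀ n f, h.sig hk n f = -(n * freq k : ℂ) ^ 2 * ψ n f

namespace IsPotential

variable {k : ℝ} {φ : ℝ → ℝ → ℝ} {hk : k ∈ Set.Ioo (0 : ℝ) (1 / 2)}
  {h : KernelFn k φ} {ψ : ℤ → TestFn →ₗ[ℂ] ℂ}

/-- `four_relation` rewritten for ψ. At the frequencies n ± 1 the zeroth order terms combine as 3k²
- 2k⁴ ± 6nw² - 3(n ± 1)²w² = k⁴ - 3n²w², because w² = k² - k⁴. So the same operator acts at all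
three frequencies and only θ_n remains. -/
theorem theta_resSymbol (hψ : IsPotential hk h ψ) (n : ℤ) (f : TestFn) :
    theta k ψ n (Polynomial.aeval D (resSymbol k n) f) = 0 := by
  have h1 := h.four_relation hk n f
  -- The two derivatives coming from φ = ∂ₓ²ψ cancel the sinh terms, leaving cosh(kx) times a
  -- constant coefficient operator.
  have e1 : D (D (cs k (D (D (D (D f)))) - (2 * k : ℂ) • sn k (D (D (D f)))
      + (k ^ 2 : ℂ) • cs k (D (D f))))
      = cs k (D (D (D (D (D (D f))))) - (2 * k ^ 2 : ℂ) • D (D (D (D f)))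
        + (k ^ 4 : ℂ) • D (D f)) := by
    simp only [map_add, map_sub, map_smul, D_cs, D_sn]
    module
  rw [hψ.four_eq, e1] at h1
  simp only [hψ.four_eq, hψ.sig_eq, map_add, map_sub, map_smul, smul_eq_mul] at h1
  rw [theta_apply, aeval_resSymbol]
  simp only [map_add, map_sub, map_smul, smul_eq_mul]
  push_cast at h1 ⊢
  linear_combination h1 + (3 * ampl k / 2 * (ψ (n + 1) (D (D f)) + ψ (n - 1) (D (D f)))) *
    freq_sq_ofReal hk

/-- The weak form of (D_x⁴ - D_x² - D_y²) τ·θ = 0, with Hirota derivatives. In the transposed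
operator each exponential of τ shifts the symbol by twice its exponent: exp(±kx) gives P_n(D ± 2k),
contained in `shifted`, and exp(±iwy) gives P_{n±2}(D). -/
theorem theta_shifted (hψ : IsPotential hk h ψ) (n : ℤ) (f : TestFn) :
    theta k ψ n (shifted k n f)
      + (ampl k / 2 : ℂ) * theta k ψ (n + 1) (Polynomial.aeval D (symbol k (n + 2)) f)
      + (ampl k / 2 : ℂ) * theta k ψ (n - 1) (Polynomial.aeval D (symbol k (n - 2)) f) = 0 := by
  have h1 := h.square_relation hk n f _ _ _ rfl rfl rfl
  set g0 := cs k (cs k f) + (ampl k ^ 2 / 2 : ℂ) • f with hg0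
  set g1 := (ampl k : ℂ) • cs k f with hg1
  set g2 := (ampl k ^ 2 / 4 : ℂ) • f with hg2
  have a := ampl_sq_ofReal hk
  have w := freq_sq_ofReal hk
  -- `i0`, `i1`, `i2` compare the coefficients of ψ_n, ψ_{n±1} and ψ_{n±2} in `square_relation` with
  -- those of the bilinear equation. In `i1` the index m is n ± 1, so 2m - n is n ± 2.
  have i0 : D (D (D (D g0) - g0 + (12 * k ^ 2 : ℂ) • f)) + ((n * freq k) ^ 2 : ℂ) • g0
      = cs k (shifted k n f) + (ampl k ^ 2 / 4 : ℂ) •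
        (Polynomial.aeval D (symbol k (n + 2)) f + Polynomial.aeval D (symbol k (n - 2)) f) := by
    rw [shifted_eq, aeval_symbol, aeval_symbol, hg0]
    refine Subtype.ext (funext fun x => ?_)
    simp only [map_add, map_sub, map_smul, D_cs, D_sn, smul_add, add_apply, sub_apply, smul_apply,
      cs_apply, sn_apply]
    have hs := sinh_sq_ofReal k x
    generalize (D (D (D (D f)))).1 x = f4
    generalize (D (D (D f))).1 x = f3
    generalize (D (D f)).1 x = f2
    generalize (D f).1 x = f1
    generalize f.1 x = f0
    push_cast at hs ⊢
    generalize Complex.cosh (k * x) = c at hs ⊢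
    generalize Complex.sinh (k * x) = s at hs ⊢
    linear_combination (12 * k ^ 2 * f2 + 8 * k ^ 4 * f0 - 2 * k ^ 2 * f0) * hs
      + (-(2 * k ^ 2 * f0)) * a + (-(2 * ampl k ^ 2 * f0)) * w
  have i1 : ∀ m : ℤ, (m - n) ^ 2 = 1 →
      D (D (D (D g1) - g1 + (6 * k ^ 2 : ℂ) • g1)) + ((m * freq k) ^ 2 : ℂ) • g1
      = (ampl k / 2 : ℂ) • (shifted k n f
        + cs k (Polynomial.aeval D (symbol k (2 * m - n)) f)) := by
    intro m hm
    have hm' : ((m : ℂ) - n) ^ 2 = 1 := by exact_mod_cast hm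
    rw [shifted_eq, aeval_symbol, hg1]
    refine Subtype.ext (funext fun x => ?_)
    simp only [map_add, map_sub, map_smul, D_cs, D_sn, smul_add, add_apply, sub_apply, smul_apply,
      cs_apply, sn_apply]
    generalize (D (D (D (D f)))).1 x = f4
    generalize (D (D (D f))).1 x = f3
    generalize (D (D f)).1 x = f2
    generalize (D f).1 x = f1
    generalize f.1 x = f0
    push_cast
    generalize Complex.cosh (k * x) = c
    generalize Complex.sinh (k * x) = s
    linear_combination (-(ampl k * freq k ^ 2 * c * f0)) * hm' + (-(ampl k * c * f0)) * w
  have i2 : ∀ m : ℤ, D (D (D (D g2) - g2)) + ((m * freq k) ^ 2 : ℂ) • g2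
      = (ampl k ^ 2 / 4 : ℂ) • Polynomial.aeval D (symbol k m) f := by
    intro m
    rw [aeval_symbol, hg2]
    simp only [map_sub, map_smul]
    module
  have j1 := i1 (n + 1) (by ring)
  have j2 := i1 (n - 1) (by ring)
  rw [show 2 * (n + 1) - n = n + 2 by ring] at j1
  rw [show 2 * (n - 1) - n = n - 2 by ring] at j2
  have j3 := i2 (n + 2)
  have j4 := i2 (n - 2)
  rw [hψ.four_eq, hψ.four_eq, hψ.four_eq, hψ.four_eq, hψ.four_eq, hψ.sig_eq, hψ.sig_eq, hψ.sig_eq,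
    hψ.sig_eq, hψ.sig_eq] at h1
  clear i1 i2 hg0 hg1 hg2
  clear_value g0 g1 g2
  generalize D (D (D (D g0) - g0 + (12 * k ^ 2 : ℂ) • f)) = H0 at i0 h1
  generalize D (D (D (D g1) - g1 + (6 * k ^ 2 : ℂ) • g1)) = H1 at j1 j2 h1
  generalize D (D (D (D g2) - g2)) = H2 at j3 j4 h1
  generalize Polynomial.aeval D (symbol k (n + 2)) f = A at *
  generalize Polynomial.aeval D (symbol k (n - 2)) f = B at *
  generalize shifted k n f = E at *
  have k0 := congrArg (ψ n) i0
  have k1 := congrArg (ψ (n + 1)) j1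
  have k2 := congrArg (ψ (n - 1)) j2
  have k3 := congrArg (ψ (n + 2)) j3
  have k4 := congrArg (ψ (n - 2)) j4
  rw [theta_apply, theta_apply, theta_apply, add_sub_cancel_right, sub_add_cancel,
    show n + 1 + 1 = n + 2 by ring, show n - 1 - 1 = n - 2 by ring]
  simp only [smul_eq_mul, map_add, map_smul] at k0 k1 k2 k3 k4
  linear_combination -k0 - k1 - k2 - k3 - k4 - h1

end IsPotential

end KPI

end

/-! ### Functionals growing more slowly than exp(k|X|), and exponential integrals. -/

noncomputable section

namespace KPI

open SmoothFn

namespace TestFn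

/-- Functionals with `exp (-k |X|) l (T X f) → 0`. -/
def tempered (k : ℝ) : Submodule ℂ (TestFn →ₗ[ℂ] ℂ) where
  carrier := {l | ∀ f, Tendsto (fun X : ℝ => (Real.exp (-(k * |X|)) : ℂ) * l (T X f))
    (cocompact ℝ) (𝓝 0)}
  add_mem' := fun ha hb f => by simpa [mul_add] using (ha f).add (hb f)
  zero_mem' := fun _ => by simp
  smul_mem' := fun c l hl f => by
    have := (hl f).const_mul c
    simpa [mul_left_comm] using this

theorem comp_aeval_mem_tempered {k : ℝ} {l : TestFn →ₗ[ℂ] ℂ} (hl : l ∈ tempered k)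
    (p : Polynomial ℂ) : l ∘ₗ Polynomial.aeval D p ∈ tempered k :=
  fun f => by simpa [aeval_D_T] using hl (Polynomial.aeval D p f)

theorem tendsto_exp_neg_mul_pow {k : ℝ} (hk : 0 < k) (n : ℕ) :
    Tendsto (fun X : ℝ => Real.exp (-(k * |X|)) * |X| ^ n) (cocompact ℝ) (𝓝 0) := by
  have h1 : Tendsto (fun X : ℝ => k * |X|) (cocompact ℝ) atTop :=
    (tendsto_norm_cocompact_atTop (E := ℝ)).const_mul_atTop hk
  have h2 := ((Real.tendsto_pow_mul_exp_neg_atTop_nhds_zero n).comp h1).const_mul ((k ^ n)⁻¹)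
  rw [mul_zero] at h2
  refine h2.congr fun X => ?_
  simp only [Function.comp, mul_pow]
  field_simp

theorem norm_exp_mul_le {k X u : ℝ} (hu : |u| ≤ Real.cosh (k * X)) (hk : 0 < k) :
    ‖((Real.exp (-(k * |X|)) : ℝ) : ℂ) * (u : ℂ)‖ ≤ 1 := by
  rw [norm_mul, Complex.norm_real, Complex.norm_real, Real.norm_eq_abs, Real.norm_eq_abs,
    abs_of_pos (Real.exp_pos _), Real.exp_neg, inv_mul_le_iff₀ (Real.exp_pos _), mul_one]
  refine hu.trans ?_
  rw [← Real.cosh_abs, abs_mul, abs_of_pos hk, Real.cosh_eq]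
  have : Real.exp (-(k * |X|)) ≤ Real.exp (k * |X|) :=
    Real.exp_le_exp.2 (by have := mul_nonneg hk.le (abs_nonneg X); linarith)
  linarith

theorem abs_sinh_le_cosh (x : ℝ) : |Real.sinh x| ≤ Real.cosh x :=
  abs_le.2 ⟨by have := Real.cosh_add_sinh x; have := Real.exp_pos x; linarith,
    (Real.sinh_lt_cosh _).le⟩

theorem tendsto_zero_of_norm_le_one_mul {F : Filter ℝ} {m u : ℝ → ℂ} (hm : ∀ X, ‖m X‖ ≤ 1)
    (hu : Tendsto u F (𝓝 0)) : Tendsto (fun X => m X * u X) F (𝓝 0) := by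
  refine squeeze_zero_norm (a := fun X => ‖u X‖) (fun X => ?_) (by simpa using hu.norm)
  rw [norm_mul]
  exact mul_le_of_le_one_left (norm_nonneg _) (hm X)

theorem cs_T (k X : ℝ) (f : TestFn) : cs k (T X f) = ((Real.cosh (k * X) : ℝ) : ℂ) • T X (cs k f)
    + ((Real.sinh (k * X) : ℝ) : ℂ) • T X (sn k f) := by
  refine Subtype.ext (funext fun x => ?_)
  change ((Real.cosh (k * x) : ℝ) : ℂ) * f.1 (x - X)
    = ((Real.cosh (k * X) : ℝ) : ℂ) * (((Real.cosh (k * (x - X)) : ℝ) : ℂ) * f.1 (x - X))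
      + ((Real.sinh (k * X) : ℝ) : ℂ) * (((Real.sinh (k * (x - X)) : ℝ) : ℂ) * f.1 (x - X))
  have h : Real.cosh (k * x) = Real.cosh (k * X) * Real.cosh (k * (x - X))
      + Real.sinh (k * X) * Real.sinh (k * (x - X)) := by
    rw [← Real.cosh_add]; ring_nf
  rw [h]
  push_cast
  ring

/-- By the addition formula, a translate multiplied by cosh(kx) costs at most the factors cosh(kX)
and |sinh(kX)|, both bounded by exp(k|X|), while `l` contributes the decay. -/
theorem comp_cs_mem_tempered {k : ℝ} (hk : 0 < k) {l : TestFn →ₗ[ℂ] ℂ} (hl : l ∈ vanishing) :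
    l ∘ₗ cs k ∈ tempered k := by
  intro f
  have h1 := tendsto_zero_of_norm_le_one_mul
    (fun X => norm_exp_mul_le (X := X) (abs_of_pos (Real.cosh_pos (k * X))).le hk) (hl (cs k f))
  have h2 := tendsto_zero_of_norm_le_one_mul
    (fun X => norm_exp_mul_le (X := X) (abs_sinh_le_cosh (k * X)) hk) (hl (sn k f))
  have h3 := h1.add h2
  rw [add_zero] at h3
  refine h3.congr fun X => ?_
  rw [LinearMap.comp_apply, cs_T, map_add, map_smul, map_smul, smul_eq_mul, smul_eq_mul]
  ring

theorem mem_tempered_of_vanishing {k : ℝ} (hk : 0 < k) {l : TestFn →ₗ[ℂ] ℂ}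
    (hl : l ∈ vanishing) : l ∈ tempered k := fun f => by
  refine tendsto_zero_of_norm_le_one_mul (fun X => ?_) (hl f)
  rw [Complex.norm_real, Real.norm_eq_abs, abs_of_pos (Real.exp_pos _), Real.exp_le_one_iff]
  have := mul_nonneg hk.le (abs_nonneg X)
  linarith

theorem mem_tempered_of_le {k : ℝ} (hk : 0 < k) {l : TestFn →ₗ[ℂ] ℂ}
    (hl : ∀ f, ∃ c, ∀ X, ‖l (T X f)‖ ≤ c * (1 + X ^ 2)) : l ∈ tempered k := by
  intro f
  obtain ⟨c, hc⟩ := hl f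
  have h1 := ((tendsto_exp_neg_mul_pow hk 0).add (tendsto_exp_neg_mul_pow hk 2)).const_mul c
  rw [add_zero, mul_zero] at h1
  refine squeeze_zero_norm (fun X => ?_) h1
  rw [norm_mul, Complex.norm_real, Real.norm_eq_abs, abs_of_pos (Real.exp_pos _), sq_abs, pow_zero]
  have := mul_le_mul_of_nonneg_left (hc X) (Real.exp_pos (-(k * |X|))).le
  linarith

theorem tendsto_exp_mul_of_tempered {k : ℝ} {l : TestFn →ₗ[ℂ] ℂ} (hl : l ∈ tempered k)
    (f : TestFn) {r : ℂ} {F : Filter ℝ} (hF : F ≤ cocompact ℝ)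
    (hr : ∀ᶠ X in F, r.re * X ≤ -(k * |X|)) :
    Tendsto (fun X : ℝ => Complex.exp (r * X) * l (T X f)) F (𝓝 0) := by
  refine squeeze_zero_norm' (a := fun X => ‖(Real.exp (-(k * |X|)) : ℂ) * l (T X f)‖) ?_
    (by simpa using ((hl f).mono_left hF).norm)
  filter_upwards [hr] with X hX
  rw [norm_mul, norm_mul, Complex.norm_exp, Complex.norm_real, Real.norm_eq_abs,
    abs_of_pos (Real.exp_pos _)]
  refine mul_le_mul_of_nonneg_right (Real.exp_le_exp.2 ?_) (norm_nonneg _)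
  simpa using hX

/-- A root with |Re r| ≥ k lets exp(rX) beat the growth of `l` in one of the two directions,
including the equality case since the definition of `tempered` asks for a limit zero. -/
theorem eq_zero_of_tempered {k : ℝ} {l : TestFn →ₗ[ℂ] ℂ} (hl : l ∈ tempered k)
    {p : Polynomial ℂ} (hp : p ≠ 0) (hr : ∀ r, p.IsRoot r → k ≤ |r.re|)
    (h : ∀ f, l (Polynomial.aeval D p f) = 0) : l = 0 := by
  refine eq_zero_of_aeval p hp l (fun r hroot => ?_) h
  rcases le_total r.re 0 with h0 | h0
  · refine ⟨atTop, inferInstance, fun f =>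
      tendsto_exp_mul_of_tempered hl f atTop_le_cocompact ?_⟩
    filter_upwards [eventually_ge_atTop 0] with X hX
    have := hr r hroot
    rw [abs_of_nonpos h0] at this
    rw [abs_of_nonneg hX]
    nlinarith
  · refine ⟨atBot, inferInstance, fun f =>
      tendsto_exp_mul_of_tempered hl f atBot_le_cocompact ?_⟩
    filter_upwards [eventually_le_atBot 0] with X hX
    have := hr r hroot
    rw [abs_of_nonneg h0] at this
    rw [abs_of_nonpos hX]
    nlinarith

theorem expInt_D (r : ℂ) (f : TestFn) : expInt r (D f) = r * expInt r f := by
  have h := integral_mul_D (fun x => hasDerivAt_exp (-r) x)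
    ((contDiff_exp (-r)).continuous.mul continuous_const) f
  refine h.trans ?_
  change _ = r * ∫ x : ℝ, Complex.exp (-r * x) * f.1 x
  rw [← integral_neg, ← integral_const_mul]
  refine integral_congr_ae (Eventually.of_forall fun x => ?_)
  change -(Complex.exp (-r * x) * -r * f.1 x) = r * (Complex.exp (-r * x) * f.1 x)
  ring

theorem expInt_aeval (r : ℂ) (p : Polynomial ℂ) (f : TestFn) :
    expInt r (Polynomial.aeval D p f) = p.eval r * expInt r f := by
  induction p using Polynomial.induction_on generalizing f with
  | C c => simp [Polynomial.aeval_C]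
  | add p q hp hq => simp [hp, hq, add_mul]
  | monomial n c ih =>
    rw [pow_succ, ← mul_assoc, map_mul, Module.End.mul_apply, ih, Polynomial.aeval_X, expInt_D]
    simp only [Polynomial.eval_mul, Polynomial.eval_X]
    ring

theorem expInt_mulExp (r s : ℂ) (f : TestFn) : expInt r (mulExp s f) = expInt (r - s) f := by
  change ∫ x : ℝ, Complex.exp (-r * x) * (Complex.exp (s * x) * f.1 x)
    = ∫ x : ℝ, Complex.exp (-(r - s) * x) * f.1 x
  refine integral_congr_ae (Eventually.of_forall fun x => ?_)
  beta_reduce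
  rw [← mul_assoc, ← Complex.exp_add]
  ring_nf

theorem shifted_T (k : ℝ) (n : ℤ) (X : ℝ) (f : TestFn) : shifted k n (T X f)
    = (1 / 2 : ℂ) • (Complex.exp (k * X) • T X (mulExp (-k) (Polynomial.aeval D (symbol k n)
        (mulExp (2 * k) f)))
      + Complex.exp (-(k * X)) • T X (mulExp k (Polynomial.aeval D (symbol k n)
        (mulExp (-(2 * k)) f)))) := by
  simp only [shifted, mulExp_T, map_smul, aeval_D_T, smul_smul, ← Complex.exp_add]
  ring_nf

theorem expInt_sn (k : ℝ) (f : TestFn) :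
    expInt 0 (sn k f) = (1 / 2) * (expInt (-k) f - expInt k f) := by
  have : sn k f = (1 / 2 : ℂ) • (mulExp k f - mulExp (-k) f) := by
    refine Subtype.ext (funext fun x => ?_)
    rw [smul_apply, sub_apply, sn_apply, mulExp_apply, mulExp_apply]
    push_cast
    rw [Complex.sinh]
    ring_nf
  rw [this, map_smul, map_sub, expInt_mulExp, expInt_mulExp, zero_sub, zero_sub, neg_neg,
    smul_eq_mul]

/-- Integration against sinh(kx) is not the zero functional: otherwise the translates by 0 and 1 of
a suitable test function would give exp(k) = exp(-k). -/
theorem eq_zero_of_mul_expInt_sn {k : ℝ} (hk : 0 < k) {b : ℂ}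
    (h : ∀ f, b * expInt 0 (sn k f) = 0) : b = 0 := by
  obtain ⟨f, hf⟩ := exists_expInt_eq_one (-k)
  by_contra hb
  have h2 : ∀ X : ℝ, Complex.exp (k * X) = Complex.exp (-k * X) * expInt k f := by
    intro X
    have := h (T X f)
    rw [expInt_sn, expInt_T, expInt_T, hf, neg_neg, mul_one] at this
    have := (mul_eq_zero.1 this).resolve_left hb
    linear_combination 2 * this
  have h3 := h2 0
  simp only [Complex.ofReal_zero, mul_zero, Complex.exp_zero, one_mul] at h3
  have h4 := h2 1
  rw [← h3, mul_one, Complex.ofReal_one, mul_one, mul_one] at h4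
  have h5 : Real.exp k = Real.exp (-k) := by exact_mod_cast h4
  have h6 := Real.exp_injective h5
  linarith

/-- A functional annihilating second derivatives is integration against an affine function. -/
theorem exists_affine {l : TestFn →ₗ[ℂ] ℂ} (h : ∀ f, l (D (D f)) = 0) :
    ∃ α β : ℂ, ∀ f, l f = ∫ x : ℝ, (α + β * x) * f.1 x := by
  obtain ⟨b, hb⟩ := eq_smul_expInt (l ∘ₗ D) 0 (fun f => by
    rw [zero_smul, sub_zero]; exact h f)
  have hx : Continuous fun x : ℝ => (x : ℂ) := Complex.continuous_ofReal
  let J : TestFn →ₗ[ℂ] ℂ :=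
    { toFun := fun f => ∫ x : ℝ, (x : ℂ) * f.1 x
      map_add' := fun f g => by
        rw [← integral_add (f.integrable_mul hx) (g.integrable_mul hx)]
        exact integral_congr_ae (Eventually.of_forall fun x => mul_add _ _ _)
      map_smul' := fun c f => by
        rw [RingHom.id_apply, smul_eq_mul, ← integral_const_mul]
        exact integral_congr_ae (Eventually.of_forall fun x => mul_left_comm _ _ _) }
  have e0 : ∀ f, expInt 0 f = ∫ x, f.1 x := fun f => by
    change ∫ x : ℝ, Complex.exp (-0 * x) * f.1 x = _
    simp
  have hJ : ∀ f, J (D f) = -expInt 0 f := fun f => by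
    have := integral_mul_D (u := fun x : ℝ => (x : ℂ)) (u' := fun _ => 1)
      (fun x => Complex.ofRealCLM.hasDerivAt) continuous_const f
    rw [e0]
    change ∫ x : ℝ, (x : ℂ) * (D f).1 x = _
    simpa using this
  obtain ⟨α, hα⟩ := eq_smul_expInt (l + b • J) 0 (fun f => by
    have h1 := LinearMap.congr_fun hb f
    rw [LinearMap.comp_apply] at h1
    rw [zero_smul, sub_zero, LinearMap.add_apply, h1, LinearMap.smul_apply, LinearMap.smul_apply,
      hJ]
    simp)
  refine ⟨α, -b, fun f => ?_⟩
  have h2 := LinearMap.congr_fun hα f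
  rw [LinearMap.add_apply, LinearMap.smul_apply, LinearMap.smul_apply, e0, smul_eq_mul,
    smul_eq_mul] at h2
  rw [eq_sub_of_add_eq h2]
  change _ - b * ∫ x : ℝ, (x : ℂ) * f.1 x = _
  rw [← integral_const_mul, ← integral_const_mul]
  have i1 := f.integrable_mul (m := fun _ => α) continuous_const
  have i2 := (f.integrable_mul hx).const_mul b
  rw [← integral_sub i1 i2]
  refine integral_congr_ae (Eventually.of_forall fun x => ?_)
  beta_reduce
  ring

end TestFn

end KPI

end

/-! ### The coefficients θ_n with n ≠ 0. -/

noncomputable section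

namespace KPI

open SmoothFn TestFn Polynomial

theorem isCoprime_of_no_common_root {p q : ℂ[X]} (hp : p ≠ 0)
    (h : ∀ r, p.IsRoot r → ¬ q.IsRoot r) : IsCoprime p q := by
  refine isCoprime_of_dvd p q (fun h0 => hp h0.1) fun z hz hz0 hzp hzq => ?_
  obtain ⟨r, hr⟩ := IsAlgClosed.exists_root z fun hd => hz (isUnit_iff_degree_eq_zero.2 hd)
  exact h r (hr.dvd hzp) (hr.dvd hzq)

theorem TestFn.eq_zero_of_isCoprime {p q : ℂ[X]} (hpq : IsCoprime p q) {l : TestFn →ₗ[ℂ] ℂ}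
    (hp : ∀ f, l (aeval TestFn.D p f) = 0) (hq : ∀ f, l (aeval TestFn.D q f) = 0) : l = 0 := by
  obtain ⟨u, v, huv⟩ := hpq
  refine LinearMap.ext fun f => ?_
  have h1 : aeval TestFn.D (p * u + q * v) f = f := by
    rw [mul_comm p, mul_comm q, huv, map_one]; rfl
  rw [map_add, map_mul, map_mul, LinearMap.add_apply, Module.End.mul_apply,
    Module.End.mul_apply] at h1
  rw [← h1, map_add, hp, hq, add_zero, LinearMap.zero_apply]

namespace IsPotential

variable {k : ℝ} {φ : ℝ → ℝ → ℝ} {hk : k ∈ Set.Ioo (0 : ℝ) (1 / 2)}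
  {h : KernelFn k φ} {ψ : ℤ → TestFn →ₗ[ℂ] ℂ}

theorem mem_vanishing (hψ : IsPotential hk h ψ) {n : ℤ} (hn : n ≠ 0) : ψ n ∈ vanishing := by
  have hc : -(n * freq k : ℂ) ^ 2 ≠ 0 := neg_ne_zero.2 (pow_ne_zero 2 (mul_ne_zero
    (Int.cast_ne_zero.2 hn) (Complex.ofReal_ne_zero.2 (freq_pos hk).ne')))
  have e : ψ n = (-(n * freq k : ℂ) ^ 2)⁻¹ • h.sig hk n := LinearMap.ext fun f => by
    rw [LinearMap.smul_apply, hψ.sig_eq, smul_eq_mul, inv_mul_cancel_left₀ hc]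
  rw [e]
  exact Submodule.smul_mem _ _ (h.sig_mem_vanishing hk n)

theorem theta_mem_tempered (hψ : IsPotential hk h ψ) (h0 : ψ 0 ∈ tempered k) {n : ℤ}
    (hn : n ≠ 0) : theta k ψ n ∈ tempered k := by
  have h1 : ∀ m, ψ m ∈ tempered k := fun m => by
    rcases eq_or_ne m 0 with rfl | hm
    · exact h0
    · exact mem_tempered_of_vanishing hk.1 (hψ.mem_vanishing hm)
  exact add_mem (comp_cs_mem_tempered hk.1 (hψ.mem_vanishing hn))
    (Submodule.smul_mem _ _ (add_mem (h1 _) (h1 _)))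

/-- With s = √3|n|w, the symbol `resSymbol` factors as X²(X² + s - k²)(X² - (k² + s)). The last
factor has real roots of modulus at least k and is removed by `eq_zero_of_tempered`; the witness is
m = s - k². For n = 0 the argument is unavailable, because ψ_0 need not decay. -/
theorem exists_theta_aeval_eq_zero (hψ : IsPotential hk h ψ) (h0 : ψ 0 ∈ tempered k) {n : ℤ}
    (hn : n ≠ 0) : ∃ m : ℝ, 0 < m ∧
      ∀ f, theta k ψ n (aeval TestFn.D (X ^ 2 * (X ^ 2 + C (m : ℂ))) f) = 0 := by
  set s : ℝ := √3 * (|(n : ℝ)| * freq k) with hs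
  have hw := freq_pos hk
  have hs0 : 0 ≤ s := by positivity
  have hs2 : s ^ 2 = 3 * (n * freq k) ^ 2 := by
    rw [hs, mul_pow, mul_pow, Real.sq_sqrt (by norm_num), sq_abs, mul_pow]
  have hn1 : (1 : ℝ) ≤ (n : ℝ) ^ 2 := by
    have : 1 ≤ n ^ 2 := Int.one_le_abs (pow_ne_zero 2 hn) |>.trans (by rw [abs_of_nonneg (sq_nonneg n)])
    exact_mod_cast this
  -- After squaring this is k⁴ < 3n²(k² - k⁴), which follows from n² ≥ 1 and k² < 1/4.
  have hks : k ^ 2 < s := by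
    refine lt_of_pow_lt_pow_left₀ 2 hs0 ?_
    rw [hs2, mul_pow, freq_sq hk]
    have h1 := hk.1
    have h2 := hk.2
    have h3 : k ^ 2 < 1 / 4 := by nlinarith
    have h4 : 0 < k ^ 2 := by positivity
    nlinarith [mul_nonneg (sub_nonneg.2 hn1) (by nlinarith : 0 ≤ k ^ 2 - k ^ 4)]
  have hfac : resSymbol k n = (X ^ 2 * (X ^ 2 + C ((s - k ^ 2 : ℝ) : ℂ)))
      * (X ^ 2 - C ((k ^ 2 + s : ℝ) : ℂ)) := by
    have hc : (3 * (n * freq k) ^ 2 : ℂ) = (s : ℂ) * s := by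
      rw [← sq]; exact_mod_cast hs2.symm
    rw [resSymbol, hc, Complex.ofReal_sub, Complex.ofReal_add, C_add, C_sub, C_mul,
      Complex.ofReal_pow]
    ring
  refine ⟨s - k ^ 2, sub_pos.2 hks, fun f => ?_⟩
  have hl := comp_aeval_mem_tempered (hψ.theta_mem_tempered h0 hn)
    (X ^ 2 * (X ^ 2 + C ((s - k ^ 2 : ℝ) : ℂ)))
  refine LinearMap.congr_fun (eq_zero_of_tempered hl (p := X ^ 2 - C ((k ^ 2 + s : ℝ) : ℂ))
    (X_pow_sub_C_ne_zero two_pos _) (fun r hr => ?_) fun g => ?_) f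
  · have hr2 : r ^ 2 = ((k ^ 2 + s : ℝ) : ℂ) := by simpa [sub_eq_zero] using hr
    have hre := congrArg Complex.re hr2
    rw [sq, Complex.mul_re, Complex.ofReal_re] at hre
    refine abs_le_of_sq_le_sq' ?_ (abs_nonneg _) |>.2
    rw [sq_abs]
    nlinarith [sq_nonneg r.im]
  · have h1 := hψ.theta_resSymbol n g
    rwa [hfac, map_mul, Module.End.mul_apply] at h1

/-- At r = 0, P_n(k) = (n² - 1)w² is nonzero. At r² = -m the root is purely imaginary, and the
imaginary part of P_n(r + k) = 0 would force 2(k² - m) = 1, impossible for m > 0 and k < 1/2. -/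
theorem symbol_shift_ne_zero (hk : k ∈ Set.Ioo (0 : ℝ) (1 / 2)) {n : ℤ} (hn : 2 ≤ |n|) {m : ℝ}
    (hm : 0 < m) {r : ℂ} (hr : (X ^ 2 * (X ^ 2 + C (m : ℂ))).IsRoot r) :
    ¬ ((symbol k n).comp (X + C (k : ℂ))).IsRoot r := by
  intro h
  have hP : ((r + k) ^ 4 - (r + k) ^ 2 + (n * freq k) ^ 2 : ℂ) = 0 := by
    simpa [symbol] using h
  have hw := freq_sq_ofReal hk
  have hk1 := hk.1
  have hk2 := hk.2
  have hr' : r ^ 2 * (r ^ 2 + m) = 0 := by simpa using hr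
  rcases mul_eq_zero.1 hr' with h0 | h0
  · have h0' : r = 0 := pow_eq_zero_iff two_ne_zero |>.1 h0
    rw [h0', zero_add] at hP
    have h1 : ((n : ℂ) ^ 2 - 1) * (freq k : ℂ) ^ 2 = 0 := by
      linear_combination hP - hw
    have h2 : ((n : ℝ) ^ 2 - 1) * (freq k) ^ 2 = 0 := by exact_mod_cast h1
    have h3 : (4 : ℤ) ≤ n ^ 2 := by
      rw [← sq_abs]; nlinarith
    have h4 : (4 : ℝ) ≤ (n : ℝ) ^ 2 := by exact_mod_cast h3
    have := pow_pos (freq_pos hk) 2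
    nlinarith
  · have hr2 : r ^ 2 = ((-m : ℝ) : ℂ) := by push_cast; linear_combination h0
    have hre := congrArg Complex.re hr2
    have him := congrArg Complex.im hr2
    rw [sq, Complex.mul_re, Complex.ofReal_re] at hre
    rw [sq, Complex.mul_im, Complex.ofReal_im] at him
    have h1 : r.re * r.im = 0 := by linarith
    have hi : r.im ≠ 0 := fun h2 => by rw [h2] at hre; nlinarith [sq_nonneg r.re]
    have hr0 : r.re = 0 := (mul_eq_zero.1 h1).resolve_right hi
    have hA : (((k ^ 2 - m) ^ 2 - 4 * k ^ 2 * m - (k ^ 2 - m) + (n * freq k) ^ 2 : ℝ) : ℂ)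
        + r * ((4 * k * (k ^ 2 - m) - 2 * k : ℝ) : ℂ) = 0 := by
      push_cast at hr2 ⊢
      linear_combination hP - (r ^ 2 - m + 6 * k ^ 2 + 4 * r * k - 1) * hr2
    have h3 := congrArg Complex.im hA
    rw [Complex.add_im, Complex.ofReal_im, Complex.mul_im, Complex.ofReal_im, Complex.ofReal_re,
      mul_zero, zero_add, zero_add, Complex.zero_im] at h3
    have h4 := (mul_eq_zero.1 h3).resolve_left hi
    have h5 : 2 * (k ^ 2 - m) - 1 = 0 := by
      have : (2 * k) * (2 * (k ^ 2 - m) - 1) = 0 := by linarith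
      exact (mul_eq_zero.1 this).resolve_left (by positivity)
    nlinarith

/-- The bilinear relation far to the right shows that θ_n composed with P_n(D + k) tends to zero. It
is also annihilated by D²(D² + m), whose roots are imaginary, so it is zero. The two polynomials
have no common root, hence θ_n = 0. -/
theorem theta_eq_zero (hψ : IsPotential hk h ψ) (h0 : ψ 0 ∈ tempered k) {n : ℤ}
    (hn : 2 ≤ |n|) : theta k ψ n = 0 := by
  have hn0 : n ≠ 0 := by rintro rfl; simp at hn
  have hn1 : n + 1 ≠ 0 := by rintro h1; rw [eq_neg_of_add_eq_zero_left h1] at hn; simp at hn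
  have hn2 : n - 1 ≠ 0 := by rintro h1; rw [sub_eq_zero.1 h1] at hn; simp at hn
  obtain ⟨m, hm, hB⟩ := hψ.exists_theta_aeval_eq_zero h0 hn0
  have hBne : (X ^ 2 * (X ^ 2 + C (m : ℂ)) : ℂ[X]) ≠ 0 :=
    mul_ne_zero (pow_ne_zero 2 X_ne_zero) (X_pow_add_C_ne_zero two_pos _)
  have t0 := hψ.theta_mem_tempered h0 hn0
  have t1 := hψ.theta_mem_tempered h0 hn1
  have t2 := hψ.theta_mem_tempered h0 hn2
  have lim : ∀ {l : TestFn →ₗ[ℂ] ℂ}, l ∈ tempered k → ∀ f,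
      Tendsto (fun X : ℝ => Complex.exp (-k * X) * l (T X f)) atTop (𝓝 0) := fun hl f =>
    tendsto_exp_mul_of_tempered hl f atTop_le_cocompact (by
      filter_upwards [eventually_ge_atTop 0] with X hX
      rw [abs_of_nonneg hX]
      simp)
  -- Multiply `theta_shifted` on a translate by 2exp(-kX). The neighbours contribute exp(-kX)θ_{n±1}
  -- and the other half of `shifted` contributes exp(-2kX)θ_n; all tend to zero.
  have key : ∀ g, Tendsto (fun x : ℝ => theta k ψ n
      (T x (aeval TestFn.D ((symbol k n).comp (X + C (k : ℂ))) g))) atTop (𝓝 0) := by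
    intro g
    -- Chosen so that exp(-kx)P_n(D)exp(2kx)f becomes P_n(D + k)g.
    set f := mulExp (-k) g with hf
    set a := mulExp (-k) (aeval TestFn.D (symbol k n) (mulExp (2 * k) f)) with ha
    set b := mulExp k (aeval TestFn.D (symbol k n) (mulExp (-(2 * k)) f)) with hb
    have ha' : a = aeval TestFn.D ((symbol k n).comp (X + C (k : ℂ))) g := by
      rw [ha, hf, mulExp_mulExp, show (2 * k + -k : ℂ) = k by ring, aeval_mulExp, mulExp_mulExp,
        neg_add_cancel, mulExp_zero]
    have l1 := (lim t1 (aeval TestFn.D (symbol k (n + 2)) f)).const_mul (ampl k : ℂ)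
    have l2 := (lim t2 (aeval TestFn.D (symbol k (n - 2)) f)).const_mul (ampl k : ℂ)
    have l3 : Tendsto (fun x : ℝ => Complex.exp (-k * x) * (Complex.exp (-k * x) *
        theta k ψ n (T x b))) atTop (𝓝 0) :=
      tendsto_exp_mul (lim t0 b) (by
        filter_upwards [eventually_ge_atTop 0] with x hx
        simpa using mul_nonneg hk.1.le hx)
    have l4 := ((l1.add l2).add l3).neg
    simp only [mul_zero, add_zero, neg_zero] at l4
    rw [← ha']
    refine l4.congr fun x => ?_
    have h1 := hψ.theta_shifted n (T x f)
    rw [shifted_T, ← ha, ← hb, aeval_D_T, aeval_D_T, map_smul, map_add, map_smul, map_smul,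
      smul_eq_mul, smul_eq_mul, smul_eq_mul] at h1
    have e1 : Complex.exp (-k * x) * Complex.exp (k * x) = 1 := by
      rw [← Complex.exp_add]; simp
    have e2 : Complex.exp (-k * x) = Complex.exp (-(k * x)) := by rw [neg_mul]
    rw [← e2] at h1
    linear_combination (-(2 * Complex.exp (-k * x))) * h1 + (theta k ψ n (T x a)) * e1
  have hz : theta k ψ n ∘ₗ aeval TestFn.D ((symbol k n).comp (X + C (k : ℂ))) = 0 := by
    refine eq_zero_of_aeval _ hBne _ (fun r hr => ⟨atTop, inferInstance, fun f => ?_⟩) fun f => ?_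
    · refine tendsto_exp_mul ?_ ?_
      · simpa [aeval_D_T] using key f
      · have hr0 : r.re = 0 := by
          have hr' : r ^ 2 * (r ^ 2 + m) = 0 := by simpa using hr
          rcases mul_eq_zero.1 hr' with h1 | h1
          · rw [pow_eq_zero_iff two_ne_zero |>.1 h1, Complex.zero_re]
          · have hr2 : r ^ 2 = ((-m : ℝ) : ℂ) := by push_cast; linear_combination h1
            have hre := congrArg Complex.re hr2
            have him := congrArg Complex.im hr2
            rw [sq, Complex.mul_re, Complex.ofReal_re] at hre
            rw [sq, Complex.mul_im, Complex.ofReal_im] at him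
            have h2 : r.re * r.im = 0 := by linarith
            refine (mul_eq_zero.1 h2).resolve_right fun h3 => ?_
            rw [h3] at hre
            nlinarith [sq_nonneg r.re]
        exact Eventually.of_forall fun x => by rw [hr0, zero_mul]
    · rw [LinearMap.comp_apply, ← Module.End.mul_apply, ← map_mul, mul_comm, map_mul,
        Module.End.mul_apply]
      exact hB _
  exact eq_zero_of_isCoprime (isCoprime_of_no_common_root hBne fun r hr =>
    symbol_shift_ne_zero hk hn hm hr) hB fun f => LinearMap.congr_fun hz f

/-- In `theta_shifted` at index ±2 only θ_{±1} composed with P_0(D) = D⁴ - D² survives. Subtracting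
this from D⁴ + mD² leaves (1 + m)D², and 1 + m is positive. -/
theorem theta_D_D_eq_zero (hψ : IsPotential hk h ψ) (h0 : ψ 0 ∈ tempered k) {n : ℤ}
    (hn : n = 1 ∨ n = -1) (f : TestFn) : theta k ψ n (TestFn.D (TestFn.D f)) = 0 := by
  have hn0 : n ≠ 0 := by rcases hn with rfl | rfl <;> simp
  obtain ⟨m, hm, hB⟩ := hψ.exists_theta_aeval_eq_zero h0 hn0
  have ha : (ampl k / 2 : ℂ) ≠ 0 :=
    div_ne_zero (Complex.ofReal_ne_zero.2 (ampl_pos hk).ne') two_ne_zero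
  have hP : ∀ f, theta k ψ n (aeval TestFn.D (symbol k 0) f) = 0 := by
    intro f
    have z : ∀ j : ℤ, 2 ≤ |j| → theta k ψ j = 0 := fun j hj => hψ.theta_eq_zero h0 hj
    rcases hn with rfl | rfl
    · have h1 := hψ.theta_shifted 2 f
      rw [z 2 (by norm_num), z (2 + 1) (by norm_num), LinearMap.zero_apply, LinearMap.zero_apply,
        mul_zero, zero_add, zero_add] at h1
      exact (mul_eq_zero.1 h1).resolve_left ha
    · have h1 := hψ.theta_shifted (-2) f
      rw [z (-2) (by norm_num), z (-2 - 1) (by norm_num), LinearMap.zero_apply,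
        LinearMap.zero_apply, mul_zero, zero_add, add_zero] at h1
      exact (mul_eq_zero.1 h1).resolve_left ha
  have h1 := hP f
  have h2 := hB f
  rw [aeval_symbol] at h1
  have e : aeval TestFn.D (X ^ 2 * (X ^ 2 + C (m : ℂ))) f
      = TestFn.D (TestFn.D (TestFn.D (TestFn.D f))) + (m : ℂ) • TestFn.D (TestFn.D f) := by
    simp only [pow_two, map_mul, map_add, aeval_X, aeval_C, Module.End.mul_apply,
      LinearMap.add_apply, Module.algebraMap_end_apply, map_smul]
  rw [e, map_add, map_smul, smul_eq_mul] at h2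
  rw [Int.cast_zero, zero_mul, zero_pow two_ne_zero, zero_smul, add_zero, map_sub] at h1
  have h3 : (1 + m : ℂ) * theta k ψ n (TestFn.D (TestFn.D f)) = 0 := by
    linear_combination h2 - h1
  refine (mul_eq_zero.1 h3).resolve_left ?_
  have : (1 + m : ℝ) ≠ 0 := by positivity
  exact_mod_cast this

end IsPotential

end KPI

end

/-! ### Normalization of ψ_0, and the coefficients θ_0 and θ_{±1}. -/

noncomputable section

namespace KPI

open SmoothFn TestFn Polynomial

namespace IsPotential

variable {k : ℝ} {φ : ℝ → ℝ → ℝ} {hk : k ∈ Set.Ioo (0 : ℝ) (1 / 2)}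
  {h : KernelFn k φ} {ψ : ℤ → TestFn →ₗ[ℂ] ℂ}

/-- The zeroth coefficient of a potential may be changed by a functional that annihilates second
derivatives. -/
theorem update (hψ : IsPotential hk h ψ) {s : TestFn →ₗ[ℂ] ℂ}
    (hs : ∀ f, s (TestFn.D (TestFn.D f)) = 0) :
    IsPotential hk h (Function.update ψ 0 (ψ 0 - s)) where
  four_eq n f := by
    rcases eq_or_ne n 0 with rfl | hn
    · rw [Function.update_self, LinearMap.sub_apply, hs, sub_zero, hψ.four_eq]
    · rw [Function.update_of_ne hn, hψ.four_eq]
  sig_eq n f := by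
    rcases eq_or_ne n 0 with rfl | hn
    · rw [h.sig_zero hk]; simp
    · rw [Function.update_of_ne hn, hψ.sig_eq]

/-- Both θ_1 and θ_{-1} contain (a/2)ψ_0. Subtracting s = (θ_1 + θ_{-1})/a from ψ_0 therefore
removes half of their sum from each and makes them opposite. This is allowed since s annihilates
second derivatives, and θ_n with |n| ≥ 2 does not involve ψ_0. -/
theorem exists_normalized (hψ : IsPotential hk h ψ) (h0 : ψ 0 ∈ tempered k) :
    ∃ s : TestFn →ₗ[ℂ] ℂ, (∀ f, s (TestFn.D (TestFn.D f)) = 0) ∧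
      ∃ ψ' : ℤ → TestFn →ₗ[ℂ] ℂ, ψ' = Function.update ψ 0 (ψ 0 - s) ∧ IsPotential hk h ψ' ∧
      (∀ n, 2 ≤ |n| → theta k ψ' n = 0) ∧ theta k ψ' (-1) = -theta k ψ' 1 ∧
      ∀ f, theta k ψ' 1 (TestFn.D (TestFn.D f)) = 0 := by
  have ha : (ampl k : ℂ) ≠ 0 := Complex.ofReal_ne_zero.2 (ampl_pos hk).ne'
  set s : TestFn →ₗ[ℂ] ℂ := (ampl k : ℂ)⁻¹ • (theta k ψ 1 + theta k ψ (-1)) with hs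
  have hs0 : ∀ f, s (TestFn.D (TestFn.D f)) = 0 := fun f => by
    rw [hs, LinearMap.smul_apply, LinearMap.add_apply, hψ.theta_D_D_eq_zero h0 (Or.inl rfl),
      hψ.theta_D_D_eq_zero h0 (Or.inr rfl), add_zero, smul_zero]
  have hψ' := hψ.update hs0
  have e0 : ∀ f, Function.update ψ 0 (ψ 0 - s) 0 f = ψ 0 f - s f := fun f => by
    rw [Function.update_self, LinearMap.sub_apply]
  have en : ∀ n ≠ 0, Function.update ψ 0 (ψ 0 - s) n = ψ n := fun n hn =>
    Function.update_of_ne hn _ _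
  have hsf : ∀ f, (ampl k : ℂ) * s f = theta k ψ 1 f + theta k ψ (-1) f := fun f => by
    rw [hs, LinearMap.smul_apply, LinearMap.add_apply, smul_eq_mul, mul_inv_cancel_left₀ ha]
  have t1 : ∀ f, theta k (Function.update ψ 0 (ψ 0 - s)) 1 f
      = (1 / 2) * (theta k ψ 1 f - theta k ψ (-1) f) := fun f => by
    rw [theta_apply, en _ one_ne_zero, en (1 + 1) (by norm_num), sub_self, e0]
    have := theta_apply k ψ 1 f
    rw [sub_self] at this
    linear_combination -this - (1 / 2) * hsf f
  have t2 : ∀ f, theta k (Function.update ψ 0 (ψ 0 - s)) (-1) f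
      = -((1 / 2) * (theta k ψ 1 f - theta k ψ (-1) f)) := fun f => by
    rw [theta_apply, en _ (by norm_num), en (-1 - 1) (by norm_num), neg_add_cancel, e0]
    have := theta_apply k ψ (-1) f
    rw [neg_add_cancel] at this
    linear_combination -this - (1 / 2) * hsf f
  refine ⟨s, hs0, _, rfl, hψ', fun n hn => ?_, LinearMap.ext fun f => ?_, fun f => ?_⟩
  · have h1 : n ≠ 0 := by rintro rfl; simp at hn
    have h2 : n + 1 ≠ 0 := by rintro h1; rw [eq_neg_of_add_eq_zero_left h1] at hn; simp at hn
    have h3 : n - 1 ≠ 0 := by rintro h1; rw [sub_eq_zero.1 h1] at hn; simp at hn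
    rw [← hψ.theta_eq_zero h0 hn, theta, theta, en _ h1, en _ h2, en _ h3]
  · rw [LinearMap.neg_apply, t1, t2]
  · rw [t1, hψ.theta_D_D_eq_zero h0 (Or.inl rfl), hψ.theta_D_D_eq_zero h0 (Or.inr rfl)]
    ring

theorem symbol_neg (k : ℝ) (n : ℤ) : symbol k (-n) = symbol k n := by
  unfold symbol
  congr 2
  push_cast
  ring

theorem shifted_neg (k : ℝ) (n : ℤ) (f : TestFn) : shifted k (-n) f = shifted k n f := by
  rw [shifted, shifted, symbol_neg]

/-- In `theta_shifted` at 1 and -1 the θ_0 terms coincide, as the symbol is even in n, while the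
θ_{±1} terms are opposite. Adding them isolates θ_0. -/
theorem theta_zero_and_one (hψ : IsPotential hk h ψ) (h2 : ∀ n, 2 ≤ |n| → theta k ψ n = 0)
    (h1 : theta k ψ (-1) = -theta k ψ 1) (f : TestFn) :
    theta k ψ 0 (aeval TestFn.D (symbol k 1) f) = 0 ∧ theta k ψ 1 (shifted k 1 f) = 0 := by
  have ha : (ampl k : ℂ) ≠ 0 := Complex.ofReal_ne_zero.2 (ampl_pos hk).ne'
  have e1 := hψ.theta_shifted 1 f
  have e2 := hψ.theta_shifted (-1) f
  rw [h2 (1 + 1) (by norm_num), LinearMap.zero_apply, sub_self, show (1 - 2 : ℤ) = -1 by norm_num,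
    symbol_neg] at e1
  rw [h2 (-1 - 1) (by norm_num), LinearMap.zero_apply, neg_add_cancel,
    show (-1 + 2 : ℤ) = 1 by norm_num, shifted_neg, h1, LinearMap.neg_apply] at e2
  have e3 : (ampl k : ℂ) * theta k ψ 0 (aeval TestFn.D (symbol k 1) f) = 0 := by
    linear_combination e1 + e2
  have e4 := (mul_eq_zero.1 e3).resolve_left ha
  exact ⟨e4, by linear_combination e1 - (ampl k / 2 : ℂ) * e4⟩

/-- θ_1 is affine, so only its slope has to be excluded. Modulo second derivatives `shifted k 1` is
(4k³ - 2k) times the derivative of sinh(kx)f, so the slope annihilates all integrals of sinh(kx)f.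
-/
theorem theta_one_eq (hψ : IsPotential hk h ψ) (h2 : ∀ n, 2 ≤ |n| → theta k ψ n = 0)
    (h1 : theta k ψ (-1) = -theta k ψ 1)
    (hD : ∀ f, theta k ψ 1 (TestFn.D (TestFn.D f)) = 0) :
    ∃ α : ℂ, theta k ψ 1 = α • expInt 0 := by
  have hk1 := hk.1
  have hk2 := hk.2
  have hc : (4 * k ^ 3 - 2 * k : ℂ) ≠ 0 := by
    have : 4 * k ^ 3 - 2 * k ≠ 0 := by
      have : 2 * k * (2 * k ^ 2 - 1) ≠ 0 := mul_ne_zero (by positivity) (by nlinarith)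
      intro h; apply this; linarith
    exact_mod_cast this
  have hsn : ∀ f, theta k ψ 1 (TestFn.D (sn k f)) = 0 := by
    intro f
    have e : shifted k 1 f = TestFn.D (TestFn.D (cs k (TestFn.D (TestFn.D f))
        + (6 * k : ℂ) • sn k (TestFn.D f) + (11 * k ^ 2 - 1 : ℂ) • cs k f))
        + (4 * k ^ 3 - 2 * k : ℂ) • TestFn.D (sn k f) := by
      have hw := freq_sq_ofReal hk
      rw [shifted_eq]
      refine Subtype.ext (funext fun x => ?_)
      simp only [map_add, map_smul, D_cs, D_sn, smul_add, add_apply, smul_apply,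
        cs_apply, sn_apply]
      push_cast
      generalize (TestFn.D (TestFn.D (TestFn.D (TestFn.D f)))).1 x = f4
      generalize (TestFn.D (TestFn.D (TestFn.D f))).1 x = f3
      generalize (TestFn.D (TestFn.D f)).1 x = f2
      generalize (TestFn.D f).1 x = f1
      generalize f.1 x = f0
      linear_combination Complex.cosh (k * x) * f0 * hw
    have h3 := (hψ.theta_zero_and_one h2 h1 f).2
    rw [e, map_add, hD, zero_add, map_smul, smul_eq_mul] at h3
    exact (mul_eq_zero.1 h3).resolve_left hc
  obtain ⟨b, hb⟩ := eq_smul_expInt (theta k ψ 1 ∘ₗ TestFn.D) 0 (fun f => by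
    rw [zero_smul, sub_zero]; exact hD f)
  have hb0 : b = 0 := eq_zero_of_mul_expInt_sn hk.1 fun f => by
    have := LinearMap.congr_fun hb (sn k f)
    rw [LinearMap.comp_apply, hsn, LinearMap.smul_apply, smul_eq_mul] at this
    exact this.symm
  refine eq_smul_expInt _ 0 fun f => ?_
  have := LinearMap.congr_fun hb f
  rw [zero_smul, sub_zero]
  rwa [hb0, zero_smul] at this

/-- θ_0 is annihilated by X²(X² - k²)² and by P_1 = (X² - k²)(X² - (1 - k²)). The first minus (X² +
1 - 2k²) times the second is (1 - k²)(1 - 2k²)(X² - k²). No growth bound on θ_0 is used. -/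
theorem theta_zero_D (hψ : IsPotential hk h ψ) (h2 : ∀ n, 2 ≤ |n| → theta k ψ n = 0)
    (h1 : theta k ψ (-1) = -theta k ψ 1) (f : TestFn) :
    theta k ψ 0 (TestFn.D (TestFn.D f) - (k ^ 2 : ℂ) • f) = 0 := by
  have hk1 := hk.1
  have hk2 := hk.2
  have hw := freq_sq_ofReal hk
  set c : ℂ := (1 - k ^ 2) * (1 - 2 * k ^ 2) with hc
  have hc0 : c ≠ 0 := by
    have : (1 - k ^ 2) * (1 - 2 * k ^ 2) ≠ 0 := mul_ne_zero (by nlinarith) (by nlinarith)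
    rw [hc]
    exact_mod_cast this
  have e1 := hψ.theta_resSymbol 0 f
  have e2 := (hψ.theta_zero_and_one h2 h1
    (TestFn.D (TestFn.D f) + (1 - 2 * k ^ 2 : ℂ) • f)).1
  rw [aeval_resSymbol] at e1
  rw [aeval_symbol] at e2
  simp only [map_add, map_sub, map_smul, smul_eq_mul] at e1 e2 ⊢
  push_cast at e1 e2
  have e3 : c * (theta k ψ 0 (TestFn.D (TestFn.D f)) - k ^ 2 * theta k ψ 0 f) = 0 := by
    rw [hc]
    linear_combination e1 - e2 + (theta k ψ 0 (TestFn.D (TestFn.D f))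
      + (1 - 2 * k ^ 2) * theta k ψ 0 f) * hw
  exact (mul_eq_zero.1 e3).resolve_left hc0

/-- θ_0 is a combination of exp(±kx). At index 0 the θ_{±1} terms of `theta_shifted` cancel, so θ_0
also annihilates the range of `shifted k 0`, and this excludes cosh(kx): P_0(±2k) = 16k⁴ - 4k² is
nonzero as k < 1/2. -/
theorem theta_zero_eq (hψ : IsPotential hk h ψ) (h2 : ∀ n, 2 ≤ |n| → theta k ψ n = 0)
    (h1 : theta k ψ (-1) = -theta k ψ 1) :
    ∃ γ : ℂ, theta k ψ 0 = γ • (expInt (-k) - expInt k) := by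
  have hk0 : (k : ℂ) ≠ 0 := Complex.ofReal_ne_zero.2 hk.1.ne'
  have hD := hψ.theta_zero_D h2 h1
  obtain ⟨c₁, hc₁⟩ := eq_smul_expInt
    (theta k ψ 0 ∘ₗ TestFn.D + (k : ℂ) • theta k ψ 0) k fun f => by
      have := hD f
      simp only [LinearMap.add_apply, LinearMap.comp_apply, LinearMap.smul_apply, map_sub,
        map_smul, smul_eq_mul] at this ⊢
      linear_combination this
  obtain ⟨c₂, hc₂⟩ := eq_smul_expInt
    (theta k ψ 0 ∘ₗ TestFn.D - (k : ℂ) • theta k ψ 0) (-k) fun f => by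
      have := hD f
      simp only [LinearMap.sub_apply, LinearMap.comp_apply, LinearMap.smul_apply, map_sub,
        map_smul, smul_eq_mul] at this ⊢
      linear_combination this
  have hθ : ∀ f, 2 * k * theta k ψ 0 f = c₁ * expInt k f - c₂ * expInt (-k) f := fun f => by
    have e1 := LinearMap.congr_fun hc₁ f
    have e2 := LinearMap.congr_fun hc₂ f
    simp only [LinearMap.add_apply, LinearMap.sub_apply, LinearMap.comp_apply,
      LinearMap.smul_apply, smul_eq_mul] at e1 e2
    linear_combination e1 - e2
  have hE : ∀ f, theta k ψ 0 (shifted k 0 f) = 0 := fun f => by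
    have := hψ.theta_shifted 0 f
    rw [zero_add, zero_sub, zero_sub, zero_add, symbol_neg, h1, LinearMap.neg_apply] at this
    linear_combination this
  have hp : (symbol k 0).eval (2 * k : ℂ) = 16 * k ^ 4 - 4 * k ^ 2 := by
    simp [symbol]; ring
  have hp' : (symbol k 0).eval (-(2 * k) : ℂ) = 16 * k ^ 4 - 4 * k ^ 2 := by
    simp [symbol]; ring
  have hp0 : (symbol k 0).eval (0 : ℂ) = 0 := by simp [symbol]
  have hpne : (16 * k ^ 4 - 4 * k ^ 2 : ℂ) ≠ 0 := by
    have hk1 := hk.1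
    have hk2 := hk.2
    have : (4 * k ^ 2) * (4 * k ^ 2 - 1) ≠ 0 := mul_ne_zero (by positivity) (by nlinarith)
    have : 16 * k ^ 4 - 4 * k ^ 2 ≠ 0 := fun h => this (by linarith)
    exact_mod_cast this
  -- Both exponential integrals of `shifted k 0 f` reduce to ½P_0(±2k) times the plain integral of
  -- f, because the other half carries P_0(0) = 0.
  obtain ⟨f, hf⟩ := exists_expInt_eq_one 0
  have s1 : expInt k (shifted k 0 f) = (1 / 2) * (16 * k ^ 4 - 4 * k ^ 2) := by
    rw [shifted, map_smul, map_add, expInt_mulExp, expInt_mulExp, expInt_aeval, expInt_aeval,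
      expInt_mulExp, expInt_mulExp, sub_self, hp0, show (k - -k : ℂ) = 2 * k by ring, hp, sub_self,
      hf, smul_eq_mul]
    ring
  have s2 : expInt (-k) (shifted k 0 f) = (1 / 2) * (16 * k ^ 4 - 4 * k ^ 2) := by
    rw [shifted, map_smul, map_add, expInt_mulExp, expInt_mulExp, expInt_aeval, expInt_aeval,
      expInt_mulExp, expInt_mulExp, sub_self, hp0, show (-k - k : ℂ) = -(2 * k) by ring, hp',
      sub_self, hf, smul_eq_mul]
    ring
  have h3 := hθ (shifted k 0 f)
  rw [hE, s1, s2] at h3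
  have h4 : c₁ = c₂ := by
    have : (c₁ - c₂) * (16 * k ^ 4 - 4 * k ^ 2 : ℂ) = 0 := by linear_combination -2 * h3
    exact sub_eq_zero.1 ((mul_eq_zero.1 this).resolve_right hpne)
  refine ⟨-c₁ / (2 * k), LinearMap.ext fun g => ?_⟩
  have h5 := hθ g
  rw [← h4] at h5
  rw [LinearMap.smul_apply, LinearMap.sub_apply, smul_eq_mul]
  field_simp
  linear_combination h5

end IsPotential

end KPI

end

/-! ### Bounds on functionals that are uniform in the frequency. -/

noncomputable section

namespace KPI

open SmoothFn TestFn

namespace TestFn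

/-- `f` vanishes outside `[-R, R]` and is bounded by `m`. -/
def BoundedBy (f : TestFn) (R m : ℝ) : Prop :=
  (∀ x, R < |x| → f.1 x = 0) ∧ ∀ x, ‖f.1 x‖ ≤ m

theorem BoundedBy.nonneg {f : TestFn} {R m : ℝ} (hf : BoundedBy f R m) : 0 ≤ m :=
  (norm_nonneg _).trans (hf.2 0)

theorem D_eq_zero {f : TestFn} {R : ℝ} (hf : ∀ x, R < |x| → f.1 x = 0) (x : ℝ) (hx : R < |x|) :
    (D f).1 x = 0 := by
  have h : f.1 =ᶠ[𝓝 x] fun _ => 0 := by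
    have ho : IsOpen {x : ℝ | R < |x|} := isOpen_lt continuous_const continuous_abs
    filter_upwards [ho.mem_nhds hx] with y hy using hf y hy
  rw [D_apply, h.deriv_eq]
  simp

theorem exists_norm_integral_le {u : ℝ → ℂ} (hu : Continuous u) (R : ℝ) :
    ∃ B : ℝ, 0 ≤ B ∧ ∀ (f : TestFn) (m : ℝ), f.BoundedBy R m → ‖∫ x, u x * f.1 x‖ ≤ B * m := by
  obtain ⟨M, hM⟩ := (isCompact_Icc (a := -R) (b := R)).exists_bound_of_continuousOn hu.continuousOn
  refine ⟨|M| * volume.real (Set.Icc (-R) R), by positivity, fun f m hf => ?_⟩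
  have e : ∫ x, u x * f.1 x = ∫ x in Set.Icc (-R) R, u x * f.1 x := by
    refine (setIntegral_eq_integral_of_forall_compl_eq_zero fun x hx => ?_).symm
    rw [hf.1 x, mul_zero]
    by_contra hle
    exact hx (abs_le.1 (not_lt.1 hle))
  have hm := hf.nonneg
  rw [e, mul_right_comm]
  refine norm_setIntegral_le_of_norm_le_const isCompact_Icc.measure_lt_top fun x hx => ?_
  rw [norm_mul]
  exact mul_le_mul ((hM x hx).trans (le_abs_self M)) (hf.2 x) (norm_nonneg _) (abs_nonneg M)

/-- The constant does not depend on n because exp(inwy) has modulus one. -/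
theorem exists_norm_integral_strip_le {G : ℝ × ℝ → ℂ} (hG : Continuous G) (k t R : ℝ) :
    ∃ B : ℝ, 0 ≤ B ∧ ∀ (n : ℤ) (f : TestFn) (m : ℝ), f.BoundedBy R m →
      ‖∫ p : ℝ × ℝ, G p * (mode k n f).1 p ∂(strip t)‖ ≤ B * m := by
  obtain ⟨M, hM⟩ := ((isCompact_Icc (a := -R) (b := R)).prod
    (isCompact_Icc (a := (0 : ℝ)) (b := t))).exists_bound_of_continuousOn hG.continuousOn
  refine ⟨|M| * volume.real (Set.Icc (-R) R ×ˢ Set.Ioc 0 t), by positivity, fun n f m hf => ?_⟩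
  have h1 : strip t = (volume : Measure (ℝ × ℝ)).restrict (Set.univ ×ˢ Set.Ioc 0 t) := by
    rw [strip, Measure.volume_eq_prod, ← Measure.prod_restrict, Measure.restrict_univ]
  have hm := hf.nonneg
  rw [h1, mul_right_comm, setIntegral_eq_of_subset_of_forall_sdiff_eq_zero
    (s := Set.Icc (-R) R ×ˢ Set.Ioc 0 t) (MeasurableSet.univ.prod measurableSet_Ioc)
    (Set.prod_mono (Set.subset_univ _) le_rfl)]
  · refine norm_setIntegral_le_of_norm_le_const ?_ fun p hp => ?_
    · exact (measure_mono (Set.prod_mono le_rfl Set.Ioc_subset_Icc_self)).trans_lt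
        (isCompact_Icc.prod isCompact_Icc).measure_lt_top
    · rw [norm_mul]
      refine mul_le_mul ((hM p ⟨hp.1, Set.Ioc_subset_Icc_self hp.2⟩).trans (le_abs_self M)) ?_
        (norm_nonneg _) (abs_nonneg M)
      change ‖f.1 p.1 * Complex.exp ((n * freq k * Complex.I) * p.2)‖ ≤ m
      rw [norm_mul, norm_exp_mode, mul_one]
      exact hf.2 _
  · rintro ⟨x, y⟩ ⟨⟨-, hy⟩, hn⟩
    change G (x, y) * (f.1 x * _) = 0
    rw [hf.1 x, zero_mul, mul_zero]
    by_contra hle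
    exact hn ⟨abs_le.1 (not_lt.1 hle), hy⟩

/-- A family of functionals that is uniformly bounded by the supremum norms of a test function and
of its second derivative, for test functions supported in a fixed interval. -/
def UniformC2 (l : ℤ → TestFn →ₗ[ℂ] ℂ) : Prop :=
  ∀ R : ℝ, ∃ B : ℝ, 0 ≤ B ∧ ∀ (n : ℤ) (f : TestFn) (m : ℝ), f.BoundedBy R m →
    (D (D f)).BoundedBy R m → ‖l n f‖ ≤ B * m

theorem UniformC2.sub {l l' : ℤ → TestFn →ₗ[ℂ] ℂ} (h : UniformC2 l) (h' : UniformC2 l') :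
    UniformC2 (fun n => l n - l' n) := fun R => by
  obtain ⟨B, hB, hl⟩ := h R
  obtain ⟨B', hB', hl'⟩ := h' R
  refine ⟨B + B', by positivity, fun n f m hf hf2 => ?_⟩
  rw [LinearMap.sub_apply, add_mul]
  exact (norm_sub_le _ _).trans (add_le_add (hl n f m hf hf2) (hl' n f m hf hf2))

end TestFn

theorem integrable_mul_mode (k t : ℝ) {G : ℝ × ℝ → ℂ} (hG : Continuous G) (n : ℤ) (f : TestFn) :
    Integrable (fun p : ℝ × ℝ => G p * (mode k n f).1 p) (strip t) := by
  obtain ⟨R, hR⟩ := mode_mem_xCompact k n f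
  exact integrable_strip (R := R) (hG.mul (mode k n f).continuous)
    fun p hp => by rw [hR p hp, mul_zero]

/-- The functional `f ↦ ∫ G f(x) exp (i n w y)` over one period strip. -/
def stripCoeff (k : ℝ) (G : SmoothFn) (n : ℤ) : TestFn →ₗ[ℂ] ℂ where
  toFun f := ∫ p : ℝ × ℝ, G.1 p * (mode k n f).1 p ∂(strip (period k))
  map_add' f g := by
    rw [← integral_add (integrable_mul_mode k _ G.continuous n f)
      (integrable_mul_mode k _ G.continuous n g)]
    exact integral_congr_ae (Eventually.of_forall fun p => by
      rw [map_add]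
      exact mul_add _ _ _)
  map_smul' c f := by
    rw [RingHom.id_apply, smul_eq_mul, ← integral_const_mul]
    exact integral_congr_ae (Eventually.of_forall fun p => by
      rw [map_smul]
      exact mul_left_comm _ _ _)

end KPI

end

/-! ### Construction of the potential. -/

noncomputable section

namespace KPI

open SmoothFn TestFn

namespace KernelFn

variable {k : ℝ} {φ : ℝ → ℝ → ℝ}

theorem four_eq_integral (h : KernelFn k φ) (n : ℤ) (f : TestFn) :
    h.four n f = ∫ p : ℝ × ℝ, (φ p.1 p.2 : ℂ) * (mode k n f).1 p ∂(strip (period k)) :=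
  h.pairing_apply (mode_mem_xCompact _ _ _)

theorem exists_norm_sig_le (hk : k ∈ Set.Ioo (0 : ℝ) (1 / 2)) (h : KernelFn k φ) :
    UniformC2 (h.sig hk) := by
  intro R
  obtain ⟨B, hB, h1⟩ := exists_norm_integral_strip_le h.continuous_ofReal k (period k) R
  obtain ⟨B', hB', h2⟩ := exists_norm_integral_strip_le
    (h.continuous_ofReal.mul (6 * prof hk).continuous) k (period k) R
  refine ⟨B + B + B', by positivity, fun n f m hf hf2 => ?_⟩
  have e : h.sig hk n f = h.four n (D (D f)) - h.four n f + h.coeff (6 * prof hk) n f := rfl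
  have e3 : h.coeff (6 * prof hk) n f = ∫ p : ℝ × ℝ,
      ((φ p.1 p.2 : ℂ) * (6 * prof hk).1 p) * (mode k n f).1 p ∂(strip (period k)) := by
    rw [coeff_apply, h.pairing_apply (Ideal.mul_mem_left _ _ (mode_mem_xCompact _ _ _))]
    exact integral_congr_ae (Eventually.of_forall fun p => (mul_assoc _ _ _).symm)
  have b1 := h1 n _ m hf2
  have b2 := h1 n f m hf
  have b3 := h2 n f m hf
  rw [← h.four_eq_integral] at b1 b2
  rw [e, e3, add_mul, add_mul]
  exact (norm_add_le _ _).trans (add_le_add ((norm_sub_le _ _).trans (add_le_add b1 b2)) b3)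

/-- The mean of `φ(x, ·)` over a period, times the period. -/
theorem continuous_mean (h : KernelFn k φ) :
    Continuous fun x => ∫ y in (0 : ℝ)..period k, (φ x y : ℂ) :=
  intervalIntegral.continuous_parametric_intervalIntegral_of_continuous'
    (f := fun x y => (φ x y : ℂ)) h.continuous_ofReal 0 (period k)

theorem exists_norm_mean_le (h : KernelFn k φ) :
    ∃ A : ℝ, 0 ≤ A ∧ ∀ x, ‖∫ y in (0 : ℝ)..period k, (φ x y : ℂ)‖ ≤ A := by
  obtain ⟨A, hA⟩ := h.decays.1
  refine ⟨A * |period k - 0|, mul_nonneg ((abs_nonneg _).trans (hA 0 0)) (abs_nonneg _),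
    fun x => ?_⟩
  refine intervalIntegral.norm_integral_le_of_norm_le_const fun y _ => ?_
  rw [Complex.norm_real]
  exact hA x y

theorem four_zero_eq (hk : k ∈ Set.Ioo (0 : ℝ) (1 / 2)) (h : KernelFn k φ) (f : TestFn) :
    h.four 0 f = ∫ x, (∫ y in (0 : ℝ)..period k, (φ x y : ℂ)) * f.1 x := by
  have hi := integrable_mul_mode k (period k) h.continuous_ofReal 0 f
  rw [four_eq_integral]
  rw [strip] at hi ⊢
  rw [integral_prod _ hi]
  refine integral_congr_ae (Eventually.of_forall fun x => ?_)
  beta_reduce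
  rw [intervalIntegral.integral_of_le (period_pos hk).le, ← integral_mul_const]
  refine integral_congr_ae (Eventually.of_forall fun y => ?_)
  change (φ x y : ℂ) * (f.1 x * Complex.exp (((0 : ℤ) * freq k * Complex.I) * y)) = _
  simp

end KernelFn

theorem exists_double_primitive {u : ℝ → ℂ} (hu : Continuous u) {A : ℝ} (hA : ∀ x, ‖u x‖ ≤ A) :
    ∃ v p : ℝ → ℂ, (∀ x, HasDerivAt p (v x) x) ∧ (∀ x, HasDerivAt v (u x) x) ∧
      ∀ x, ‖p x‖ ≤ A * x ^ 2 := by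
  have hv : ∀ x, HasDerivAt (fun x => ∫ s in (0 : ℝ)..x, u s) (u x) x := fun x =>
    intervalIntegral.integral_hasDerivAt_right (hu.intervalIntegrable _ _)
      (hu.stronglyMeasurableAtFilter _ _) hu.continuousAt
  have hvc : Continuous fun x => ∫ s in (0 : ℝ)..x, u s :=
    continuous_iff_continuousAt.2 fun x => (hv x).continuousAt
  have hA0 : 0 ≤ A := (norm_nonneg _).trans (hA 0)
  have hvb : ∀ x, ‖∫ s in (0 : ℝ)..x, u s‖ ≤ A * |x| := fun x => by
    simpa using intervalIntegral.norm_integral_le_of_norm_le_const (a := 0) (b := x)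
      fun y _ => hA y
  refine ⟨_, fun x => ∫ r in (0 : ℝ)..x, ∫ s in (0 : ℝ)..r, u s, fun x =>
    intervalIntegral.integral_hasDerivAt_right (hvc.intervalIntegrable _ _)
      (hvc.stronglyMeasurableAtFilter _ _) hvc.continuousAt, hv, fun x => ?_⟩
  have := intervalIntegral.norm_integral_le_of_norm_le_const (a := 0) (b := x) (C := A * |x|)
    (f := fun r => ∫ s in (0 : ℝ)..r, u s) fun y hy => by
      refine (hvb y).trans (mul_le_mul_of_nonneg_left ?_ hA0)
      rcases le_total 0 x with hx | hx
      · rw [Set.uIoc_of_le hx] at hy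
        rw [abs_of_pos hy.1, abs_of_nonneg hx]
        exact hy.2
      · rw [Set.uIoc_of_ge hx] at hy
        rw [abs_of_nonpos hy.2, abs_of_nonpos hx]
        linarith [hy.1]
  refine this.trans (le_of_eq ?_)
  rw [sub_zero, mul_assoc, ← sq, sq_abs]

/-- Integration of a test function against a continuous function. -/
def TestFn.integralMul (u : ℝ → ℂ) (hu : Continuous u) : TestFn →ₗ[ℂ] ℂ where
  toFun f := ∫ x, u x * f.1 x
  map_add' f g := by
    rw [← integral_add (f.integrable_mul hu) (g.integrable_mul hu)]
    exact integral_congr_ae (Eventually.of_forall fun x => mul_add _ _ _)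
  map_smul' c f := by
    rw [RingHom.id_apply, smul_eq_mul, ← integral_const_mul]
    exact integral_congr_ae (Eventually.of_forall fun x => mul_left_comm _ _ _)

theorem TestFn.integralMul_mem_tempered {k : ℝ} (hk : 0 < k) {u : ℝ → ℂ} (hu : Continuous u)
    {A : ℝ} (hA : ∀ x, ‖u x‖ ≤ A * x ^ 2) : integralMul u hu ∈ tempered k := by
  refine mem_tempered_of_le hk fun f => ?_
  obtain ⟨R, hR0, hR⟩ := f.exists_bound
  have hA0 : 0 ≤ A := by simpa using (norm_nonneg _).trans (hA 1)
  refine ⟨(∫ x, ‖f.1 x‖) * (2 * A * (R ^ 2 + 1)), fun X => ?_⟩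
  have e : integralMul u hu (T X f) = ∫ x, u (x + X) * f.1 x := by
    have := integral_sub_right_eq_self (μ := volume) (fun x : ℝ => u (x + X) * f.1 x) X
    simp only [sub_add_cancel] at this
    exact this
  rw [e, mul_assoc, ← integral_mul_const]
  refine norm_integral_le_of_norm_le ?_ (Eventually.of_forall fun x => ?_)
  · exact ((f.continuous.integrable_of_hasCompactSupport f.compact).norm).mul_const _
  · rw [norm_mul, mul_comm]
    by_cases hx : R < |x|
    · rw [hR x hx, norm_zero, zero_mul, zero_mul]
    · refine mul_le_mul_of_nonneg_left ((hA _).trans ?_) (norm_nonneg _)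
      have h1 : x ^ 2 ≤ R ^ 2 := sq_le_sq' (by linarith [abs_le.1 (not_lt.1 hx)])
        (abs_le.1 (not_lt.1 hx)).2
      have h2 : (x + X) ^ 2 ≤ 2 * (R ^ 2 + 1) * (1 + X ^ 2) := by
        nlinarith [sq_nonneg (x - X), mul_nonneg (sq_nonneg R) (sq_nonneg X)]
      calc A * (x + X) ^ 2 ≤ A * (2 * (R ^ 2 + 1) * (1 + X ^ 2)) :=
            mul_le_mul_of_nonneg_left h2 hA0
        _ = 2 * A * (R ^ 2 + 1) * (1 + X ^ 2) := by ring

variable {k : ℝ} {φ : ℝ → ℝ → ℝ}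

/-- For n ≠ 0 divide the coefficient of Sφ by -n²w²; the weak equation `sig_D_D` then gives φ =
∂ₓ²ψ. For n = 0 take a double primitive of the mean of φ, which grows at most quadratically; the
other condition holds by `sig_zero`. -/
theorem KernelFn.exists_isPotential (hk : k ∈ Set.Ioo (0 : ℝ) (1 / 2)) (h : KernelFn k φ) :
    ∃ (u : ℝ → ℂ) (hu : Continuous u) (ψ : ℤ → TestFn →ₗ[ℂ] ℂ), IsPotential hk h ψ ∧
      ψ 0 = integralMul u hu ∧ ψ 0 ∈ tempered k := by
  obtain ⟨A, -, hA⟩ := h.exists_norm_mean_le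
  obtain ⟨v, p, hp, hv, hb⟩ := exists_double_primitive h.continuous_mean hA
  have hpc : Continuous p := continuous_iff_continuousAt.2 fun x => (hp x).continuousAt
  refine ⟨p, hpc, fun n => if n = 0 then integralMul p hpc
    else (-(n * freq k : ℂ) ^ 2)⁻¹ • h.sig hk n, ⟨fun n f => ?_, fun n f => ?_⟩, if_pos rfl, ?_⟩
  · rcases eq_or_ne n 0 with rfl | hn
    · rw [if_pos rfl, h.four_zero_eq hk]
      exact (integral_mul_D_D hp hv h.continuous_mean f).symm
    · have hc : -(n * freq k : ℂ) ^ 2 ≠ 0 := neg_ne_zero.2 (pow_ne_zero 2 (mul_ne_zero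
        (Int.cast_ne_zero.2 hn) (Complex.ofReal_ne_zero.2 (freq_pos hk).ne')))
      rw [if_neg hn, LinearMap.smul_apply, h.sig_D_D, smul_eq_mul, inv_mul_cancel_left₀ hc]
  · rcases eq_or_ne n 0 with rfl | hn
    · rw [h.sig_zero hk]; simp
    · have hc : -(n * freq k : ℂ) ^ 2 ≠ 0 := neg_ne_zero.2 (pow_ne_zero 2 (mul_ne_zero
        (Int.cast_ne_zero.2 hn) (Complex.ofReal_ne_zero.2 (freq_pos hk).ne')))
      rw [if_neg hn, LinearMap.smul_apply, smul_eq_mul, mul_inv_cancel_left₀ hc]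
  · exact integralMul_mem_tempered hk.1 hpc hb

theorem IsPotential.uniformC2 {hk : k ∈ Set.Ioo (0 : ℝ) (1 / 2)} {h : KernelFn k φ}
    {ψ : ℤ → TestFn →ₗ[ℂ] ℂ} (hψ : IsPotential hk h ψ) {u : ℝ → ℂ} (hu : Continuous u)
    (h0 : ψ 0 = integralMul u hu) : UniformC2 ψ := by
  intro R
  obtain ⟨B, hB, h1⟩ := h.exists_norm_sig_le hk R
  obtain ⟨B', hB', h2⟩ := exists_norm_integral_le hu R
  have hw := freq_pos hk
  refine ⟨B / freq k ^ 2 + B', by positivity, fun n f m hf hf2 => ?_⟩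
  have hm := hf.nonneg
  rcases eq_or_ne n 0 with rfl | hn
  · rw [h0]
    refine (h2 f m hf).trans (mul_le_mul_of_nonneg_right ?_ hm)
    have : 0 ≤ B / freq k ^ 2 := by positivity
    linarith
  · have h3 := h1 n f m hf hf2
    rw [hψ.sig_eq, norm_mul, norm_neg, norm_pow, norm_mul, Complex.norm_real, Real.norm_eq_abs,
      abs_of_pos hw, Complex.norm_intCast, mul_pow, sq_abs] at h3
    have hn1 : (1 : ℝ) ≤ (n : ℝ) ^ 2 := by
      have : 1 ≤ n ^ 2 := Int.one_le_abs (pow_ne_zero 2 hn) |>.trans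
        (by rw [abs_of_nonneg (sq_nonneg n)])
      exact_mod_cast this
    have h4 : freq k ^ 2 * ‖ψ n f‖ ≤ B * m := by
      refine le_trans ?_ h3
      refine mul_le_mul_of_nonneg_right ?_ (norm_nonneg _)
      nlinarith [pow_pos hw 2]
    have h5 : ‖ψ n f‖ ≤ B / freq k ^ 2 * m := by
      rw [div_mul_eq_mul_div, le_div_iff₀ (by positivity), mul_comm]
      exact h4
    have : 0 ≤ B' * m := by positivity
    rw [add_mul]
    linarith

end KPI

end

/-! ### Uniqueness of division by τ. -/

noncomputable section

namespace KPI

open SmoothFn TestFn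

namespace TestFn

/-- Multiplication by `1 / cosh (k x)`. -/
def sech (k : ℝ) : TestFn →ₗ[ℂ] TestFn :=
  mulBy (fun x => (((Real.cosh (k * x))⁻¹ : ℝ) : ℂ)) (Complex.ofRealCLM.contDiff.comp
    ((by fun_prop : ContDiff ℝ ∞ fun x => Real.cosh (k * x)).inv fun _ => (Real.cosh_pos _).ne'))

theorem sech_apply (k : ℝ) (f : TestFn) (x : ℝ) :
    (sech k f).1 x = (((Real.cosh (k * x))⁻¹ : ℝ) : ℂ) * f.1 x := rfl

theorem cs_sech (k : ℝ) (f : TestFn) : cs k (sech k f) = f := by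
  refine Subtype.ext (funext fun x => ?_)
  rw [cs_apply, sech_apply, ← mul_assoc, ← Complex.ofReal_mul,
    mul_inv_cancel₀ (Real.cosh_pos _).ne', Complex.ofReal_one, one_mul]

/-- Multiplication by `tanh (k x)`. -/
def th (k : ℝ) : TestFn →ₗ[ℂ] TestFn := sech k ∘ₗ sn k

theorem D_sech (k : ℝ) (f : TestFn) : D (sech k f) = sech k (D f - (k : ℂ) • th k f) := by
  have h1 : D (cs k (sech k f)) = D f := by rw [cs_sech]
  rw [D_cs] at h1
  have h2 : D (sech k f) = sech k (cs k (D (sech k f))) := by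
    refine Subtype.ext (funext fun x => ?_)
    rw [sech_apply, cs_apply, ← mul_assoc, ← Complex.ofReal_mul,
      inv_mul_cancel₀ (Real.cosh_pos _).ne', Complex.ofReal_one, one_mul]
  rw [h2, eq_sub_of_add_eq h1]
  refine Subtype.ext (funext fun x => ?_)
  simp only [th, LinearMap.comp_apply, sech_apply, sub_apply, smul_apply, sn_apply]
  ring

/-- Each derivative of a product with sech^j costs only a factor linear in j, so the C² norms along
the iteration grow at most quadratically in j. -/
theorem D_sech_pow (k : ℝ) (j : ℕ) (f : TestFn) :
    D ((sech k ^ j) f) = (sech k ^ j) (D f - (j * k : ℂ) • th k f) := by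
  have hc : Commute (th k) (sech k) := LinearMap.ext fun g => Subtype.ext (funext fun x => by
    rw [Module.End.mul_apply, Module.End.mul_apply]
    simp only [th, LinearMap.comp_apply, sech_apply, sn_apply]
    ring)
  induction j generalizing f with
  | zero => simp
  | succ j ih =>
    rw [pow_succ, Module.End.mul_apply, Module.End.mul_apply, ih, D_sech]
    have h1 : th k (sech k f) = sech k (th k f) := LinearMap.congr_fun hc.eq f
    rw [h1]
    congr 1
    simp only [map_sub, map_smul]
    push_cast
    module

theorem norm_sech_pow_le (k : ℝ) (j : ℕ) (f : TestFn) (x : ℝ) :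
    ‖((sech k ^ j) f).1 x‖ ≤ ‖f.1 x‖ := by
  induction j generalizing f with
  | zero => simp
  | succ j ih =>
    rw [pow_succ, Module.End.mul_apply]
    refine (ih _).trans ?_
    rw [sech_apply, norm_mul, Complex.norm_real, Real.norm_eq_abs,
      abs_of_pos (inv_pos.2 (Real.cosh_pos _))]
    exact mul_le_of_le_one_left (norm_nonneg _) (inv_le_one_of_one_le₀ (Real.one_le_cosh _))

theorem exists_boundedBy_sech_pow (k : ℝ) (f : TestFn) : ∃ R A : ℝ, 0 ≤ A ∧ ∀ j : ℕ,
    ((sech k ^ j) f).BoundedBy R (A * (1 + j + j ^ 2)) ∧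
      (D (D ((sech k ^ j) f))).BoundedBy R (A * (1 + j + j ^ 2)) := by
  obtain ⟨R, -, hR⟩ := f.exists_bound
  obtain ⟨M0, h0⟩ := f.exists_norm_le
  obtain ⟨M1, h1⟩ := (D (D f)).exists_norm_le
  obtain ⟨M2, h2⟩ := ((k : ℂ) • D (th k f) + (k : ℂ) • th k (D f)).exists_norm_le
  obtain ⟨M3, h3⟩ := ((k ^ 2 : ℂ) • th k (th k f)).exists_norm_le
  have p0 := (norm_nonneg _).trans (h0 0)
  have p1 := (norm_nonneg _).trans (h1 0)
  have p2 := (norm_nonneg _).trans (h2 0)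
  have p3 := (norm_nonneg _).trans (h3 0)
  refine ⟨R, M0 + M1 + M2 + M3, by positivity, fun j => ?_⟩
  have hsupp : ∀ x, R < |x| → ((sech k ^ j) f).1 x = 0 := fun x hx => by
    have := norm_sech_pow_le k j f x
    rw [hR x hx, norm_zero] at this
    exact norm_le_zero_iff.1 this
  have hj : (0 : ℝ) ≤ j := j.cast_nonneg
  refine ⟨⟨hsupp, fun x => (norm_sech_pow_le k j f x).trans ((h0 x).trans ?_)⟩,
    ⟨fun x hx => D_eq_zero (fun y hy => D_eq_zero hsupp y hy) x hx, fun x => ?_⟩⟩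
  · nlinarith [mul_nonneg p0 hj, mul_nonneg p0 (sq_nonneg (j : ℝ)),
      mul_nonneg (add_nonneg (add_nonneg p1 p2) p3)
        (by positivity : (0 : ℝ) ≤ 1 + j + (j : ℝ) ^ 2)]
  · have e : D (D ((sech k ^ j) f)) = (sech k ^ j) (D (D f)
        - (j : ℂ) • ((k : ℂ) • D (th k f) + (k : ℂ) • th k (D f))
        + (j : ℂ) ^ 2 • (k ^ 2 : ℂ) • th k (th k f)) := by
      rw [D_sech_pow, D_sech_pow]
      congr 1
      simp only [map_sub, map_smul]
      module
    rw [e]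
    refine (norm_sech_pow_le k j _ x).trans ?_
    rw [add_apply, sub_apply, smul_apply, smul_apply]
    refine (norm_add_le _ _).trans ((add_le_add (norm_sub_le _ _) le_rfl).trans ?_)
    rw [norm_mul, norm_mul, norm_pow, Complex.norm_natCast]
    have a1 := h1 x
    have a2 := mul_le_mul_of_nonneg_left (h2 x) hj
    have a3 := mul_le_mul_of_nonneg_left (h3 x) (sq_nonneg (j : ℝ))
    nlinarith [mul_nonneg p1 hj, mul_nonneg p1 (sq_nonneg (j : ℝ)), mul_nonneg p2 (sq_nonneg (j : ℝ)),
      mul_nonneg p3 hj, mul_nonneg p0 (by positivity : (0 : ℝ) ≤ 1 + j + (j : ℝ) ^ 2)]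

theorem tendsto_pow_mul_quadratic {a : ℝ} (ha0 : 0 ≤ a) (ha : a < 1) :
    Tendsto (fun i : ℕ => a ^ i * (1 + i + (i : ℝ) ^ 2)) atTop (𝓝 0) := by
  have h := fun n => tendsto_pow_const_mul_const_pow_of_abs_lt_one n
    (by rwa [abs_of_nonneg ha0] : |a| < 1)
  have h3 := ((h 0).add (h 1)).add (h 2)
  simp only [add_zero] at h3
  refine h3.congr fun i => ?_
  ring

end TestFn

/-- A uniformly bounded family whose product with `τ` vanishes is zero. -/
theorem eq_zero_of_theta_eq_zero {k : ℝ} (hk : k ∈ Set.Ioo (0 : ℝ) (1 / 2))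
    {δ : ℤ → TestFn →ₗ[ℂ] ℂ} (hδ : UniformC2 δ) (h : ∀ n, theta k δ n = 0) (n : ℤ) : δ n = 0 := by
  refine LinearMap.ext fun f => ?_
  obtain ⟨R, A, hA, hf⟩ := exists_boundedBy_sech_pow k f
  obtain ⟨B, hB, hb⟩ := hδ R
  have ha0 := ampl_pos hk
  have step : ∀ (n : ℤ) (g : TestFn),
      δ n g = -(ampl k / 2 : ℂ) * (δ (n + 1) (sech k g) + δ (n - 1) (sech k g)) := fun n g => by
    have h1 := LinearMap.congr_fun (h n) (sech k g)
    rw [theta_apply, cs_sech, LinearMap.zero_apply] at h1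
    linear_combination h1
  -- Each application of `step` produces two terms with weight a/2 and one more factor sech: the
  -- bound gains a factor a, while the seminorm of the test function grows polynomially. Since a < 1
  -- the bound tends to zero.
  have iter : ∀ (i j : ℕ) (n : ℤ), ‖δ n ((sech k ^ j) f)‖
      ≤ ampl k ^ i * (B * (A * (1 + ((i + j : ℕ) : ℝ) + ((i + j : ℕ) : ℝ) ^ 2))) := by
    intro i
    induction i with
    | zero =>
      intro j n
      rw [pow_zero, one_mul, zero_add]
      exact hb n _ _ (hf j).1 (hf j).2
    | succ i ih =>
      intro j n
      have e : sech k ((sech k ^ j) f) = (sech k ^ (j + 1)) f := by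
        rw [pow_succ', Module.End.mul_apply]
      rw [step, e, norm_mul, norm_neg, norm_div, Complex.norm_real, Real.norm_eq_abs,
        abs_of_pos ha0, Complex.norm_two]
      have h1 := ih (j + 1) (n + 1)
      have h2 := ih (j + 1) (n - 1)
      rw [show i + (j + 1) = i + 1 + j by ring] at h1 h2
      have h3 := mul_le_mul_of_nonneg_left ((norm_add_le _ _).trans (add_le_add h1 h2))
        (by positivity : 0 ≤ ampl k / 2)
      refine h3.trans (le_of_eq ?_)
      ring
  have hlim := (tendsto_pow_mul_quadratic ha0.le (ampl_lt_one hk)).const_mul (B * A)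
  rw [mul_zero] at hlim
  have h0 : ‖δ n f‖ ≤ 0 := ge_of_tendsto' hlim fun i => by
    have := iter i 0 n
    rw [pow_zero, Module.End.one_apply, add_zero] at this
    refine this.trans (le_of_eq ?_)
    ring
  exact norm_le_zero_iff.1 h0

end KPI

end

/-! ### Fourier uniqueness on the strip, and coefficients of explicit functions. -/

noncomputable section

namespace KPI

open SmoothFn TestFn

theorem periodic_eq_zero {k : ℝ} (hk : k ∈ Set.Ioo (0 : ℝ) (1 / 2)) {f : ℝ → ℂ}
    (hf : Continuous f) (hp : Function.Periodic f (period k))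
    (h : ∀ n : ℤ, ∫ y in (0 : ℝ)..period k,
      f y * Complex.exp ((n * freq k * Complex.I) * y) = 0) (y : ℝ) : f y = 0 := by
  have : Fact (0 < period k) := ⟨period_pos hk⟩
  let F : C(AddCircle (period k), ℂ) := ⟨hp.lift, continuous_coinduced_dom.2 hf⟩
  have hF : ∀ n, fourierCoeff F n = 0 := by
    intro n
    rw [fourierCoeff_eq_intervalIntegral _ n 0, zero_add]
    have e : ∀ y : ℝ, fourier (-n) (y : AddCircle (period k)) • F (y : AddCircle (period k))
        = f y * Complex.exp (((-n : ℤ) * freq k * Complex.I) * y) := by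
      intro y
      have hc : Complex.exp (2 * Real.pi * Complex.I * (-n : ℤ) * y / period k)
          = Complex.exp (((-n : ℤ) * freq k * Complex.I) * y) := by
        have h1 : (period k : ℂ) ≠ 0 := Complex.ofReal_ne_zero.2 (period_pos hk).ne'
        have h2 : (freq k : ℂ) * (period k : ℂ) = 2 * Real.pi := by
          exact_mod_cast freq_mul_period hk
        rw [← h2]
        congr 1
        field_simp
      rw [fourier_coe_apply, hc, smul_eq_mul, mul_comm]
      rfl
    simp only [e]
    rw [h (-n), smul_zero]
  have hs : Summable (fourierCoeff F) := by
    rw [show fourierCoeff F = fun _ => 0 from funext hF]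
    exact summable_zero
  have h1 := has_pointwise_sum_fourier_series_of_summable hs (y : AddCircle (period k))
  simp only [hF, zero_smul] at h1
  exact h1.unique hasSum_zero

theorem eq_zero_of_integral_mode {k : ℝ} (hk : k ∈ Set.Ioo (0 : ℝ) (1 / 2)) {ρ : ℝ → ℝ → ℂ}
    (hρ : Continuous fun p : ℝ × ℝ => ρ p.1 p.2) (hp : ∀ x, Function.Periodic (ρ x) (period k))
    (h : ∀ (n : ℤ) (f : TestFn),
      ∫ p : ℝ × ℝ, ρ p.1 p.2 * (mode k n f).1 p ∂(strip (period k)) = 0) (x y : ℝ) :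
    ρ x y = 0 := by
  refine periodic_eq_zero hk (hρ.comp (continuous_const.prodMk continuous_id)) (hp x)
    (fun n => ?_) y
  have hG : Continuous fun p : ℝ × ℝ => ρ p.1 p.2 * Complex.exp ((n * freq k * Complex.I) * p.2) :=
    hρ.mul (by fun_prop)
  have hc : Continuous fun x => ∫ y in (0 : ℝ)..period k,
      ρ x y * Complex.exp ((n * freq k * Complex.I) * y) :=
    intervalIntegral.continuous_parametric_intervalIntegral_of_continuous'
      (f := fun x y => ρ x y * Complex.exp ((n * freq k * Complex.I) * y)) hG 0 (period k)
  have hae := ae_eq_zero_of_integral_contDiff_smul_eq_zero (μ := volume) hc.locallyIntegrable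
    fun g hg hgs => by
      let f : TestFn := ⟨fun x => (g x : ℂ), Complex.ofRealCLM.contDiff.comp hg,
        hgs.comp_left (g := fun x : ℝ => (x : ℂ)) Complex.ofReal_zero⟩
      have h1 := h n f
      have hi := integrable_mul_mode k (period k) hρ n f
      rw [strip] at hi h1
      rw [integral_prod _ hi] at h1
      rw [← h1]
      refine integral_congr_ae (Eventually.of_forall fun x => ?_)
      beta_reduce
      rw [intervalIntegral.integral_of_le (period_pos hk).le, Complex.real_smul,
        ← integral_const_mul]
      refine integral_congr_ae (Eventually.of_forall fun y => ?_)
      change (g x : ℂ) * (ρ x y * Complex.exp ((n * freq k * Complex.I) * y))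
        = ρ x y * ((g x : ℂ) * Complex.exp ((n * freq k * Complex.I) * y))
      ring
  have := (hc.ae_eq_iff_eq volume continuous_const).1 hae
  exact congrFun this x

/-- Integration by parts in `x` over a period strip. -/
theorem stripCoeff_D_D (k : ℝ) (G : SmoothFn) (n : ℤ) (f : TestFn) :
    stripCoeff k G n (D (D f)) = stripCoeff k (dX (dX G)) n f := by
  change ∫ p : ℝ × ℝ, G.1 p * (mode k n (D (D f))).1 p ∂(strip (period k))
    = ∫ p : ℝ × ℝ, (dX (dX G)).1 p * (mode k n f).1 p ∂(strip (period k))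
  have h1 := integrable_mul_mode k (period k) G.continuous n (D (D f))
  have h2 := integrable_mul_mode k (period k) (dX (dX G)).continuous n f
  rw [strip] at h1 h2 ⊢
  rw [integral_prod_symm _ h1, integral_prod_symm _ h2]
  refine integral_congr_ae (Eventually.of_forall fun y => ?_)
  have h3 := integral_mul_D_D (G.hasDerivAt_dX · y) ((dX G).hasDerivAt_dX · y)
    ((dX (dX G)).continuous.comp (continuous_id.prodMk continuous_const)) f
  have h4 := congrArg (· * Complex.exp ((n * freq k * Complex.I) * y)) h3
  beta_reduce at h4 ⊢
  rw [← integral_mul_const, ← integral_mul_const] at h4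
  refine Eq.trans ?_ (h4.trans ?_)
  · exact integral_congr_ae (Eventually.of_forall fun x => (mul_assoc _ _ _).symm)
  · exact integral_congr_ae (Eventually.of_forall fun x => mul_assoc _ _ _)

theorem stripCoeff_apply (k : ℝ) (G : SmoothFn) (n : ℤ) (f : TestFn) : stripCoeff k G n f
    = ∫ p : ℝ × ℝ, (G * mode k n f).1 p ∂(strip (period k)) := rfl

theorem stripCoeff_add (k : ℝ) (G G' : SmoothFn) (n : ℤ) (f : TestFn) :
    stripCoeff k (G + G') n f = stripCoeff k G n f + stripCoeff k G' n f := by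
  rw [stripCoeff, LinearMap.coe_mk, AddHom.coe_mk]
  have h1 := integrable_mul_mode k (period k) G.continuous n f
  have h2 := integrable_mul_mode k (period k) G'.continuous n f
  refine Eq.trans ?_ (integral_add h1 h2)
  exact integral_congr_ae (Eventually.of_forall fun p => add_mul _ _ _)

theorem stripCoeff_const_mul (k : ℝ) (c : ℂ) (G : SmoothFn) (n : ℤ) (f : TestFn) :
    stripCoeff k (const c * G) n f = c * stripCoeff k G n f := by
  refine Eq.trans ?_ (integral_const_mul c _)
  exact integral_congr_ae (Eventually.of_forall fun p => mul_assoc _ _ _)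

theorem stripCoeff_C_mul (k : ℝ) (G : SmoothFn) (n : ℤ) (f : TestFn) :
    stripCoeff k (G * C k) n f = stripCoeff k G n (cs k f) := by
  rw [stripCoeff_apply, stripCoeff_apply, ← C_mul_mode, mul_assoc]

theorem stripCoeff_S (k : ℝ) (n : ℤ) (f : TestFn) :
    stripCoeff k (S k) n f = stripCoeff k 1 n (sn k f) := by
  rw [stripCoeff_apply, stripCoeff_apply, ← S_mul_mode, one_mul]

theorem integral_mode_add (k : ℝ) (m n : ℤ) (G : SmoothFn) (f g : TestFn) :
    ∫ p : ℝ × ℝ, (G * (mode k m f + mode k n g)).1 p ∂(strip (period k))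
      = stripCoeff k G m f + stripCoeff k G n g := by
  have h1 := integrable_mul_mode k (period k) G.continuous m f
  have h2 := integrable_mul_mode k (period k) G.continuous n g
  refine Eq.trans ?_ (integral_add h1 h2)
  exact integral_congr_ae (Eventually.of_forall fun p => mul_add _ _ _)

theorem stripCoeff_co_mul (k : ℝ) (G : SmoothFn) (n : ℤ) (f : TestFn) :
    stripCoeff k (G * co k) n f = stripCoeff k G (n + 1) ((ampl k / 2 : ℂ) • f)
      + stripCoeff k G (n - 1) ((ampl k / 2 : ℂ) • f) := by
  rw [stripCoeff_apply, mul_assoc, co_mul_mode, integral_mode_add]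

theorem stripCoeff_si (k : ℝ) (n : ℤ) (f : TestFn) :
    stripCoeff k (si k) n f = stripCoeff k 1 (n + 1) (-(ampl k / 2 * Complex.I : ℂ) • f)
      + stripCoeff k 1 (n - 1) ((ampl k / 2 * Complex.I : ℂ) • f) := by
  rw [stripCoeff_apply, ← one_mul (si k), mul_assoc, si_mul_mode, integral_mode_add]

theorem theta_stripCoeff (k : ℝ) (G : SmoothFn) (n : ℤ) (f : TestFn) :
    theta k (stripCoeff k G) n f = stripCoeff k (G * (C k + co k)) n f := by
  rw [theta_apply, mul_add G, stripCoeff_add, stripCoeff_C_mul, stripCoeff_co_mul, map_smul, map_smul,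
    smul_eq_mul, smul_eq_mul, mul_add]

theorem stripCoeff_one {k : ℝ} (hk : k ∈ Set.Ioo (0 : ℝ) (1 / 2)) (n : ℤ) (f : TestFn) :
    stripCoeff k 1 n f = (if n = 0 then (period k : ℂ) else 0) * expInt 0 f := by
  have h1 := integral_prod_mul (μ := (volume : Measure ℝ))
    (ν := (volume : Measure ℝ).restrict (Set.Ioc 0 (period k))) f.1
    (fun y => Complex.exp ((n * freq k * Complex.I) * y))
  have h2 : stripCoeff k 1 n f = ∫ p : ℝ × ℝ, f.1 p.1 *
      Complex.exp ((n * freq k * Complex.I) * p.2) ∂(strip (period k)) :=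
    integral_congr_ae (Eventually.of_forall fun p => one_mul _)
  have h3 : expInt 0 f = ∫ x, f.1 x := by
    change ∫ x : ℝ, Complex.exp (-0 * x) * f.1 x = _
    simp
  rw [h2, strip, h1, h3, mul_comm, ← intervalIntegral.integral_of_le (period_pos hk).le]
  congr 1
  split_ifs with hn
  · simp [hn]
  · have hc : (n * freq k * Complex.I : ℂ) ≠ 0 := mul_ne_zero (mul_ne_zero
      (Int.cast_ne_zero.2 hn) (Complex.ofReal_ne_zero.2 (freq_pos hk).ne')) Complex.I_ne_zero
    rw [integral_exp_mul_complex hc]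
    have h4 : Complex.exp (n * freq k * Complex.I * period k) = 1 := by
      have h : (freq k : ℂ) * (period k : ℂ) = 2 * Real.pi := by
        exact_mod_cast freq_mul_period hk
      rw [Complex.exp_eq_one_iff]
      exact ⟨n, by linear_combination (n * Complex.I) * h⟩
    rw [h4]
    simp

end KPI

end

/-! ### Identification of ψ and conclusion. -/

noncomputable section

namespace KPI

open SmoothFn TestFn

theorem uniformC2_stripCoeff (k : ℝ) (G : SmoothFn) : UniformC2 (stripCoeff k G) := fun R => by
  obtain ⟨B, hB, hb⟩ := exists_norm_integral_strip_le G.continuous k (period k) R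
  exact ⟨B, hB, fun n f m hf _ => hb n f m hf⟩

theorem theta_sub (k : ℝ) (ψ ψ' : ℤ → TestFn →ₗ[ℂ] ℂ) (n : ℤ) :
    theta k (fun n => ψ n - ψ' n) n = theta k ψ n - theta k ψ' n := LinearMap.ext fun f => by
  simp only [theta_apply, LinearMap.sub_apply]
  ring

namespace SmoothFn

variable {k : ℝ} (hk : k ∈ Set.Ioo (0 : ℝ) (1 / 2))

theorem dX_const_mul (c : ℂ) (g : SmoothFn) : dX (const c * g) = const c * dX g := by
  rw [Derivation.leibniz, dX_const, smul_zero, add_zero, smul_eq_mul]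

/-- The derivatives of the profile are the second derivatives of `S / τ` and `si / τ`. -/
theorem dX_prof_and_dY_prof :
    2 * const k * dX (dX (S k * ti hk)) = dX (prof hk) ∧
      -(2 * const (freq k)) * dX (dX (si k * ti hk)) = dY (prof hk) := by
  have hτ := tau_mul_ti hk
  obtain ⟨comm, Xk, Yk, Xw, Yw, XC, XS, YC, YS, Xco, Xsi, Yco, Ysi, hyp, trig, -, -⟩ := tauRing hk
  have h1 : dX (ti hk) = -(const k * S k * ti hk ^ 2) := by
    have := congrArg dX hτ
    rw [Derivation.leibniz, Derivation.map_one_eq_zero, map_add, XC, Xco, smul_eq_mul,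
      smul_eq_mul] at this
    linear_combination ti hk * this - dX (ti hk) * hτ
  have h2 : dY (ti hk) = const (freq k) * si k * ti hk ^ 2 := by
    have := congrArg dY hτ
    rw [Derivation.leibniz, Derivation.map_one_eq_zero, map_add, YC, Yco, smul_eq_mul,
      smul_eq_mul] at this
    linear_combination ti hk * this - dY (ti hk) * hτ
  -- kS/τ and -w si/τ are the x- and y-derivatives of ln τ; the claims follow from Q = 2∂ₓ² ln τ and
  -- the equality of mixed derivatives (`h4`, `h5`).
  have h3 : prof hk = 2 * dX (const k * S k * ti hk) := by
    rw [prof, Derivation.leibniz, Derivation.leibniz, Xk, XS, h1]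
    simp only [smul_eq_mul]
    linear_combination (2 * const (k : ℂ) ^ 2 * C k * ti hk) * hτ
      + 2 * const (k : ℂ) ^ 2 * ti hk ^ 2 * hyp
  have h4 : dX (si k * ti hk) = -(const k * si k * S k * ti hk ^ 2) := by
    rw [Derivation.leibniz, Xsi, h1, smul_zero, add_zero, smul_eq_mul]
    ring
  have h5 : dY (const k * S k * ti hk) = const (freq k) * (const k * si k * S k * ti hk ^ 2) := by
    rw [Derivation.leibniz, Derivation.leibniz, Yk, YS, h2, smul_zero, smul_zero, add_zero,
      smul_zero, add_zero, smul_eq_mul]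
    ring
  have h6 (g : SmoothFn) : dX (2 * g) = 2 * dX g := by rw [two_mul, two_mul, map_add]
  have h7 (g : SmoothFn) : dY (2 * g) = 2 * dY g := by rw [two_mul, two_mul, map_add]
  constructor
  · rw [h3, h6, mul_assoc (const _), dX_const_mul, dX_const_mul]
    ring
  · rw [h3, h7, comm, h5, h4, dX_const_mul, map_neg]
    ring

theorem dX_prof_apply (x y : ℝ) : (dX (prof hk)).1 (x, y) = (dx (Q k) x y : ℂ) := by
  have h1 := (prof hk).hasDerivAt_dX x y
  have hQ : ContDiff ℝ 1 (fun p : ℝ × ℝ => Q k p.1 p.2) := by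
    simp only [Q_eq hk]
    exact (contDiff_profile hk).of_le (WithTop.coe_le_coe.2 le_top)
  have h2 := (hasDerivAt_dx hQ x y).ofReal_comp
  simp only [prof_apply, ← Q_eq hk] at h1
  exact h1.unique h2

theorem dY_prof_apply (x y : ℝ) : (dY (prof hk)).1 (x, y) = (dy (Q k) x y : ℂ) := by
  have h1 := (prof hk).hasDerivAt_dY x y
  have hQ : ContDiff ℝ 1 (fun p : ℝ × ℝ => Q k p.1 p.2) := by
    simp only [Q_eq hk]
    exact (contDiff_profile hk).of_le (WithTop.coe_le_coe.2 le_top)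
  have h2 := (hasDerivAt_dy hQ x y).ofReal_comp
  simp only [prof_apply, ← Q_eq hk] at h1
  exact h1.unique h2

end SmoothFn

variable {k : ℝ} {φ : ℝ → ℝ → ℝ}

/-- A kernel function has the potential `(c₁ S + c₂ si) / τ`. -/
theorem KernelFn.exists_stripCoeff (hk : k ∈ Set.Ioo (0 : ℝ) (1 / 2)) (h : KernelFn k φ) :
    ∃ c₁ c₂ : ℂ, ∀ n f,
      h.four n f = stripCoeff k ((const c₁ * S k + const c₂ * si k) * ti hk) n (D (D f)) := by
  obtain ⟨u, hu, ψ₀, hψ₀, hψu, htemp⟩ := h.exists_isPotential hk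
  obtain ⟨s, hs, ψ, hψe, hψ, h2, h1, hD⟩ := hψ₀.exists_normalized htemp
  obtain ⟨α₀, β₀, hsf⟩ := exists_affine hs
  have hv : Continuous fun x : ℝ => u x - (α₀ + β₀ * x) := by fun_prop
  have hac : Continuous fun x : ℝ => α₀ + β₀ * (x : ℂ) := by fun_prop
  -- After normalization ψ_0 is still integration against a continuous function, since only an
  -- affine function was subtracted. This is required for the uniform bound on ψ.
  have hψ0 : ψ 0 = integralMul _ hv := by
    rw [hψe, Function.update_self]
    refine LinearMap.ext fun f => ?_
    rw [LinearMap.sub_apply, hψu, hsf]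
    change (∫ x, u x * f.1 x) - ∫ x : ℝ, (α₀ + β₀ * x) * f.1 x
      = ∫ x : ℝ, (u x - (α₀ + β₀ * x)) * f.1 x
    rw [← integral_sub (f.integrable_mul hu) (f.integrable_mul hac)]
    exact integral_congr_ae (Eventually.of_forall fun x => (sub_mul _ _ _).symm)
  obtain ⟨α, hα⟩ := hψ.theta_one_eq h2 h1 hD
  obtain ⟨γ, hγ⟩ := hψ.theta_zero_eq h2 h1
  have ht : (period k : ℂ) ≠ 0 := Complex.ofReal_ne_zero.2 (period_pos hk).ne'
  have ha : (ampl k : ℂ) ≠ 0 := Complex.ofReal_ne_zero.2 (ampl_pos hk).ne'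
  -- The constants match the coefficient of c₁ sinh(kx) at frequency 0 with θ_0, and that of c₂ a
  -- sin(wy) at frequency 1 with θ_1; frequency -1 then agrees because both are odd.
  set c₁ : ℂ := 2 * γ / period k with hc₁
  set c₂ : ℂ := α / (period k * (ampl k / 2 * Complex.I)) with hc₂
  have hc₁' : c₁ * period k = 2 * γ := div_mul_cancel₀ _ ht
  have hc₂' : c₂ * (period k * (ampl k / 2 * Complex.I)) = α :=
    div_mul_cancel₀ _ (mul_ne_zero ht (mul_ne_zero (div_ne_zero ha two_ne_zero) Complex.I_ne_zero))
  set G : SmoothFn := (const c₁ * S k + const c₂ * si k) * ti hk with hG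
  have hGτ : G * (C k + co k) = const c₁ * S k + const c₂ * si k := by
    rw [hG]
    linear_combination (const c₁ * S k + const c₂ * si k) * tau_mul_ti hk
  have hθ : ∀ n f, theta k (stripCoeff k G) n f
      = c₁ * ((if n = 0 then (period k : ℂ) else 0) * ((1 / 2) * (expInt (-k) f - expInt k f)))
        + c₂ * ((ampl k / 2 * Complex.I) * ((if n - 1 = 0 then (period k : ℂ) else 0)
          - (if n + 1 = 0 then (period k : ℂ) else 0)) * expInt 0 f) := by
    intro n f
    rw [theta_stripCoeff, hGτ, stripCoeff_add, stripCoeff_const_mul, stripCoeff_const_mul,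
      stripCoeff_S, stripCoeff_si, stripCoeff_one hk, stripCoeff_one hk, stripCoeff_one hk,
      expInt_sn, map_smul, map_smul, smul_eq_mul, smul_eq_mul]
    ring
  have hzero : ∀ n, theta k (fun n => ψ n - stripCoeff k G n) n = 0 := by
    intro n
    rw [theta_sub, sub_eq_zero]
    refine LinearMap.ext fun f => ?_
    rw [hθ]
    rcases eq_or_ne n 0 with rfl | hn0
    · rw [hγ]
      simp only [LinearMap.smul_apply, LinearMap.sub_apply, smul_eq_mul, if_true, zero_sub,
        zero_add, neg_eq_zero, one_ne_zero, if_false]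
      linear_combination (-(1 / 2) * (expInt (-k) f - expInt k f)) * hc₁'
    rcases eq_or_ne n 1 with rfl | hn1
    · rw [hα]
      norm_num
      linear_combination (-(expInt 0 f)) * hc₂'
    rcases eq_or_ne n (-1) with rfl | hn2
    · rw [h1, hα]
      norm_num
      linear_combination (-(expInt 0 f)) * hc₂'
    · have e1 : n - 1 ≠ 0 := sub_ne_zero.2 hn1
      have e2 : n + 1 ≠ 0 := fun h => hn2 (eq_neg_of_add_eq_zero_left h)
      rw [h2 n (by rcases abs_cases n with ⟨h, _⟩ | ⟨h, _⟩ <;> omega), if_neg hn0, if_neg e1,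
        if_neg e2]
      simp
  have hψG : ∀ n, ψ n = stripCoeff k G n := fun n =>
    sub_eq_zero.1 (eq_zero_of_theta_eq_zero hk
      ((hψ.uniformC2 hv hψ0).sub (uniformC2_stripCoeff k G)) hzero n)
  exact ⟨c₁, c₂, fun n f => by rw [hψ.four_eq, hψG]⟩

theorem KernelFn.eq_second_derivative (hk : k ∈ Set.Ioo (0 : ℝ) (1 / 2)) (h : KernelFn k φ) :
    ∃ c₁ c₂ : ℂ, ∀ x y, (φ x y : ℂ)
      = (dX (dX ((const c₁ * S k + const c₂ * si k) * ti hk))).1 (x, y) := by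
  obtain ⟨c₁, c₂, hc⟩ := h.exists_stripCoeff hk
  refine ⟨c₁, c₂, fun x y => sub_eq_zero.1 ?_⟩
  set G : SmoothFn := (const c₁ * S k + const c₂ * si k) * ti hk with hG
  have hGp : G ∈ yPeriodic (period k) :=
    mul_mem (add_mem (mul_mem (const_mem_yPeriodic _ _) fun _ _ => rfl)
      (mul_mem (const_mem_yPeriodic _ _) (si_mem_yPeriodic hk))) (ti_mem_yPeriodic hk)
  have hGp2 := dX_mem_yPeriodic (dX_mem_yPeriodic hGp)
  refine eq_zero_of_integral_mode hk (ρ := fun x y => (φ x y : ℂ) - (dX (dX G)).1 (x, y))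
    (h.continuous_ofReal.sub (dX (dX G)).continuous) (fun x y => ?_) (fun n f => ?_) x y
  · change (φ x (y + period k) : ℂ) - (dX (dX G)).1 (x, y + period k) = _
    rw [h.periodic x y, hGp2 x y]
  · have h1 := hc n f
    rw [stripCoeff_D_D, h.four_eq_integral] at h1
    have e := integral_sub (integrable_mul_mode k (period k) h.continuous_ofReal n f)
      (integrable_mul_mode k (period k) (dX (dX G)).continuous n f)
    refine Eq.trans ?_ (e.trans (sub_eq_zero.2 h1))
    exact integral_congr_ae (Eventually.of_forall fun p => sub_mul _ _ _)

theorem KernelFn.exists_eq (hk : k ∈ Set.Ioo (0 : ℝ) (1 / 2)) (h : KernelFn k φ) :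
    ∃ c₁ c₂ : ℝ, ∀ x y, φ x y = c₁ * dx (Q k) x y + c₂ * dy (Q k) x y := by
  obtain ⟨c₁, c₂, hc⟩ := h.eq_second_derivative hk
  have hk0 : (k : ℂ) ≠ 0 := Complex.ofReal_ne_zero.2 hk.1.ne'
  have hw0 : (freq k : ℂ) ≠ 0 := Complex.ofReal_ne_zero.2 (freq_pos hk).ne'
  -- Since φ, ∂ₓQ and ∂_yQ are real, the real parts of the complex constants suffice.
  refine ⟨(c₁ / (2 * k)).re, (-(c₂ / (2 * freq k))).re, fun x y => ?_⟩
  obtain ⟨h1, h2⟩ := dX_prof_and_dY_prof hk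
  have e1 : (2 * k : ℂ) * (dX (dX (S k * ti hk))).1 (x, y) = (dx (Q k) x y : ℂ) := by
    rw [← dX_prof_apply hk, ← h1]; rfl
  have e2 : -(2 * freq k : ℂ) * (dX (dX (si k * ti hk))).1 (x, y) = (dy (Q k) x y : ℂ) := by
    rw [← dY_prof_apply hk, ← h2]; rfl
  have e3 : dX (dX ((const c₁ * S k + const c₂ * si k) * ti hk))
      = const c₁ * dX (dX (S k * ti hk)) + const c₂ * dX (dX (si k * ti hk)) := by
    simp only [add_mul, mul_assoc, map_add, dX_const_mul]
  have e4 : (φ x y : ℂ) = c₁ / (2 * k) * (dx (Q k) x y : ℂ)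
      + -(c₂ / (2 * freq k)) * (dy (Q k) x y : ℂ) := by
    rw [hc x y, e3, ← e1, ← e2]
    change c₁ * _ + c₂ * _ = _
    field_simp
  have e5 := congrArg Complex.re e4
  rw [Complex.ofReal_re, Complex.add_re, Complex.re_mul_ofReal, Complex.re_mul_ofReal] at e5
  exact e5

end KPI

end

theorem theorem4 (k : ℝ) (hk : 0 < k) (hk' : k < 1 / 2)
    (φ : ℝ → ℝ → ℝ) (hφ : ContDiff ℝ 4 (fun p : ℝ × ℝ => φ p.1 p.2))
    (hdecay : KPI.DecaysInX φ)
    (hper : ∀ x, Function.Periodic (φ x) (KPI.period k))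
    (hsol : ∀ x y, KPI.linearized (KPI.Q k) φ x y = 0) :
    ∃ c₁ c₂ : ℝ, ∀ x y,
      φ x y = c₁ * KPI.dx (KPI.Q k) x y + c₂ * KPI.dy (KPI.Q k) x y :=
  KPI.KernelFn.exists_eq ⟨hk, hk'⟩ ⟨hφ, hdecay, hper, hsol⟩
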